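/- **Setting.** Let $0<\lambda<1$. An IFS $(f_1,\dots,f_M)$ is a finite family of homeomorphisms of the plane $\mathbb C$ with a common Lipschitz constant $<1$. Words and strings in the letters $1,\dots,M$ are ordered lexicographically with $1>2>\dots>M$. A sequence $(F_n)_{n\ge1}$ of IFSs $F_n=(f^{(n)}_1,\dots,f^{(n)}_M)$, all of whose maps have contraction ratio $\lambda$, is a *sequential IFS (SIFS)* if $f_i^{(n)}\to f_i$ uniformly for every $i$ and $(f_1,\dots,f_M)$ is an IFS. Let $T$ be a finite set of fewer than $M$ tiles (nonempty compact sets homeomorphic to the closed disc), and $\alpha$ a surjection from the indices onto $T$. Put $\pi_T(j_1\cdots j_k)=f^{(k)}_{j_1}f^{(k-1)}_{j_2}\cdots f^{(1)}_{j_k}(\alpha(j_k))$, and let $$\widetilde\pi_T(w)=\overline{\pi_T(w)\setminus\textstyle\bigcup_{v>w,\,|v|=|w|}\pi_T(v)}$$ be the processed tile. Let $\Sigma_{T,k}$ be the set of words $w$ of length $k$ for which $\widetilde\pi_T(w)$ is congruent to an element of $\lambda^kT$ (reflections allowed), and let $\Sigma$ be the set of top addresses of the limit IFS, i.e. of those strings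 $\mathbf j$ that are the largest string with $\lim_m f_{j_1}\cdots f_{j_m}(x)=p$, for some point $p$ of its attractor. The triple $((F_n),T,\alpha)$ is a *tiling SIFS* if for all $k\ge1$ 1. (first condition) every processed tile of depth $k$ is empty or congruent to an element of $\lambda^kT$; 2. (second condition) $\Sigma_{T,k}=\{\mathbf j|k:\mathbf j\in\Sigma\}$, where letters $i,i'$ with equal limit maps $f_i=f_{i'}$ are identified. **Theorem.** Let $c\in[0,1]$ and let $T_c$ be the polygon (curve and interior) with successive vertices $0$, $2i(1-c)$, $(1-c)(\sqrt3+3i)$, $(1-c)(\sqrt3+3i)+c(-1+\sqrt3i)$, $(1-c)(\sqrt3+3i)+c(1+3\sqrt3i)$, $(1-c)(\sqrt3+3i)+c(3+3\sqrt3i)$, $(1-c)(\sqrt3+i)+c(3+3\sqrt3i)$, $2(1-c)\sqrt3+c(3+3\sqrt3i)$, $2(1-c)\sqrt3+c(2+2\sqrt3i)$, $2(1-c)\sqrt3+c(3+\sqrt3i)$, $(1-c)(\sqrt3-i)+c(3+\sqrt3i)$, $c(3+\sqrt3i)$, $2c$. Let $\phi=\left(\frac{1+\sqrt5}2\right)^{-2}$,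 let $\mathsf F_m$ be the Fibonacci numbers ($\mathsf F_0=0$, $\mathsf F_1=\mathsf F_2=1$), and for $n\ge1$ let $F_{n,c}=(f^{(n)}_1,\dots,f^{(n)}_8)$, where $f_1^{(n)}(z)=\phi z$, $$\begin{aligned} f_2^{(n)}(z)&=\phi e^{-i\pi/3}z+\phi^n\big[\sqrt3(1-c)(\mathsf F_{2n+2}-2)+3c(\mathsf F_{2n-1}-1)\big]+i\phi^n\big[3(1-c)\mathsf F_{2n-1}+c\sqrt3(2\mathsf F_{2n+1}+\mathsf F_{2n-1}-1)\big],\\ f_3^{(n)}(z)&=\phi e^{-2i\pi/3}z+\phi^n\big[3\sqrt3(1-c)(\mathsf F_{2n+1}-1)+3c(2\mathsf F_{2n-1}+\mathsf F_{2n+1}-2)\big]+i\phi^n\big[-3(1-c)(\mathsf F_{2n-2}-1)+3c\sqrt3\,\mathsf F_{2n+1}\big],\\ f_4^{(n)}(z)&=\phi e^{2i\pi/3}z+\phi^n\big[2\sqrt3(1-c)\mathsf F_{2n+1}+3c(2\mathsf F_{2n+2}-1)\big]+i\phi^n\big[-6(1-c)(\mathsf F_{2n+1}-1)-c\sqrt3(2\mathsf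 F_{2n-1}-3)\big],\\ f_5^{(n)}(z)&=\phi e^{i\pi/3}z+\phi^n\big[\sqrt3(1-c)(\mathsf F_{2n}+1)+9c\,\mathsf F_{2n}\big]+i\phi^n\big[-3(1-c)(\mathsf F_{2n-1}+\mathsf F_{2n+1}-1)+c\sqrt3(-\mathsf F_{2n-1}-\mathsf F_{2n+1}+2)\big],\\ f_6^{(n)}(z)&=\phi z+\phi^n\big[\sqrt3(1-c)(\mathsf F_{2n}+\mathsf F_{2n-2})+3c(\mathsf F_{2n}+\mathsf F_{2n-2})\big]+i\phi^n\big[-3(1-c)\mathsf F_{2n-1}+c\sqrt3\,\mathsf F_{2n-1}\big],\\ f_7^{(n)}(z)&=\phi z+\phi^n\big[\sqrt3(1-c)(\mathsf F_{2n+1}+\mathsf F_{2n-1})+3c(\mathsf F_{2n+1}+\mathsf F_{2n-1})\big]+i\phi^n\big[-3(1-c)\mathsf F_{2n}+c\sqrt3\,\mathsf F_{2n}\big], \end{aligned}$$ $f_8^{(1)}(z)=\phi\bar z+\phi\big[2\sqrt3(1-c)+6c+4\sqrt3\,c\,i\big]$, and $f_8^{(n)}=f_6^{(n)}$ for $n\ge2$.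 Then: - $((F_{n,c})_{n\ge1},\{T_c\},i\mapsto T_c)$ is a tiling SIFS with contraction ratio $\phi$; - $\Sigma_{\{T_c\},k}$ consists of exactly the words $j_1\cdots j_k$ that do not contain $71$ and in which the letter $8$ occurs at most as the last letter $j_k$ (the letter applied at level $1$); for these words $\widetilde\pi_T(w)=\pi_T(w)$; - $\{\mathbf j|k:\mathbf j\in\Sigma\}$ consists of exactly the words of length $k$ in the letters $1,\dots,7$ that do not contain $71$; - $f_6^{(n+1)}\circ f_7^{(n)}=f_7^{(n+1)}\circ f_1^{(n)}$ for all $n\ge1$; - for every $k\ge1$ the nonempty processed tiles of depth $k$ form the $k$-th supertile $H_8^{(k)}$ of the imperfect substitution, where $H_8^{(1)}=\{f^{(1)}_i(T_c):1\le i\le8\}$, $H_7^{(1)}=\{f^{(1)}_i(T_c):2\le i\le8\}$, and for $k\ge2$, $H_8^{(k)}=\bigcup_{i=1}^6f_i^{(k)}(H_8^{(k-1)})\cup f_7^{(k)}(H_7^{(k-1)})$, $H_7^{(k)}=\bigcup_{i=2}^6f_i^{(k)}(H_8^{(k-1)})\cup f_7^{(k)}(H_7^{(k-1)})$. -/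

import Mathlib

noncomputable section

/-! ### Iterated function systems, addresses and the top code space -/

section General

variable {E : Type*} [NormedAddCommGroup E] [NormedSpace ℝ E] {M : ℕ}

/-- A finite family of contractive homeomorphisms, with a common contraction constant
`lam` strictly between `0` and `1`. -/
def IsIFS (f : Fin M → E → E) : Prop :=
  ∃ lam : ℝ, 0 < lam ∧ lam < 1 ∧
    ∀ i, IsHomeomorph (f i) ∧ ∀ x y, dist (f i x) (f i y) ≤ lam * dist x y

/-- `TopGT u v`: the string `u` is larger than the string `v` in the lexicographic order
used for top addresses, in which the letters are ordered `1 > 2 > ⋯ > M`. The index `i`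
of the text is represented by the element `i - 1` of `Fin M`. -/
def TopGT {ι : Type} [LT ι] (u v : ι → Fin M) : Prop :=
  ∃ m, (∀ l, l < m → u l = v l) ∧ u m < v m

/-- `wordMap F k (j₁ ⋯ jₖ) = f_{j₁}^{(k)} ∘ f_{j₂}^{(k-1)} ∘ ⋯ ∘ f_{jₖ}^{(1)}`. The maps of
the `n`-th system are `F n`, where `n ≥ 1`; the value `F 0` is never used. -/
def wordMap (F : ℕ → Fin M → E → E) : (k : ℕ) → (Fin k → Fin M) → E → E
  | 0, _ => id
  | k + 1, w => F (k + 1) (w 0) ∘ wordMap F k (fun l => w l.succ)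

/-- `j` is an address of the point `x` for the system `f`:
`f_{j₁} ∘ ⋯ ∘ f_{jₘ} (y) → x` as `m → ∞`, for every `y`, that is, `x = π(j)`. -/
def IsAddress (f : Fin M → E → E) (j : ℕ → Fin M) (x : E) : Prop :=
  ∀ y : E, Filter.Tendsto (fun m : ℕ => wordMap (fun _ => f) m (fun l => j l) y)
    Filter.atTop (nhds x)

/-- The top code space `Σ`: the strings which are, for some point `x` of the attractor,
the largest address of `x`. The attractor is the set of all points that have an address. -/
def topCodeSpace (f : Fin M → E → E) : Set (ℕ → Fin M) :=
  {j | ∃ x, IsAddress f j x ∧ ∀ j', IsAddress f j' x → j' = j ∨ TopGT j j'}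

/-! ### Sequential iterated function systems -/

/-- Uniform convergence of `f_i^{(n)}` to `f_i`, for every index `i`. -/
def ConvergesTo (F : ℕ → Fin M → E → E) (f : Fin M → E → E) : Prop :=
  ∀ i, TendstoUniformly (fun n => F n i) (f i) Filter.atTop

/-- A sequential IFS all of whose maps have contraction ratio exactly `lam`. -/
structure IsSIFS (lam : ℝ) (F : ℕ → Fin M → E → E) : Prop where
  isIFS : ∀ n, 1 ≤ n → IsIFS (F n)
  ratio : ∀ n, 1 ≤ n → ∀ i x y, dist (F n i x) (F n i y) = lam * dist x y
  exists_limit : ∃ f : Fin M → E → E, IsIFS f ∧ ConvergesTo F f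

/-- A tile: a nonempty compact set homeomorphic to the closed unit ball. -/
def IsTile (K : Set E) : Prop :=
  K.Nonempty ∧ IsCompact K ∧ Nonempty (K ≃ₜ Metric.closedBall (0 : E) 1)

/-- An SIFS system: an SIFS, a finite set `T` of fewer than `M` tiles, and a surjection
`α` from the indices onto `T`. -/
structure IsSIFSSystem (lam : ℝ) (F : ℕ → Fin M → E → E) (T : Set (Set E))
    (α : Fin M → Set E) : Prop where
  isSIFS : IsSIFS lam F
  finite : T.Finite
  isTile : ∀ t ∈ T, IsTile t
  card_lt : T.ncard < M
  range_eq : Set.range α = T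

/-- `π_T(j₁ ⋯ jₖ) = f_{j₁}^{(k)} ⋯ f_{jₖ}^{(1)} (α(jₖ))`, for words of positive length. -/
def tileAt (F : ℕ → Fin M → E → E) (α : Fin M → Set E) {k : ℕ}
    (w : Fin (k + 1) → Fin M) : Set E :=
  wordMap F (k + 1) w '' α (w (Fin.last k))

/-- The processed tile: the closure of what remains of `π_T(w)` when all tiles with a
larger address of the same length are removed. -/
def processedTile (F : ℕ → Fin M → E → E) (α : Fin M → Set E) {k : ℕ}
    (w : Fin (k + 1) → Fin M) : Set E :=
  closure (tileAt F α w \ ⋃ (v : Fin (k + 1) → Fin M) (_ : TopGT v w), tileAt F α v)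

/-- The processed `(k+1)`-collection: all nonempty processed tiles of depth `k + 1`. -/
def processedCollection (F : ℕ → Fin M → E → E) (α : Fin M → Set E) (k : ℕ) :
    Set (Set E) :=
  {s | s.Nonempty ∧ ∃ w : Fin (k + 1) → Fin M, s = processedTile F α w}

/-- `K` is a copy of an element of `r T`: the image of some `t ∈ T` scaled by `r`, under an
isometry of the space. -/
def IsCopyOf (r : ℝ) (T : Set (Set E)) (K : Set E) : Prop :=
  ∃ t ∈ T, ∃ g : E ≃ᵢ E, K = (fun x => g (r • x)) '' t

/-- First condition: at each depth `k`, every processed tile is empty or a copy of an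
element of `lam ^ k T`. -/
def FirstCondition (lam : ℝ) (F : ℕ → Fin M → E → E) (T : Set (Set E))
    (α : Fin M → Set E) : Prop :=
  ∀ (k : ℕ) (w : Fin (k + 1) → Fin M),
    processedTile F α w = ∅ ∨ IsCopyOf (lam ^ (k + 1)) T (processedTile F α w)

/-- `Σ_{T,k+1}`: the addresses of length `k + 1` of tiles that do not vanish when they are
processed. -/
def tileAddresses (lam : ℝ) (F : ℕ → Fin M → E → E) (T : Set (Set E))
    (α : Fin M → Set E) (k : ℕ) : Set (Fin (k + 1) → Fin M) :=
  {w | IsCopyOf (lam ^ (k + 1)) T (processedTile F α w)}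

/-- Second condition: at each depth `k`, the set `Σ_{T,k}` agrees with the set of
truncations `j|k` of the top addresses `j` of the limit system `f`. Indices `i`, `i'` that
have become redundant copies of each other in the limit, `f i = f i'`, are not
distinguished. (If the limit maps are pairwise distinct, this is equality of the two
sets of words.) -/
def SecondCondition (lam : ℝ) (F : ℕ → Fin M → E → E) (T : Set (Set E))
    (α : Fin M → Set E) : Prop :=
  ∃ f : Fin M → E → E, IsIFS f ∧ ConvergesTo F f ∧
    ∀ (k : ℕ) (u : Fin (k + 1) → Fin M),
      (∃ w ∈ tileAddresses lam F T α k, ∀ l, f (u l) = f (w l)) ↔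
        ∃ j ∈ topCodeSpace f, ∀ l : Fin (k + 1), f (u l) = f (j l)

/-- A tiling SIFS: an SIFS system that satisfies the first and the second condition. -/
structure IsTilingSIFS (lam : ℝ) (F : ℕ → Fin M → E → E) (T : Set (Set E))
    (α : Fin M → Set E) : Prop where
  isSIFSSystem : IsSIFSSystem lam F T α
  first : FirstCondition lam F T α
  second : SecondCondition lam F T α

end General

/-! ### The hat polygons -/

/-- The closed polygonal curve through the given points. -/
def polygonCurve {n : ℕ} [NeZero n] (v : Fin n → ℂ) : Set ℂ :=
  ⋃ i : Fin n, segment ℝ (v i) (v (i + 1))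

/-- The polygon with the given successive vertices, as a region: the closed polygonal
curve together with all points that it encloses (the bounded components of its
complement). -/
def polygonRegion {n : ℕ} [NeZero n] (v : Fin n → ℂ) : Set ℂ :=
  polygonCurve v ∪
    {z | z ∉ polygonCurve v ∧ Bornology.IsBounded (connectedComponentIn (polygonCurve v)ᶜ z)}

/-- The vertices of `T_c`. -/
def hatVertex (c : ℝ) : Fin 13 → ℂ :=
  let s : ℂ := (Real.sqrt 3 : ℂ)
  let i : ℂ := Complex.I
  let d : ℂ := 1 - (c : ℂ)
  ![0,
    d * (2 * i),
    d * (s + 3 * i),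
    d * (s + 3 * i) + c * (-1 + s * i),
    d * (s + 3 * i) + c * (1 + 3 * i * s),
    d * (s + 3 * i) + c * (3 + 3 * i * s),
    d * (s + i) + c * (3 + 3 * i * s),
    2 * d * s + c * (3 + 3 * i * s),
    2 * d * s + c * (2 + 2 * i * s),
    2 * d * s + c * (3 + s * i),
    d * (s - i) + c * (3 + s * i),
    c * (3 + s * i),
    2 * c]

/-- The prototile `T_c`. -/
def hatTile (c : ℝ) : Set ℂ := polygonRegion (hatVertex c)

/-! ### The explicit sequence of systems -/

/-- The contraction factor `φ`, the golden mean to the power `-2`. -/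
def hatRatio : ℝ := (Real.goldenRatio ^ 2)⁻¹

/-- The map `z ↦ φ e^{i m π / 3} z + φ^n (a + i b)`. -/
def hatAffine (n : ℕ) (m : ℤ) (a b : ℝ) (z : ℂ) : ℂ :=
  (hatRatio : ℂ) * Complex.exp (Complex.I * ((m : ℂ) * (Real.pi : ℂ) / 3)) * z
    + (hatRatio : ℂ) ^ n * ((a : ℂ) + Complex.I * (b : ℂ))

/-- `fibR m` is the `m`-th Fibonacci number as a real number (`fibR 1 = fibR 2 = 1`). -/
def fibR (m : ℕ) : ℝ := (Nat.fib m : ℝ)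

/-- The map `f_6^{(n)}`. -/
def hatSix (c : ℝ) (n : ℕ) : ℂ → ℂ :=
  hatAffine n 0
    (Real.sqrt 3 * (1 - c) * (fibR (2 * n) + fibR (2 * n - 2))
      + 3 * c * (fibR (2 * n) + fibR (2 * n - 2)))
    (-3 * (1 - c) * fibR (2 * n - 1) + c * Real.sqrt 3 * fibR (2 * n - 1))

/-- The systems `F_{n,c} = (f_1^{(n)}, …, f_8^{(n)})`, for `n ≥ 1`. -/
def hatSIFS (c : ℝ) (n : ℕ) : Fin 8 → ℂ → ℂ :=
  let s : ℝ := Real.sqrt 3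
  ![fun z => (hatRatio : ℂ) * z,
    hatAffine n (-1)
      (s * (1 - c) * (fibR (2 * n + 2) - 2) + 3 * c * (fibR (2 * n - 1) - 1))
      (3 * (1 - c) * fibR (2 * n - 1)
        + c * s * (2 * fibR (2 * n + 1) + fibR (2 * n - 1) - 1)),
    hatAffine n (-2)
      (3 * s * (1 - c) * (fibR (2 * n + 1) - 1)
        + 3 * c * (2 * fibR (2 * n - 1) + fibR (2 * n + 1) - 2))
      (-3 * (1 - c) * (fibR (2 * n - 2) - 1) + 3 * c * s * fibR (2 * n + 1)),
    hatAffine n 2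
      (2 * s * (1 - c) * fibR (2 * n + 1) + 3 * c * (2 * fibR (2 * n + 2) - 1))
      (-6 * (1 - c) * (fibR (2 * n + 1) - 1) - c * s * (2 * fibR (2 * n - 1) - 3)),
    hatAffine n 1
      (s * (1 - c) * (fibR (2 * n) + 1) + 9 * c * fibR (2 * n))
      (-3 * (1 - c) * (fibR (2 * n - 1) + fibR (2 * n + 1) - 1)
        + c * s * (-fibR (2 * n - 1) - fibR (2 * n + 1) + 2)),
    hatSix c n,
    hatAffine n 0
      (s * (1 - c) * (fibR (2 * n + 1) + fibR (2 * n - 1))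
        + 3 * c * (fibR (2 * n + 1) + fibR (2 * n - 1)))
      (-3 * (1 - c) * fibR (2 * n) + c * s * fibR (2 * n)),
    if n = 1 then
      fun z => (hatRatio : ℂ) * (starRingEnd ℂ) z
        + (hatRatio : ℂ) * (((2 * s * (1 - c) + 6 * c : ℝ) : ℂ)
          + Complex.I * ((4 * s * c : ℝ) : ℂ))
    else hatSix c n]

/-! ### The imperfect substitution -/

/-- The image of a collection of sets under a map. -/
def mapCollection (g : ℂ → ℂ) (S : Set (Set ℂ)) : Set (Set ℂ) := (fun s => g '' s) '' S

/-- The supertiles of level `k + 1` of the imperfect substitution, normalised to the scale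
`φ^(k+1)`, as a pair (`H_8`-supertile, `H_7`-supertile). At level `1` these are the
clusters `H_8` and `H_7`, where `H_8` has `H_7` and one further tile, in the first place.
At higher levels each of the tiles in the places `1, …, 6` of the cluster is replaced with
an `H_8`-supertile of one level less, and the pair of tiles in the places `7` and `8` is
replaced with a single `H_7`-supertile of one level less. -/
def hatSupertiles (c : ℝ) : ℕ → Set (Set ℂ) × Set (Set ℂ)
  | 0 =>
    let h7 : Set (Set ℂ) := {s | ∃ i : Fin 8, i ≠ 0 ∧ s = hatSIFS c 1 i '' hatTile c}
    ({hatSIFS c 1 0 '' hatTile c} ∪ h7, h7)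
  | k + 1 =>
    let p := hatSupertiles c k
    let f := hatSIFS c (k + 2)
    let h7 : Set (Set ℂ) := mapCollection (f 1) p.1 ∪ mapCollection (f 2) p.1 ∪
      mapCollection (f 3) p.1 ∪ mapCollection (f 4) p.1 ∪ mapCollection (f 5) p.1 ∪
      mapCollection (f 6) p.2
    (mapCollection (f 0) p.1 ∪ h7, h7)

/-- The word does not contain `71` (two consecutive letters). -/
def Avoids71 {k : ℕ} (w : Fin (k + 1) → Fin 8) : Prop :=
  ∀ l : Fin k, ¬ (w l.castSucc = 6 ∧ w l.succ = 0)

end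

/-! Undoing the contraction turns every map into a rigid motion: f_i^{(n+1)}(φ^n z) = φ^{n+1} U(z)
with an isometry U (`hatSIFS_scaled`). A word then describes the position of a hat of unit size, and
the admissible words (no `71`, the letter `8` at most at the end) name the tiles of the supertiles,
which are kept as lists of motions (`frames`).

The geometric core is that the tiles of a supertile do not overlap. The boundary of a supertile
consists of superedges of three types X, H, E. A superedge of level n+1 is a chain of superedges of
level n, by a rule that depends neither on n nor on c. End points are written over the Eisenstein
integers in two edge vectors A, B and two vectors α, β of the level, so the identity "the boundaries
of the parts add up to the subdivided boundary of the whole" is one finite cancellation of integer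
data. Applied to the angles seen from a point p, it shows that the sweeps of all tiles add up to the
sweep of the boundary of the supertile (`frameSweep_frames`). Seen from outside a suitable disc, a
superedge has the same sweep as its chord (`exists_isTube`). Hence for large n the boundary of the
H₈-supertile winds exactly once around the points of a disc whose radius grows like φ^{-n}
(`exists_totalSweep_boundary8`). The hat is a topological disc, so its boundary has one winding
number m at all interior points and 0 outside. Thus m times the covering number is 1, and generic
points of the disc are covered exactly once (`eventually_coverCount_eq_one`). Every supertile has a
copy inside such a disc, so its tiles do not overlap (`pairwise_frames`), and large supertiles cover
the discs (`eventually_covers`).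

Processing is then formal. By f_6 f_7 = f_7 f_1, and since `8` repeats `6` from level 2 on, a word
that is not admissible has the same map as a larger word, and its processed tile is empty. Every
tile of a larger word is the tile of a larger admissible word, so it misses the interior of an
admissible tile, which is therefore unchanged (`processedTile_of_admissible`).

For the second condition, top addresses of the limit system avoid `71` and `8` for the same reason.
Conversely, the limits of the H₈- and H₇-supertiles satisfy a pair of set equations with matrix (6
1; 5 1). The limit of H₈ contains a disc, by passing to the limit in the covering statement, so its
area is positive. As φ^{-2} is the Perron eigenvalue of the matrix, no area may be lost and the
pieces overlap in null sets (`volume_inter_pieces`). So for each word avoiding `71` and `8` some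
point has all its allowed addresses, in particular its top address, beginning with that word
(`exists_topCodeSpace_iff`). -/

open Complex

/-! ### The position lattice -/

/-- Multiplication of `x + y ω` by `ω = exp (iπ/3)`. -/
def eisRot (z : ℤ × ℤ) : ℤ × ℤ := (-z.2, z.1 + z.2)

/-- Formal positions: `(p, q, x, y)` stands for `p α + q β + x A + y B`, with coefficients
`x + y ω` and with `α`, `β` depending on the level. -/
abbrev Pos : Type := (ℤ × ℤ) × (ℤ × ℤ) × (ℤ × ℤ) × (ℤ × ℤ)

/-- Rotation of a position by `π/3`. -/
def Pos.turn (S : Pos) : Pos := (eisRot S.1, eisRot S.2.1, eisRot S.2.2.1, eisRot S.2.2.2)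

/-- Rotation of a position by `r π/3`. -/
def Pos.rot : ℕ → Pos → Pos
  | 0, S => S
  | r + 1, S => (Pos.rot r S).turn

/-- Sum of positions. -/
def Pos.plus (S S' : Pos) : Pos :=
  ((S.1.1 + S'.1.1, S.1.2 + S'.1.2), (S.2.1.1 + S'.2.1.1, S.2.1.2 + S'.2.1.2),
    (S.2.2.1.1 + S'.2.2.1.1, S.2.2.1.2 + S'.2.2.1.2),
    (S.2.2.2.1 + S'.2.2.2.1, S.2.2.2.2 + S'.2.2.2.2))

/-- A position of level `n + 1`, written in the coordinates of level `n`. -/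
def Pos.shift (S : Pos) : Pos :=
  ((S.1.1 + S.2.1.1, S.1.2 + S.2.1.2), (S.1.1 + 2 * S.2.1.1, S.1.2 + 2 * S.2.1.2),
    S.2.2.1, S.2.2.2)

/-- A position of the lowest level, written in edge vectors only. -/
def Pos.ground (S : Pos) : Pos :=
  ((0, 0), (0, 0),
    (S.2.2.1.1 + S.1.1 + S.2.1.1, S.2.2.1.2 + S.1.2 + S.2.1.2),
    (S.2.2.2.1 + (eisRot S.1).1 + 2 * (eisRot S.2.1).1 - S.2.1.1,
      S.2.2.2.2 + (eisRot S.1).2 + 2 * (eisRot S.2.1).2 - S.2.1.2))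

/-- The types of boundary arcs: three superedges and the two edges of the tile. -/
inductive Arc
  | X | H | E | A | B

/-- A code for the type of an arc. -/
def Arc.code : Arc → ℕ
  | .X => 0 | .H => 1 | .E => 2 | .A => 3 | .B => 4

/-- The displacement along an arc. -/
def Arc.disp : Arc → Pos
  | .X => ((4, -2), (0, 0), (-2, 2), (-4, 2))
  | .H => ((0, 1), (1, 0), (0, -1), (1, -2))
  | .E => ((-2, 1), (1, 0), (1, -1), (2, -1))
  | .A => ((0, 0), (0, 0), (1, 0), (0, 0))
  | .B => ((0, 0), (0, 0), (0, 0), (1, 0))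

/-- A placed arc: sign, type, rotation and starting position. -/
structure Term where
  s : ℤ
  arc : Arc
  r : ℕ
  pos : Pos

/-- The image of a placed arc under a rotation and a translation. -/
def Term.place (r : ℕ) (S : Pos) (t : Term) : Term :=
  ⟨t.s, t.arc, r + t.r, S.plus (t.pos.rot r)⟩

/-- The oppositely oriented placed arc. -/
def Term.neg (t : Term) : Term := ⟨-t.s, t.arc, t.r, t.pos⟩

/-- Equality of the arcs underlying two terms. -/
def Term.same (t t' : Term) : Bool :=
  t.arc.code == t'.arc.code && t.r == t'.r && t.pos == t'.pos

/-- Normal form of a term: arcs with a half-turn symmetry get a rotation below `3`. -/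
def Term.norm (t : Term) : Term :=
  let r := t.r % 6
  match t.arc with
  | .H => ⟨t.s, .H, r, t.pos⟩
  | .E => ⟨t.s, .E, r, t.pos⟩
  | k => if 3 ≤ r then ⟨-t.s, k, r - 3, t.pos.plus (k.disp.rot r)⟩ else ⟨t.s, k, r, t.pos⟩

/-- Do the terms of the list cancel, up to `fuel` steps? -/
def cancels : ℕ → List Term → Bool
  | 0, l => l.isEmpty
  | _ + 1, [] => true
  | m + 1, t :: l =>
    (((l.filter t.same).map Term.s).sum + t.s == 0) && cancels m (l.filter fun t' => !t.same t')

/-- Subdivision of the boundary arc `X` of the next level. -/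
def ruleX : List Term :=
  [⟨1, .X, 0, ((0,0),(0,0),(0,0),(0,0))⟩,
    ⟨1, .E, 0, ((4,-2),(0,0),(-2,2),(-4,2))⟩,
    ⟨-1, .E, 2, ((1,1),(2,-1),(-1,0),(-1,-1))⟩,
    ⟨1, .X, 5, ((1,1),(2,-1),(-1,0),(-1,-1))⟩,
    ⟨1, .E, 5, ((3,-3),(2,-1),(-1,2),(-3,3))⟩,
    ⟨-1, .E, 3, ((0,0),(4,-2),(0,0),(0,0))⟩,
    ⟨1, .X, 0, ((0,0),(4,-2),(0,0),(0,0))⟩]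

/-- Subdivision of the boundary arc `H` of the next level. -/
def ruleH : List Term :=
  [⟨1, .H, 0, ((0,0),(0,0),(0,0),(0,0))⟩,
    ⟨-1, .H, 4, ((-1,2),(1,1),(1,-2),(3,-3))⟩,
    ⟨1, .X, 0, ((-1,2),(1,1),(1,-2),(3,-3))⟩,
    ⟨1, .E, 0, ((3,0),(1,1),(-1,0),(-1,-1))⟩]

/-- Subdivision of the boundary arc `E` of the next level. -/
def ruleE : List Term :=
  [⟨1, .H, 1, ((0,0),(0,0),(0,0),(0,0))⟩]

/-- The arc `X` of the lowest level, as a path of tile edges. -/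
def pathX : List Term :=
  [⟨1, .A, 0, ((0,0),(0,0),(0,0),(0,0))⟩,
    ⟨1, .B, 2, ((0,0),(0,0),(1,0),(0,0))⟩,
    ⟨1, .B, 1, ((0,0),(0,0),(1,0),(-1,1))⟩,
    ⟨1, .B, 1, ((0,0),(0,0),(1,0),(-1,2))⟩,
    ⟨1, .B, 2, ((0,0),(0,0),(1,0),(-1,3))⟩,
    ⟨1, .A, 0, ((0,0),(0,0),(1,0),(-2,4))⟩]

/-- The arc `H` of the lowest level, as a path of tile edges. -/
def pathH : List Term :=
  [⟨1, .A, 0, ((0,0),(0,0),(0,0),(0,0))⟩,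
    ⟨1, .B, 2, ((0,0),(0,0),(1,0),(0,0))⟩]

/-- The boundary of the `H₈`-supertile, as a closed path of arcs. -/
def boundary8 : List Term :=
  [⟨1, .X, 0, ((0,0),(0,0),(0,1),(0,0))⟩,
    ⟨1, .E, 0, ((4,-2),(0,0),(-2,3),(-4,2))⟩,
    ⟨-1, .E, 2, ((1,1),(2,-1),(-1,1),(-1,-1))⟩,
    ⟨1, .X, 5, ((1,1),(2,-1),(-1,1),(-1,-1))⟩,
    ⟨1, .E, 5, ((3,-3),(2,-1),(-1,3),(-3,3))⟩,
    ⟨-1, .E, 1, ((3,0),(3,-3),(-2,2),(-3,0))⟩,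
    ⟨1, .X, 4, ((3,0),(3,-3),(-2,2),(-3,0))⟩,
    ⟨1, .H, 5, ((1,-2),(3,-3),(0,2),(-1,2))⟩,
    ⟨-1, .H, 3, ((2,-1),(5,-4),(-1,1),(-1,-1))⟩,
    ⟨1, .E, 2, ((2,-1),(5,-4),(-1,1),(-1,-1))⟩,
    ⟨-1, .E, 0, ((5,-4),(3,-3),(-2,3),(-4,2))⟩,
    ⟨-1, .X, 0, ((1,-2),(3,-3),(0,1),(0,0))⟩,
    ⟨1, .H, 4, ((1,-2),(3,-3),(0,1),(0,0))⟩,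
    ⟨-1, .H, 0, ((2,-4),(2,-4),(-1,3),(-3,3))⟩,
    ⟨1, .X, 2, ((2,-4),(2,-4),(-1,3),(-3,3))⟩,
    ⟨1, .E, 2, ((0,0),(2,-4),(-1,1),(-1,-1))⟩,
    ⟨-1, .E, 4, ((0,-3),(1,-2),(0,2),(-1,2))⟩,
    ⟨1, .X, 1, ((0,-3),(1,-2),(0,2),(-1,2))⟩,
    ⟨1, .H, 2, ((2,-1),(1,-2),(-2,2),(-3,0))⟩,
    ⟨-1, .H, 4, ((0,0),(0,0),(0,1),(0,0))⟩]

/-- The boundary of the `H₇`-supertile, as a closed path of arcs. -/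
def boundary7 : List Term :=
  [⟨1, .X, 1, ((0,-3),(1,-2),(0,2),(-1,2))⟩,
    ⟨1, .E, 1, ((2,-1),(1,-2),(-2,2),(-3,0))⟩,
    ⟨-1, .E, 3, ((-1,-1),(2,-1),(0,1),(0,0))⟩,
    ⟨1, .X, 0, ((-1,-1),(2,-1),(0,1),(0,0))⟩,
    ⟨1, .E, 0, ((3,-3),(2,-1),(-2,3),(-4,2))⟩,
    ⟨-1, .E, 2, ((0,0),(4,-2),(-1,1),(-1,-1))⟩,
    ⟨1, .H, 3, ((0,0),(4,-2),(-1,1),(-1,-1))⟩,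
    ⟨-1, .H, 5, ((-1,-1),(2,-1),(0,2),(-1,2))⟩,
    ⟨1, .E, 4, ((-1,-1),(2,-1),(0,2),(-1,2))⟩,
    ⟨-1, .E, 0, ((2,-1),(1,-2),(-2,3),(-4,2))⟩,
    ⟨1, .H, 1, ((2,-1),(1,-2),(-2,3),(-4,2))⟩,
    ⟨-1, .H, 3, ((1,1),(2,-1),(-1,1),(-1,-1))⟩,
    ⟨1, .X, 5, ((1,1),(2,-1),(-1,1),(-1,-1))⟩,
    ⟨1, .E, 5, ((3,-3),(2,-1),(-1,3),(-3,3))⟩,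
    ⟨-1, .E, 1, ((3,0),(3,-3),(-2,2),(-3,0))⟩,
    ⟨1, .X, 4, ((3,0),(3,-3),(-2,2),(-3,0))⟩,
    ⟨1, .H, 5, ((1,-2),(3,-3),(0,2),(-1,2))⟩,
    ⟨-1, .H, 3, ((2,-1),(5,-4),(-1,1),(-1,-1))⟩,
    ⟨1, .E, 2, ((2,-1),(5,-4),(-1,1),(-1,-1))⟩,
    ⟨-1, .E, 0, ((5,-4),(3,-3),(-2,3),(-4,2))⟩,
    ⟨-1, .X, 0, ((1,-2),(3,-3),(0,1),(0,0))⟩,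
    ⟨1, .H, 4, ((1,-2),(3,-3),(0,1),(0,0))⟩,
    ⟨-1, .H, 0, ((2,-4),(2,-4),(-1,3),(-3,3))⟩,
    ⟨1, .X, 2, ((2,-4),(2,-4),(-1,3),(-3,3))⟩,
    ⟨1, .E, 2, ((0,0),(2,-4),(-1,1),(-1,-1))⟩,
    ⟨-1, .E, 4, ((0,-3),(1,-2),(0,2),(-1,2))⟩]

/-- The boundary of the hat, as a closed path of edges. -/
def tileEdges : List Term :=
  [⟨1, .A, 1, ((0,0),(0,0),(0,0),(0,0))⟩,
    ⟨1, .A, 0, ((0,0),(0,0),(0,1),(0,0))⟩,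
    ⟨1, .B, 2, ((0,0),(0,0),(1,1),(0,0))⟩,
    ⟨1, .B, 1, ((0,0),(0,0),(1,1),(-1,1))⟩,
    ⟨1, .B, 1, ((0,0),(0,0),(1,1),(-1,2))⟩,
    ⟨1, .B, 0, ((0,0),(0,0),(1,1),(-1,3))⟩,
    ⟨1, .A, 4, ((0,0),(0,0),(1,1),(0,3))⟩,
    ⟨1, .A, 5, ((0,0),(0,0),(1,0),(0,3))⟩,
    ⟨1, .B, 4, ((0,0),(0,0),(2,-1),(0,3))⟩,
    ⟨1, .B, 5, ((0,0),(0,0),(2,-1),(0,2))⟩,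
    ⟨1, .A, 3, ((0,0),(0,0),(2,-1),(1,1))⟩,
    ⟨1, .A, 2, ((0,0),(0,0),(1,-1),(1,1))⟩,
    ⟨1, .B, 4, ((0,0),(0,0),(0,0),(1,1))⟩,
    ⟨1, .B, 3, ((0,0),(0,0),(0,0),(1,0))⟩]

/-- The subdivision rule of an arc. -/
def Arc.rule : Arc → List Term
  | .X => ruleX
  | .H => ruleH
  | .E => ruleE
  | .A => [⟨1, .A, 0, ((0, 0), (0, 0), (0, 0), (0, 0))⟩]
  | .B => [⟨1, .B, 0, ((0, 0), (0, 0), (0, 0), (0, 0))⟩]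

/-- The arcs of the lowest level as paths of tile edges. -/
def Arc.path : Arc → List Term
  | .X => pathX
  | .H => pathH
  | .E => []
  | .A => [⟨1, .A, 0, ((0, 0), (0, 0), (0, 0), (0, 0))⟩]
  | .B => [⟨1, .B, 0, ((0, 0), (0, 0), (0, 0), (0, 0))⟩]

/-- Subdivision of a list of placed arcs of level `n + 1` into arcs of level `n`. -/
def subdivide (l : List Term) : List Term :=
  l.flatMap fun t => (t.arc.rule.map (Term.place t.r t.pos.shift)).map fun t' =>
    ⟨t.s * t'.s, t'.arc, t'.r, t'.pos⟩

/-- Subdivision of a list of placed arcs of the lowest level into tile edges. -/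
def toEdges (l : List Term) : List Term :=
  l.flatMap fun t => (t.arc.path.map (Term.place t.r t.pos)).map fun t' =>
    ⟨t.s * t'.s, t'.arc, t'.r, t'.pos⟩

/-- The motions of the substitution: rotation and translation. -/
def motion (i : Fin 7) : ℕ × Pos :=
  ![(0, ((0,0),(0,0),(0,0),(0,0))), (5, ((1,1),(2,-1),(-2,1),(-1,-1))),
    (4, ((3,0),(3,-3),(-3,3),(-3,0))), (2, ((2,-4),(2,-4),(0,3),(-3,3))),
    (1, ((0,-3),(1,-2),(1,1),(-1,2))), (0, ((-1,-1),(2,-1),(0,0),(0,0))),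
    (0, ((2,-1),(1,-2),(0,0),(0,0)))] i

/-- A tile edge reflected in the real axis. -/
def Term.mirror (t : Term) : Term :=
  ⟨t.s, t.arc, match t.arc with | .A => 11 - t.r | _ => 12 - t.r,
    ((0, 0), (0, 0), (t.pos.2.2.1.1, -t.pos.2.2.1.1 - t.pos.2.2.1.2),
      (t.pos.2.2.2.1 + t.pos.2.2.2.2, -t.pos.2.2.2.2))⟩

/-- The boundaries of the `H₈`-supertiles in the places `lo, …, 6` and of the `H₇`-supertile
in the seventh place. -/
def blocks (lo : List (Fin 7)) : List Term :=
  (lo.flatMap fun i => boundary8.map (Term.place (motion i).1 (motion i).2.shift)) ++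
    boundary7.map (Term.place (motion 6).1 (motion 6).2.shift)

/-- The boundaries of the tiles of the clusters. -/
def tileBlocks (lo : List (Fin 7)) : List Term :=
  (lo.flatMap fun i => tileEdges.map (Term.place (motion i).1 (motion i).2)) ++
    (tileEdges.map (Term.place (motion 6).1 (motion 6).2) ++
      ((tileEdges.map Term.mirror).map
        (Term.place 0 ((0, 0), (0, 0), (2, -1), (1, 4)))).map Term.neg)

/-- This check and its three companions are the combinatorial heart of the proof. They hold in the
free abelian group on placed arcs, hence for all levels and all values of c at once. The fuel only
has to suffice: a shortage makes the check fail and cannot make it succeed wrongly. -/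
theorem cancels_blocks8 : cancels 400 ((blocks [0, 1, 2, 3, 4, 5] ++
    (subdivide boundary8).map Term.neg).map Term.norm) = true := by decide +kernel

theorem cancels_blocks7 : cancels 400 ((blocks [1, 2, 3, 4, 5] ++
    (subdivide boundary7).map Term.neg).map Term.norm) = true := by decide +kernel

theorem cancels_tileBlocks8 : cancels 400 (((tileBlocks [0, 1, 2, 3, 4, 5] ++
    (toEdges boundary8).map Term.neg).map fun t => ⟨t.s, t.arc, t.r, t.pos.ground⟩).map
      Term.norm) = true := by decide +kernel

theorem cancels_tileBlocks7 : cancels 400 (((tileBlocks [1, 2, 3, 4, 5] ++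
    (toEdges boundary7).map Term.neg).map fun t => ⟨t.s, t.arc, t.r, t.pos.ground⟩).map
      Term.norm) = true := by decide +kernel

/-- The arc `X` and its half-turn, with opposite orientations. -/
def turnedX : List Term :=
  [⟨1, .X, 0, ((0, 0), (0, 0), (0, 0), (0, 0))⟩, ⟨1, .X, 3, Arc.X.disp⟩]

/-- Inductive step for the half-turn symmetry of X: traversing X and then its half-turn returns to
the start, and after one subdivision everything cancels, provided that the X arcs of the lower level
already have the symmetry used by `Term.norm`. -/
theorem cancels_turnedX : cancels 40 ((subdivide turnedX).map Term.norm) = true := by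
  decide +kernel

theorem cancels_turnedX_ground :
    cancels 40 (((toEdges turnedX).map fun t => ⟨t.s, t.arc, t.r, t.pos.ground⟩).map
      Term.norm) = true := by
  decide +kernel

/-! ### Angles swept by placed arcs, and their invariance under subdivision and cancellation -/

noncomputable section

open Complex

/-! ### Evaluation of formal positions -/

/-- The primitive sixth root of unity `ω = exp (iπ/3)`. -/
def hexRoot : ℂ := 1 / 2 + (Real.sqrt 3 : ℂ) / 2 * I

theorem sqrt_three_sq : (Real.sqrt 3 : ℂ) ^ 2 = 3 := by
  rw [← Complex.ofReal_pow, Real.sq_sqrt (by norm_num)]; norm_num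

theorem hexRoot_sq : hexRoot ^ 2 = hexRoot - 1 := by
  unfold hexRoot
  linear_combination (1 / 4 : ℂ) * I ^ 2 * sqrt_three_sq + (3 / 4 : ℂ) * I_sq

theorem hexRoot_pow_three : hexRoot ^ 3 = -1 := by
  linear_combination (hexRoot + 1) * hexRoot_sq

theorem hexRoot_pow_six : hexRoot ^ 6 = 1 := by
  linear_combination (hexRoot ^ 3 - 1) * hexRoot_pow_three

theorem hexRoot_ne_zero : hexRoot ≠ 0 := by
  intro h
  have := hexRoot_pow_six
  simp [h] at this

theorem norm_hexRoot : ‖hexRoot‖ = 1 := by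
  have h : ‖hexRoot‖ ^ 6 = 1 := by rw [← norm_pow, hexRoot_pow_six, norm_one]
  exact (pow_eq_one_iff_of_nonneg (norm_nonneg _) (by norm_num)).1 h

theorem hexRoot_eq_exp : hexRoot = Complex.exp (I * ((Real.pi : ℂ) / 3)) := by
  have h : I * ((Real.pi : ℂ) / 3) = ((Real.pi / 3 : ℝ) : ℂ) * I := by push_cast; ring
  rw [h, Complex.exp_mul_I, ← Complex.ofReal_cos, ← Complex.ofReal_sin, Real.cos_pi_div_three,
    Real.sin_pi_div_three]
  unfold hexRoot
  push_cast
  ring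

theorem conj_hexRoot : (starRingEnd ℂ) hexRoot = 1 - hexRoot := by
  unfold hexRoot
  simp only [map_add, map_mul, map_div₀, map_one, Complex.conj_I, Complex.conj_ofReal, map_ofNat]
  ring

/-- The complex number `x + y ω`. -/
def eis (z : ℤ × ℤ) : ℂ := z.1 + z.2 * hexRoot

theorem eis_eisRot (z : ℤ × ℤ) : eis (eisRot z) = hexRoot * eis z := by
  unfold eis eisRot
  push_cast
  linear_combination (-(z.2 : ℂ)) * hexRoot_sq

/-- The half edge vector of the edges of the first kind, for `c = 0`. -/
def edgeUnit : ℂ := (Real.sqrt 3 : ℂ) + I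

/-- The two basic displacements of level `n`. -/
def scales (a b : ℝ) : ℕ → ℂ × ℂ
  | 0 => (a * edgeUnit + 2 * b * hexRoot, a * edgeUnit + 2 * b * (2 * hexRoot - 1))
  | n + 1 =>
    ((scales a b n).1 + (scales a b n).2, (scales a b n).1 + 2 * (scales a b n).2)

/-- The point of the plane with a given formal position, at level `n`. -/
def Pos.ev (a b : ℝ) (n : ℕ) (S : Pos) : ℂ :=
  eis S.1 * (scales a b n).1 + eis S.2.1 * (scales a b n).2 + eis S.2.2.1 * (a * edgeUnit) +
    eis S.2.2.2 * (2 * b)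

variable {a b : ℝ} {n : ℕ}

theorem Pos.ev_turn (S : Pos) : S.turn.ev a b n = hexRoot * S.ev a b n := by
  simp only [Pos.ev, Pos.turn, eis_eisRot]; ring

theorem Pos.ev_rot (r : ℕ) (S : Pos) : (S.rot r).ev a b n = hexRoot ^ r * S.ev a b n := by
  induction r with
  | zero => simp [Pos.rot]
  | succ r ih => rw [Pos.rot, Pos.ev_turn, ih]; ring

theorem Pos.ev_plus (S S' : Pos) : (S.plus S').ev a b n = S.ev a b n + S'.ev a b n := by
  simp only [Pos.ev, Pos.plus, eis]; push_cast; ring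

theorem Pos.ev_shift (S : Pos) : S.shift.ev a b n = S.ev a b (n + 1) := by
  simp only [Pos.ev, Pos.shift, eis, scales]; push_cast; ring

theorem Pos.ev_ground (S : Pos) : S.ground.ev a b 0 = S.ev a b 0 := by
  simp only [Pos.ev, Pos.ground, eis, scales, eisRot]; push_cast
  linear_combination (- 2 * (b : ℂ) * (S.1.2 + 2 * S.2.1.2)) * hexRoot_sq

/-! ### Oriented angles -/

/-- The oriented angle from `w` to `z`, with value `0` for opposite directions. -/
def turnAngle (z w : ℂ) : ℝ := if arg (z / w) = Real.pi then 0 else arg (z / w)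

/-- This is why `turnAngle` is 0 for opposite directions: with the value π antisymmetry would fail
there. So reversed edges cancel for every observer p, even for one on an edge, and the boundary
identities hold without exceptional points. -/
theorem turnAngle_symm (z w : ℂ) : turnAngle w z = -turnAngle z w := by
  unfold turnAngle
  have h : w / z = (z / w)⁻¹ := by rw [inv_div]
  rw [h, Complex.arg_inv]
  by_cases h' : arg (z / w) = Real.pi
  · simp [h']
  · rw [if_neg h', if_neg h', if_neg]
    intro h2
    have := Complex.neg_pi_lt_arg (z / w)
    linarith

theorem turnAngle_mul_left {ζ : ℂ} (h : ζ ≠ 0) (z w : ℂ) :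
    turnAngle (ζ * z) (ζ * w) = turnAngle z w := by
  unfold turnAngle; rw [mul_div_mul_left _ _ h]

theorem turnAngle_conj (z w : ℂ) :
    turnAngle ((starRingEnd ℂ) z) ((starRingEnd ℂ) w) = -turnAngle z w := by
  unfold turnAngle
  rw [← map_div₀, Complex.arg_conj]
  by_cases h' : arg (z / w) = Real.pi
  · simp [h']
  · rw [if_neg h', if_neg h', if_neg]
    intro h2
    have := Complex.neg_pi_lt_arg (z / w)
    linarith

/-! ### Angles swept by boundary arcs -/

/-- The vector of an edge of the tile. -/
def edgeVec (a b : ℝ) : Arc → ℂ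
  | .A => a * edgeUnit
  | _ => 2 * b

/-- The angle swept by an arc of level `n`, placed at the origin, as seen from `p`. -/
def sweep (a b : ℝ) : ℕ → Arc → ℂ → ℝ
  | _, .A, p => turnAngle (-p) (edgeVec a b .A - p)
  | _, .B, p => turnAngle (-p) (edgeVec a b .B - p)
  | 0, .X, p => (pathX.map fun t =>
      (t.s : ℝ) * turnAngle (-((hexRoot⁻¹) ^ t.r * (p - t.pos.ev a b 0)))
        (edgeVec a b t.arc - (hexRoot⁻¹) ^ t.r * (p - t.pos.ev a b 0))).sum
  | 0, .H, p => (pathH.map fun t =>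
      (t.s : ℝ) * turnAngle (-((hexRoot⁻¹) ^ t.r * (p - t.pos.ev a b 0)))
        (edgeVec a b t.arc - (hexRoot⁻¹) ^ t.r * (p - t.pos.ev a b 0))).sum
  | 0, .E, _ => 0
  | n + 1, k, p => (k.rule.map fun t =>
      (t.s : ℝ) * sweep a b n t.arc ((hexRoot⁻¹) ^ t.r * (p - t.pos.ev a b n))).sum

/-- The angle swept by a placed arc. -/
def sweepAt (a b : ℝ) (n : ℕ) (p : ℂ) (k : Arc) (r : ℕ) (S : Pos) : ℝ :=
  sweep a b n k ((hexRoot⁻¹) ^ r * (p - S.ev a b n))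

/-- The total angle swept by a list of placed arcs. -/
def totalSweep (a b : ℝ) (n : ℕ) (p : ℂ) (l : List Term) : ℝ :=
  (l.map fun t => t.s * sweepAt a b n p t.arc t.r t.pos).sum

theorem sweep_A (p : ℂ) : sweep a b n .A p = turnAngle (-p) (a * edgeUnit - p) := by
  cases n <;> simp [sweep, edgeVec]

theorem sweep_B (p : ℂ) : sweep a b n .B p = turnAngle (-p) (2 * b - p) := by
  cases n <;> simp [sweep, edgeVec]

theorem sweep_zero (k : Arc) (p : ℂ) : sweep a b 0 k p = totalSweep a b 0 p k.path := by
  cases k <;>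
    simp [sweep, edgeVec, totalSweep, sweepAt, Arc.path, pathX, pathH, Pos.ev, eis]

theorem sweep_succ (k : Arc) (p : ℂ) :
    sweep a b (n + 1) k p = totalSweep a b n p k.rule := by
  cases k
  case A => simp [sweep_A, totalSweep, sweepAt, Arc.rule, Pos.ev, eis]
  case B => simp [sweep_B, totalSweep, sweepAt, Arc.rule, Pos.ev, eis]
  all_goals simp only [sweep, totalSweep, sweepAt]

theorem totalSweep_append (p : ℂ) (l l' : List Term) :
    totalSweep a b n p (l ++ l') = totalSweep a b n p l + totalSweep a b n p l' := by
  simp [totalSweep]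

theorem totalSweep_cons (p : ℂ) (t : Term) (l : List Term) :
    totalSweep a b n p (t :: l) =
      t.s * sweepAt a b n p t.arc t.r t.pos + totalSweep a b n p l := by
  simp [totalSweep]

theorem totalSweep_nil (p : ℂ) : totalSweep a b n p [] = 0 := rfl

theorem totalSweep_neg (p : ℂ) (l : List Term) :
    totalSweep a b n p (l.map Term.neg) = -totalSweep a b n p l := by
  induction l with
  | nil => simp [totalSweep]
  | cons t l ih =>
    rw [List.map_cons, totalSweep_cons, totalSweep_cons, ih]
    simp only [Term.neg]; push_cast; ring

/-- Moving the arcs by a rigid motion has the same effect as moving the observer by the inverse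
motion. -/
theorem totalSweep_place (p : ℂ) (r : ℕ) (S : Pos) (l : List Term) :
    totalSweep a b n p (l.map (Term.place r S)) =
      totalSweep a b n ((hexRoot⁻¹) ^ r * (p - S.ev a b n)) l := by
  induction l with
  | nil => simp [totalSweep]
  | cons t l ih =>
    rw [List.map_cons, totalSweep_cons, totalSweep_cons, ih]
    congr 2
    simp only [Term.place, sweepAt, Pos.ev_plus, Pos.ev_rot]
    congr 1
    have h := hexRoot_ne_zero
    have h2 : (hexRoot⁻¹) ^ r * hexRoot ^ r = 1 := by
      rw [← mul_pow, inv_mul_cancel₀ h, one_pow]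
    rw [pow_add]
    linear_combination (- hexRoot⁻¹ ^ t.r * t.pos.ev a b n) * h2

theorem totalSweep_smul (p : ℂ) (s : ℤ) (l : List Term) :
    totalSweep a b n p (l.map fun t' => ⟨s * t'.s, t'.arc, t'.r, t'.pos⟩) =
      s * totalSweep a b n p l := by
  induction l with
  | nil => simp [totalSweep]
  | cons t l ih =>
    rw [List.map_cons, totalSweep_cons, totalSweep_cons, ih]
    push_cast; ring

/-- The sweep of a superedge is by definition the sum over its rule, so subdivision does not change
it; no geometry enters. -/
theorem totalSweep_subdivide (p : ℂ) (l : List Term) :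
    totalSweep a b n p (subdivide l) = totalSweep a b (n + 1) p l := by
  induction l with
  | nil => simp [totalSweep, subdivide]
  | cons t l ih =>
    rw [totalSweep_cons, ← ih, subdivide, List.flatMap_cons, totalSweep_append,
      totalSweep_smul, totalSweep_place, ← subdivide, sweepAt, sweep_succ, Pos.ev_shift]

theorem totalSweep_toEdges (p : ℂ) (l : List Term) :
    totalSweep a b 0 p (toEdges l) = totalSweep a b 0 p l := by
  induction l with
  | nil => simp [totalSweep, toEdges]
  | cons t l ih =>
    rw [totalSweep_cons, ← ih, toEdges, List.flatMap_cons, totalSweep_append,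
      totalSweep_smul, totalSweep_place, ← toEdges, sweepAt, sweep_zero]

/-! ### Soundness of the cancellation of terms -/

theorem totalSweep_filter (p : ℂ) (l : List Term) (f : Term → Bool) :
    totalSweep a b n p l =
      totalSweep a b n p (l.filter f) + totalSweep a b n p (l.filter fun t => !f t) := by
  induction l with
  | nil => simp [totalSweep]
  | cons t l ih =>
    rw [totalSweep_cons, ih]
    cases h : f t <;> simp [h, totalSweep_cons] <;> ring

theorem Arc.code_injective : Function.Injective Arc.code := by
  intro k k' h
  cases k <;> cases k' <;> first | rfl | (simp [Arc.code] at h)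

theorem totalSweep_filter_same (p : ℂ) (t : Term) (l : List Term) :
    totalSweep a b n p (l.filter t.same) =
      (((l.filter t.same).map Term.s).sum : ℤ) * sweepAt a b n p t.arc t.r t.pos := by
  induction l with
  | nil => simp [totalSweep]
  | cons t' l ih =>
    by_cases h : t.same t' = true
    · rw [List.filter_cons_of_pos h, totalSweep_cons, ih, List.map_cons, List.sum_cons]
      simp only [Term.same, Bool.and_eq_true, beq_iff_eq] at h
      rw [← Arc.code_injective h.1.1, ← h.1.2, ← h.2]
      push_cast; ring
    · rw [List.filter_cons_of_neg h, ih]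

/-- Soundness of the integer check: each round collects all copies of the arc of the first term,
whose signs sum to zero, and discards them. -/
theorem totalSweep_eq_zero_of_cancels (p : ℂ) :
    ∀ (m : ℕ) (l : List Term), cancels m l = true → totalSweep a b n p l = 0
  | 0, l, h => by
    rw [cancels, List.isEmpty_iff] at h
    rw [h]; rfl
  | _ + 1, [], _ => rfl
  | m + 1, t :: l, h => by
    rw [cancels, Bool.and_eq_true, beq_iff_eq] at h
    rw [totalSweep_cons, totalSweep_filter p l t.same, totalSweep_filter_same,
      totalSweep_eq_zero_of_cancels p m _ h.2, add_zero, ← add_mul]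
    have := congrArg (Int.cast : ℤ → ℝ) h.1
    rw [Int.cast_add, Int.cast_zero] at this
    rw [add_comm, this, zero_mul]

theorem hexRoot_inv_pow_mod (r : ℕ) : (hexRoot⁻¹) ^ (r % 6) = (hexRoot⁻¹) ^ r := by
  have h : (hexRoot⁻¹) ^ 6 = 1 := by rw [inv_pow, hexRoot_pow_six, inv_one]
  conv_rhs => rw [← Nat.div_add_mod r 6, pow_add, pow_mul, h, one_pow, one_mul]

/-- An arc is symmetric under its half-turn if the half-turn reverses its orientation. -/
def HalfTurn (a b : ℝ) (n : ℕ) (k : Arc) : Prop :=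
  ∀ p, sweep a b n k (-(p - k.disp.ev a b n)) = -sweep a b n k p

theorem halfTurn_A : HalfTurn a b n .A := by
  intro p
  rw [sweep_A, sweep_A, ← turnAngle_symm, ← turnAngle_mul_left (neg_ne_zero.2 one_ne_zero)]
  congr 1 <;> simp [Arc.disp, Pos.ev, eis]

theorem halfTurn_B : HalfTurn a b n .B := by
  intro p
  rw [sweep_B, sweep_B, ← turnAngle_symm, ← turnAngle_mul_left (neg_ne_zero.2 one_ne_zero)]
  congr 1 <;> simp [Arc.disp, Pos.ev, eis]

/-- Only X needs a hypothesis: the straight edges A and B are symmetric under their half-turn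
anyway, and for H and E the normal form merely reduces the rotation modulo 6. -/
theorem totalSweep_norm (p : ℂ) (l : List Term)
    (hX : ∀ t ∈ l, t.arc = .X → HalfTurn a b n .X) :
    totalSweep a b n p (l.map Term.norm) = totalSweep a b n p l := by
  have flip : ∀ k, HalfTurn a b n k → ∀ (r : ℕ) (S : Pos), 3 ≤ r →
      sweepAt a b n p k (r - 3) (S.plus (k.disp.rot r)) = -sweepAt a b n p k r S := by
    intro k hk r S hr
    obtain ⟨r, rfl⟩ : ∃ m, r = m + 3 := ⟨r - 3, by omega⟩
    rw [sweepAt, sweepAt, ← hk]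
    congr 1
    rw [Pos.ev_plus, Pos.ev_rot, Nat.add_sub_cancel]
    have h := hexRoot_ne_zero
    have h2 : (hexRoot⁻¹) ^ r * hexRoot ^ r = 1 := by
      rw [← mul_pow, inv_mul_cancel₀ h, one_pow]
    have h3 : (hexRoot⁻¹) ^ 3 = -1 := by rw [inv_pow, hexRoot_pow_three]; norm_num
    rw [pow_add, pow_add, h3, hexRoot_pow_three]
    linear_combination (k.disp.ev a b n) * h2
  induction l with
  | nil => rfl
  | cons t l ih =>
    rw [List.map_cons, totalSweep_cons, totalSweep_cons,
      ih fun t' ht' => hX t' (List.mem_cons_of_mem _ ht')]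
    congr 1
    have hk : ∀ k, t.arc = k → k ≠ .H → k ≠ .E → HalfTurn a b n k := by
      intro k hk hH hE
      cases k
      · exact hX t List.mem_cons_self hk
      · exact absurd rfl hH
      · exact absurd rfl hE
      · exact halfTurn_A
      · exact halfTurn_B
    have hm : ∀ k, sweepAt a b n p k (t.r % 6) t.pos = sweepAt a b n p k t.r t.pos := by
      intro k
      rw [sweepAt, hexRoot_inv_pow_mod, ← sweepAt]
    obtain ⟨s, k, r, S⟩ := t
    cases k
    case H => simp only [Term.norm]; rw [hm]
    case E => simp only [Term.norm]; rw [hm]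
    all_goals
      simp only [Term.norm]
      split_ifs with h
      · simp only
        rw [flip _ (hk _ rfl (by simp) (by simp)) _ _ h, hm]; push_cast; ring
      · simp only
        rw [hm]

theorem totalSweep_ground (p : ℂ) (l : List Term) :
    totalSweep a b 0 p (l.map fun t => ⟨t.s, t.arc, t.r, t.pos.ground⟩) =
      totalSweep a b 0 p l := by
  induction l with
  | nil => rfl
  | cons t l ih =>
    rw [List.map_cons, totalSweep_cons, totalSweep_cons, ih]
    simp only [sweepAt, Pos.ev_ground]

theorem halfTurn_of_totalSweep (h : ∀ p, totalSweep a b n p turnedX = 0) :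
    HalfTurn a b n .X := by
  intro p
  have := h p
  have h3 : (hexRoot⁻¹) ^ 3 = -1 := by rw [inv_pow, hexRoot_pow_three]; norm_num
  have h0 : Pos.ev a b n ((0, 0), (0, 0), (0, 0), (0, 0)) = 0 := by simp [Pos.ev, eis]
  rw [turnedX, totalSweep_cons, totalSweep_cons, totalSweep_nil, sweepAt, sweepAt] at this
  simp only [h3, h0, pow_zero, one_mul, sub_zero, neg_one_mul, Int.cast_one] at this
  linarith

/-- Induction on the level. On the ground no arc X is left after the expansion into edges, so the
normal form is sound unconditionally; above it, normalization at level n uses the symmetry at level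
n. -/
theorem halfTurn_X : ∀ n, HalfTurn a b n .X
  | 0 => halfTurn_of_totalSweep fun p => by
    rw [← totalSweep_toEdges, ← totalSweep_ground]
    have h := totalSweep_eq_zero_of_cancels (a := a) (b := b) (n := 0) p _ _
      cancels_turnedX_ground
    rwa [totalSweep_norm] at h
    have h2 : ∀ t ∈ (toEdges turnedX).map
        (fun t => (⟨t.s, t.arc, t.r, t.pos.ground⟩ : Term)), t.arc.code ≠ Arc.X.code := by
      decide
    intro t ht hX
    exact absurd (congrArg Arc.code hX) (h2 t ht)
  | n + 1 => halfTurn_of_totalSweep fun p => by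
    rw [← totalSweep_subdivide, ← totalSweep_norm p _ fun _ _ _ => halfTurn_X n]
    exact totalSweep_eq_zero_of_cancels p _ _ cancels_turnedX

end

/-! ### Supertiles as lists of motions, and the sum of the boundaries of their tiles -/

noncomputable section

open Complex

variable {a b : ℝ} {n : ℕ}

/-! ### Supertiles as lists of motions -/

/-- The sixth root of unity `ω` on the unit circle. -/
def hexCircle : Circle := ⟨hexRoot, mem_sphere_zero_iff_norm.2 norm_hexRoot⟩

/-- The motion `z ↦ ω ^ r z + t`, for a formal position `t` of level `n`. -/
def frame (a b : ℝ) (n r : ℕ) (S : Pos) : ℂ ≃ᵢ ℂ :=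
  (rotation (hexCircle ^ r)).toIsometryEquiv.trans (IsometryEquiv.addRight (S.ev a b n))

theorem frame_apply (r : ℕ) (S : Pos) (z : ℂ) :
    frame a b n r S z = hexRoot ^ r * z + S.ev a b n := by
  have h : ((hexCircle ^ r : Circle) : ℂ) = hexRoot ^ r := by
    rw [Circle.coe_pow]; rfl
  change rotation (hexCircle ^ r) z + S.ev a b n = _
  rw [rotation_apply, h]

theorem frame_symm_apply (r : ℕ) (S : Pos) (z : ℂ) :
    (frame a b n r S).symm z = (hexRoot⁻¹) ^ r * (z - S.ev a b n) := by
  rw [IsometryEquiv.symm_apply_eq, frame_apply]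
  have h2 : hexRoot ^ r * (hexRoot⁻¹) ^ r = 1 := by
    rw [← mul_pow, mul_inv_cancel₀ hexRoot_ne_zero, one_pow]
  linear_combination (-(z - S.ev a b n)) * h2

/-- The motion that puts a supertile of level `n` into the `i`-th place of a supertile of
level `n + 1`. -/
def hatMove (a b : ℝ) (n : ℕ) (i : Fin 7) : ℂ ≃ᵢ ℂ := frame a b n (motion i).1 (motion i).2

/-- The translation part of the reflected tile of the cluster. -/
def mirrorPos : Pos := ((0, 0), (0, 0), (2, -1), (1, 4))

/-- The motion of the reflected tile of the cluster. -/
def mirrorMove (a b : ℝ) : ℂ ≃ᵢ ℂ :=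
  conjLIE.toIsometryEquiv.trans (IsometryEquiv.addRight (mirrorPos.ev a b 0))

theorem mirrorMove_apply (z : ℂ) :
    mirrorMove a b z = (starRingEnd ℂ) z + mirrorPos.ev a b 0 := by
  simp [mirrorMove]

theorem mirrorMove_symm_apply (z : ℂ) :
    (mirrorMove a b).symm z = (starRingEnd ℂ) (z - mirrorPos.ev a b 0) := by
  rw [IsometryEquiv.symm_apply_eq, mirrorMove_apply, Complex.conj_conj, sub_add_cancel]

/-- The motions of the tiles of a cluster. -/
def baseFrames (a b : ℝ) (lo : List (Fin 7)) : List (ℂ ≃ᵢ ℂ) :=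
  lo.map (hatMove a b 0) ++ [hatMove a b 0 6, mirrorMove a b]

/-- The motions of the tiles of a supertile, in terms of those of its parts. -/
def nextFrames (a b : ℝ) (n : ℕ) (lo : List (Fin 7)) (p : List (ℂ ≃ᵢ ℂ) × List (ℂ ≃ᵢ ℂ)) :
    List (ℂ ≃ᵢ ℂ) :=
  (lo.flatMap fun i => p.1.map fun U => U.trans (hatMove a b n i)) ++
    p.2.map fun U => U.trans (hatMove a b n 6)

/-- The motions of the tiles of the `H₈`- and the `H₇`-supertile. -/
def frames (a b : ℝ) : ℕ → List (ℂ ≃ᵢ ℂ) × List (ℂ ≃ᵢ ℂ)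
  | 0 => (baseFrames a b [0, 1, 2, 3, 4, 5], baseFrames a b [1, 2, 3, 4, 5])
  | n + 1 => (nextFrames a b (n + 1) [0, 1, 2, 3, 4, 5] (frames a b n),
      nextFrames a b (n + 1) [1, 2, 3, 4, 5] (frames a b n))

/-- The angle swept by the boundary of the tile. -/
def tileSweep (a b : ℝ) (p : ℂ) : ℝ := totalSweep a b 0 p tileEdges

/-- The total angle swept by the boundaries of the tiles of a list. -/
def frameSweep (a b : ℝ) (l : List (ℂ ≃ᵢ ℂ)) (p : ℂ) : ℝ :=
  (l.map fun U => tileSweep a b (U.symm p)).sum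

theorem frameSweep_append (l l' : List (ℂ ≃ᵢ ℂ)) (p : ℂ) :
    frameSweep a b (l ++ l') p = frameSweep a b l p + frameSweep a b l' p := by
  simp [frameSweep]

theorem frameSweep_trans (l : List (ℂ ≃ᵢ ℂ)) (V : ℂ ≃ᵢ ℂ) (p : ℂ) :
    frameSweep a b (l.map fun U => U.trans V) p = frameSweep a b l (V.symm p) := by
  rw [frameSweep, frameSweep, List.map_map]
  rfl

theorem totalSweep_map_hatMove (l : List Term) (i : Fin 7) (p : ℂ) :
    totalSweep a b n p (l.map (Term.place (motion i).1 (motion i).2)) =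
      totalSweep a b n ((hatMove a b n i).symm p) l := by
  rw [totalSweep_place, hatMove, frame_symm_apply]

theorem totalSweep_map_hatMove_succ (l : List Term) (i : Fin 7) (p : ℂ) :
    totalSweep a b n p (l.map (Term.place (motion i).1 (motion i).2.shift)) =
      totalSweep a b n ((hatMove a b (n + 1) i).symm p) l := by
  rw [totalSweep_place, hatMove, frame_symm_apply, Pos.ev_shift]

/-- The edge vector of the first kind has argument π/6, so complex conjugation turns it by -π/3.
This is the reason for the rotation `11 - r`, instead of `12 - r`, of A edges in `Term.mirror`. -/
theorem conj_edgeUnit : (starRingEnd ℂ) edgeUnit = hexRoot⁻¹ * edgeUnit := by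
  rw [eq_comm, inv_mul_eq_iff_eq_mul₀ hexRoot_ne_zero]
  simp only [edgeUnit, hexRoot, map_add, conj_I, conj_ofReal]
  linear_combination (- I / 2) * sqrt_three_sq + (Real.sqrt 3 / 2 : ℂ) * I_sq

theorem conj_hexRoot_eq_inv : (starRingEnd ℂ) hexRoot = hexRoot⁻¹ := by
  rw [Complex.inv_def, Complex.normSq_eq_norm_sq, norm_hexRoot]; simp

theorem conj_hexRoot_pow {r : ℕ} (h : r ≤ 12) :
    (starRingEnd ℂ) (hexRoot ^ r) = hexRoot ^ (12 - r) := by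
  rw [map_pow, conj_hexRoot_eq_inv, inv_pow, inv_eq_iff_eq_inv, eq_comm, inv_eq_of_mul_eq_one_left]
  rw [← pow_add, Nat.add_sub_cancel' h]
  linear_combination (hexRoot ^ 6 + 1) * hexRoot_pow_six

theorem sweepAt_edge (k : Arc) (hk : k = .A ∨ k = .B) (r : ℕ) (S : Pos) (p : ℂ) :
    sweepAt a b n p k r S =
      turnAngle (S.ev a b n - p) (S.ev a b n + hexRoot ^ r * edgeVec a b k - p) := by
  have h2 : hexRoot ^ r * (hexRoot⁻¹) ^ r = 1 := by
    rw [← mul_pow, mul_inv_cancel₀ hexRoot_ne_zero, one_pow]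
  have h3 : sweepAt a b n p k r S = turnAngle (-((hexRoot⁻¹) ^ r * (p - S.ev a b n)))
      (edgeVec a b k - (hexRoot⁻¹) ^ r * (p - S.ev a b n)) := by
    rcases hk with rfl | rfl
    · rw [sweepAt, sweep_A, edgeVec]
    · rw [sweepAt, sweep_B, edgeVec]
      intro h
      cases h
  rw [h3, ← turnAngle_mul_left (pow_ne_zero r hexRoot_ne_zero)]
  congr 1
  · linear_combination (-(p - S.ev a b n)) * h2
  · linear_combination (-(p - S.ev a b n)) * h2

theorem sweepAt_mirror (t : Term) (hk : t.arc = .A ∨ t.arc = .B) (hr : t.r ≤ 11)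
    (hS : t.pos.1 = (0, 0) ∧ t.pos.2.1 = (0, 0)) (p : ℂ) :
    sweepAt a b 0 p t.mirror.arc t.mirror.r t.mirror.pos =
      -sweepAt a b 0 ((starRingEnd ℂ) p) t.arc t.r t.pos := by
  have hpos : t.mirror.pos.ev a b 0 = (starRingEnd ℂ) (t.pos.ev a b 0) := by
    have hx : hexRoot⁻¹ = 1 - hexRoot := by rw [← conj_hexRoot, conj_hexRoot_eq_inv]
    simp only [Pos.ev, Term.mirror, hS.1, hS.2, eis, map_add, map_mul, conj_edgeUnit,
      conj_hexRoot, hx, conj_ofReal, map_ofNat, map_intCast, map_zero, Int.cast_zero]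
    push_cast
    linear_combination (a : ℂ) * edgeUnit * t.pos.2.2.1.2 * (-hexRoot_sq)
  have hedge : hexRoot ^ t.mirror.r * edgeVec a b t.mirror.arc =
      (starRingEnd ℂ) (hexRoot ^ t.r * edgeVec a b t.arc) := by
    rw [map_mul, conj_hexRoot_pow (by omega)]
    rcases hk with h | h
    · simp only [Term.mirror, h, edgeVec, map_mul, conj_edgeUnit, conj_ofReal]
      rw [show 12 - t.r = 11 - t.r + 1 by omega, pow_succ]
      field_simp [hexRoot_ne_zero]
    · simp only [Term.mirror, h, edgeVec, map_mul, conj_ofReal, map_ofNat]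
  rw [sweepAt_edge _ (by simpa [Term.mirror] using hk), sweepAt_edge _ hk, hpos, hedge,
    ← turnAngle_conj]
  simp only [map_sub, map_add, Complex.conj_conj]

/-- A reflection reverses angles. Therefore `tileBlocks` lists the reflected tile with the opposite
sign, and each tile contributes its winding number with the same sign. -/
theorem totalSweep_mirror (p : ℂ) :
    totalSweep a b 0 p (tileEdges.map Term.mirror) = -tileSweep a b ((starRingEnd ℂ) p) := by
  have h' : ∀ t ∈ tileEdges, (t.arc = .A ∨ t.arc = .B) ∧ t.r ≤ 11 ∧
      t.pos.1 = (0, 0) ∧ t.pos.2.1 = (0, 0) := by simp [tileEdges]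
  have : ∀ l : List Term, (∀ t ∈ l, t ∈ tileEdges) →
      totalSweep a b 0 p (l.map Term.mirror) = -totalSweep a b 0 ((starRingEnd ℂ) p) l := by
    intro l
    induction l with
    | nil => simp [totalSweep]
    | cons t l ih =>
      intro h
      rw [List.map_cons, totalSweep_cons, totalSweep_cons,
        ih fun t' ht' => h t' (List.mem_cons_of_mem _ ht'),
        sweepAt_mirror t (h' t (h t List.mem_cons_self)).1 (h' t (h t List.mem_cons_self)).2.1
          (h' t (h t List.mem_cons_self)).2.2]
      simp only [Term.mirror]; ring
  exact this tileEdges fun _ h => h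

theorem frameSweep_baseFrames (lo : List (Fin 7)) (p : ℂ) :
    frameSweep a b (baseFrames a b lo) p = totalSweep a b 0 p (tileBlocks lo) := by
  rw [baseFrames, frameSweep_append, tileBlocks, totalSweep_append, totalSweep_append,
    totalSweep_neg, totalSweep_map_hatMove, totalSweep_place, totalSweep_mirror]
  congr 1
  · induction lo with
    | nil => simp [frameSweep, totalSweep]
    | cons i lo ih =>
      rw [List.map_cons, List.flatMap_cons, totalSweep_append, ← ih, totalSweep_map_hatMove]
      simp [frameSweep, tileSweep]
  · simp [frameSweep, mirrorMove_symm_apply, tileSweep, mirrorPos]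

theorem frameSweep_nextFrames (lo : List (Fin 7)) (p : ℂ)
    (h8 : ∀ p, frameSweep a b (frames a b n).1 p = totalSweep a b n p boundary8)
    (h7 : ∀ p, frameSweep a b (frames a b n).2 p = totalSweep a b n p boundary7) :
    frameSweep a b (nextFrames a b (n + 1) lo (frames a b n)) p =
      totalSweep a b n p (blocks lo) := by
  rw [nextFrames, frameSweep_append, blocks, totalSweep_append, frameSweep_trans, h7,
    totalSweep_map_hatMove_succ]
  congr 1
  induction lo with
  | nil => simp [frameSweep, totalSweep]
  | cons i lo ih =>
    rw [List.flatMap_cons, List.flatMap_cons, totalSweep_append, ← ih, frameSweep_append,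
      frameSweep_trans, h8, totalSweep_map_hatMove_succ]

/-- At level 0 the vectors α and β are themselves sums of edge vectors, so equal points may have
different formal positions; `Pos.ground` removes this ambiguity before the terms are compared. The
hypothesis `h'` excludes arcs X, so that the symmetry of X is not needed for the normal form. -/
theorem totalSweep_eq_of_cancels_ground (p : ℂ) (m : ℕ) (l l' : List Term)
    (h : cancels m (((l ++ (toEdges l').map Term.neg).map
      fun t => ⟨t.s, t.arc, t.r, t.pos.ground⟩).map Term.norm) = true)
    (h' : ∀ t ∈ ((l ++ (toEdges l').map Term.neg).map
      fun t => (⟨t.s, t.arc, t.r, t.pos.ground⟩ : Term)), t.arc.code ≠ Arc.X.code) :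
    totalSweep a b 0 p l = totalSweep a b 0 p l' := by
  have := totalSweep_eq_zero_of_cancels (a := a) (b := b) (n := 0) p _ _ h
  rw [totalSweep_norm, totalSweep_ground, totalSweep_append, totalSweep_neg,
    totalSweep_toEdges] at this
  · linarith
  · intro t ht hX
    exact absurd (congrArg Arc.code hX) (h' t ht)

theorem totalSweep_eq_of_cancels (p : ℂ) (m : ℕ) (l l' : List Term)
    (h : cancels m ((l ++ (subdivide l').map Term.neg).map Term.norm) = true) :
    totalSweep a b n p l = totalSweep a b (n + 1) p l' := by
  have := totalSweep_eq_zero_of_cancels (a := a) (b := b) (n := n) p _ _ h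
  rw [totalSweep_norm _ _ fun _ _ _ => halfTurn_X n, totalSweep_append, totalSweep_neg,
    totalSweep_subdivide] at this
  linarith

/-- The boundaries of the tiles of a supertile add up to the boundary of the supertile. -/
theorem frameSweep_frames : ∀ (n : ℕ) (p : ℂ),
    frameSweep a b (frames a b n).1 p = totalSweep a b n p boundary8 ∧
      frameSweep a b (frames a b n).2 p = totalSweep a b n p boundary7
  | 0, p => by
    rw [frames, frameSweep_baseFrames, frameSweep_baseFrames]
    exact ⟨totalSweep_eq_of_cancels_ground p _ _ _ cancels_tileBlocks8 (by decide +kernel),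
      totalSweep_eq_of_cancels_ground p _ _ _ cancels_tileBlocks7 (by decide +kernel)⟩
  | n + 1, p => by
    have h8 := fun p => (frameSweep_frames n p).1
    have h7 := fun p => (frameSweep_frames n p).2
    rw [frames, frameSweep_nextFrames _ _ h8 h7, frameSweep_nextFrames _ _ h8 h7]
    exact ⟨totalSweep_eq_of_cancels p _ _ _ cancels_blocks8,
      totalSweep_eq_of_cancels p _ _ _ cancels_blocks7⟩

end

/-! ### Telescoping of angles in half-planes, and the asymptotics of formal positions -/

noncomputable section

open Complex

variable {a b : ℝ} {n : ℕ}

/-! ### Telescoping of angles in a half-plane -/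

theorem div_re_pos {z v : ℂ} (h : 0 < (z * (starRingEnd ℂ) v).re) : 0 < (z / v).re := by
  have hv : v ≠ 0 := by rintro rfl; simp at h
  rw [div_eq_mul_inv, Complex.inv_def, ← mul_assoc, Complex.re_mul_ofReal]
  exact mul_pos h (inv_pos.2 (Complex.normSq_pos.2 hv))

theorem abs_arg_div_lt {z v : ℂ} (h : 0 < (z * (starRingEnd ℂ) v).re) :
    |arg (z / v)| < Real.pi / 2 :=
  Complex.abs_arg_lt_pi_div_two_iff.2 (Or.inl (div_re_pos h))

/-- In the open half-plane around v both arguments relative to v lie in (-π/2, π/2), so their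
difference lies in (-π, π) and does not wrap around. -/
theorem turnAngle_eq_sub {z w v : ℂ} (hz : 0 < (z * (starRingEnd ℂ) v).re)
    (hw : 0 < (w * (starRingEnd ℂ) v).re) :
    turnAngle z w = arg (z / v) - arg (w / v) := by
  have h1 := abs_lt.1 (abs_arg_div_lt hz)
  have h2 := abs_lt.1 (abs_arg_div_lt hw)
  have hz' : z ≠ 0 := by rintro rfl; simp at hz
  have hw' : w ≠ 0 := by rintro rfl; simp at hw
  have hv : v ≠ 0 := by rintro rfl; simp at hw
  have hpi := Real.pi_pos
  have e : z / w = z / v * (w / v)⁻¹ := by field_simp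
  have hinv : arg ((w / v)⁻¹) = -arg (w / v) := by
    rw [Complex.arg_inv, if_neg]
    linarith
  have h : arg (z / w) = arg (z / v) - arg (w / v) := by
    rw [e, Complex.arg_mul (div_ne_zero hz' hv) (inv_ne_zero (div_ne_zero hw' hv)), hinv,
      sub_eq_add_neg]
    rw [hinv]
    constructor <;> linarith
  rw [turnAngle, h, if_neg]
  linarith

/-- Changing the reference direction by ω⁴, a turn by -2π/3, increases the argument by 2π/3. Three
such changes make up the full turn of a boundary. -/
theorem arg_div_rotate {z v : ℂ} (hz : 0 < (z * (starRingEnd ℂ) v).re)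
    (hz' : 0 < (z * (starRingEnd ℂ) (v * hexRoot ^ 4)).re) :
    arg (z / (v * hexRoot ^ 4)) = arg (z / v) + 2 * Real.pi / 3 := by
  have h1 := abs_lt.1 (abs_arg_div_lt hz)
  have h2 := abs_lt.1 (abs_arg_div_lt hz')
  have hz0 : z ≠ 0 := by rintro rfl; simp at hz
  have hv : v ≠ 0 := by rintro rfl; simp at hz
  have hpi := Real.pi_pos
  have hω := hexRoot_ne_zero
  have hexp : hexRoot ^ 2 = Complex.exp (((2 * Real.pi / 3 : ℝ) : ℂ) * I) := by
    rw [hexRoot_eq_exp, ← Complex.exp_nat_mul]; congr 1; push_cast; ring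
  have harg : arg (hexRoot ^ 2) = 2 * Real.pi / 3 := by
    rw [hexp, Complex.arg_exp_mul_I]
    rw [(toIocMod_eq_self _).2]
    constructor <;> linarith
  have e : z / (v * hexRoot ^ 4) = z / v * hexRoot ^ 2 := by
    rw [div_mul_eq_mul_div, div_eq_div_iff (mul_ne_zero hv (pow_ne_zero _ hω)) hv]
    linear_combination (-z * v) * hexRoot_pow_six
  have h := Complex.arg_mul_coe_angle (div_ne_zero hz0 hv) (pow_ne_zero 2 hω)
  rw [← e, harg, ← Real.Angle.coe_add, Real.Angle.angle_eq_iff_two_pi_dvd_sub] at h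
  obtain ⟨k, hk⟩ := h
  -- Both arguments are below π/2 in modulus, so the multiple 2πk lies between -5π/3 and π/3.
  have hk0 : k = 0 := by
    have u1 : (k : ℝ) < 1 := by
      by_contra hc
      have : 2 * Real.pi * 1 ≤ 2 * Real.pi * k := by gcongr; linarith
      linarith
    have u2 : (-1 : ℝ) < k := by
      by_contra hc
      have : 2 * Real.pi * k ≤ 2 * Real.pi * (-1) := by gcongr; linarith
      linarith
    have u1' : k < 1 := by exact_mod_cast u1
    have u2' : -1 < k := by exact_mod_cast u2
    omega
  rw [hk0] at hk
  simp only [Int.cast_zero, mul_zero] at hk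
  linarith

/-! ### Paths of placed arcs -/

/-- The end of the underlying arc of a term. -/
def Term.far (t : Term) : Pos := t.pos.plus (t.arc.disp.rot t.r)

/-- The starting position of a term, according to its sign. -/
def Term.src (t : Term) : Pos := if t.s = 1 then t.pos else t.far

/-- The final position of a term, according to its sign. -/
def Term.tgt (t : Term) : Pos := if t.s = 1 then t.far else t.pos

/-- Is the list a path of oriented arcs from `S` to `T`? -/
def isPath : Pos → List Term → Pos → Bool
  | S, [], T => S == T
  | S, t :: l, T => t.src == S && (t.s == 1 || t.s == -1) && isPath t.tgt l T

/-- The sweep of a placed arc only depends on its end points. -/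
def Straight (a b : ℝ) (n : ℕ) (p : ℂ) (t : Term) : Prop :=
  sweepAt a b n p t.arc t.r t.pos = turnAngle (t.pos.ev a b n - p) (t.far.ev a b n - p)

/-- Within one half-plane the angle of a path telescopes to the difference of the arguments of its
ends, whatever the path does in between. -/
theorem totalSweep_of_isPath {p v : ℂ} :
    ∀ (S : Pos) (l : List Term) (T : Pos), isPath S l T = true →
      (∀ t ∈ l, Straight a b n p t) →
      0 < ((S.ev a b n - p) * (starRingEnd ℂ) v).re →
      (∀ t ∈ l, 0 < ((t.tgt.ev a b n - p) * (starRingEnd ℂ) v).re) →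
      totalSweep a b n p l = arg ((S.ev a b n - p) / v) - arg ((T.ev a b n - p) / v)
  | S, [], T, h, _, _, _ => by
    rw [isPath, beq_iff_eq] at h
    rw [h, totalSweep_nil, sub_self]
  | S, t :: l, T, h, hs, hS, ht => by
    rw [isPath, Bool.and_eq_true, Bool.and_eq_true, Bool.or_eq_true, beq_iff_eq, beq_iff_eq,
      beq_iff_eq] at h
    obtain ⟨⟨h1, h2⟩, h3⟩ := h
    have htgt := ht t List.mem_cons_self
    rw [totalSweep_cons, totalSweep_of_isPath t.tgt l T h3
      (fun t' h' => hs t' (List.mem_cons_of_mem _ h')) htgt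
      (fun t' h' => ht t' (List.mem_cons_of_mem _ h')), hs t List.mem_cons_self]
    rw [← h1] at hS ⊢
    rcases h2 with h2 | h2
    · simp only [Term.src, Term.tgt, h2, if_true] at hS htgt ⊢
      rw [turnAngle_eq_sub hS htgt]; push_cast; ring
    · simp only [Term.src, Term.tgt, h2, show (-1 : ℤ) ≠ 1 by decide, if_false] at hS htgt ⊢
      rw [turnAngle_eq_sub htgt hS]; push_cast; ring

/-- Seen from a point outside an open disc, the disc lies in the open half-plane towards its centre.
-/
theorem re_mul_conj_pos_of_ball {x p c : ℂ} {R : ℝ} (hx : ‖x - c‖ < R) (hp : R ≤ ‖p - c‖) :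
    0 < ((x - p) * (starRingEnd ℂ) (c - p)).re := by
  have h0 : 0 ≤ ‖x - c‖ := norm_nonneg _
  have e : (x - p) * (starRingEnd ℂ) (c - p) =
      (x - c) * (starRingEnd ℂ) (c - p) + (c - p) * (starRingEnd ℂ) (c - p) := by ring
  have h1 := Complex.abs_re_le_norm ((x - c) * (starRingEnd ℂ) (c - p))
  rw [norm_mul, Complex.norm_conj, norm_sub_rev c p] at h1
  rw [e, Complex.add_re, Complex.mul_conj, Complex.ofReal_re, Complex.normSq_eq_norm_sq,
    norm_sub_rev c p]
  have h2 := (abs_le.1 h1).1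
  nlinarith

theorem totalSweep_of_isPath_ball {p c : ℂ} {R : ℝ} (S : Pos) (l : List Term) (T : Pos)
    (h : isPath S l T = true) (hs : ∀ t ∈ l, Straight a b n p t) (hp : R ≤ ‖p - c‖)
    (hS : ‖S.ev a b n - c‖ < R) (hT : ‖T.ev a b n - c‖ < R)
    (ht : ∀ t ∈ l, ‖t.tgt.ev a b n - c‖ < R) :
    totalSweep a b n p l = turnAngle (S.ev a b n - p) (T.ev a b n - p) := by
  rw [totalSweep_of_isPath (v := c - p) S l T h hs (re_mul_conj_pos_of_ball hS hp)
    fun t h => re_mul_conj_pos_of_ball (ht t h) hp,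
    turnAngle_eq_sub (re_mul_conj_pos_of_ball hS hp) (re_mul_conj_pos_of_ball hT hp)]

/-! ### Leading terms of positions -/

/-- The limit of a formal position, in units of the scale of its level. -/
def Pos.lead (S : Pos) : ℂ := eis S.1 + Real.goldenRatio * eis S.2.1

theorem goldenRatio_sq_complex : (Real.goldenRatio : ℂ) ^ 2 = Real.goldenRatio + 1 := by
  rw [← Complex.ofReal_pow, Real.goldenRatio_sq]; push_cast; ring

theorem Pos.lead_turn (S : Pos) : S.turn.lead = hexRoot * S.lead := by
  simp only [Pos.lead, Pos.turn, eis_eisRot]; ring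

theorem Pos.lead_rot (r : ℕ) (S : Pos) : (S.rot r).lead = hexRoot ^ r * S.lead := by
  induction r with
  | zero => simp [Pos.rot]
  | succ r ih => rw [Pos.rot, Pos.lead_turn, ih]; ring

theorem Pos.lead_plus (S S' : Pos) : (S.plus S').lead = S.lead + S'.lead := by
  simp only [Pos.lead, Pos.plus, eis]; push_cast; ring

/-- The row vector (1, τ) is an eigenvector of the change of coordinates between levels, with
eigenvalue τ². -/
theorem Pos.lead_shift (S : Pos) : S.shift.lead = (Real.goldenRatio : ℂ) ^ 2 * S.lead := by
  simp only [Pos.lead, Pos.shift, eis, Int.cast_add, Int.cast_mul, Int.cast_ofNat]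
  linear_combination (-((S.1.1 : ℂ) + S.1.2 * hexRoot) - (S.2.1.1 + S.2.1.2 * hexRoot) *
    ((Real.goldenRatio : ℂ) + 1)) * goldenRatio_sq_complex

/-- The basic scale of the lowest level. -/
def baseScale (a b : ℝ) : ℂ :=
  ((scales a b 0).1 + Real.goldenRatio * (scales a b 0).2) / (1 + Real.goldenRatio ^ 2)

/-- The basic scale of level `n + 1`. -/
def levelScale (a b : ℝ) (n : ℕ) : ℂ := baseScale a b * (Real.goldenRatio : ℂ) ^ (2 * n)

theorem levelScale_succ : levelScale a b (n + 1) =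
    (Real.goldenRatio : ℂ) ^ 2 * levelScale a b n := by
  simp only [levelScale]; ring

theorem scales_lead (n : ℕ) : (scales a b n).1 + Real.goldenRatio * (scales a b n).2 =
    (1 + (Real.goldenRatio : ℂ) ^ 2) * levelScale a b n := by
  induction n with
  | zero =>
    have : (1 + (Real.goldenRatio : ℂ) ^ 2) ≠ 0 := by
      have : (1 + Real.goldenRatio ^ 2 : ℝ) ≠ 0 := by positivity
      exact_mod_cast this
    simp only [levelScale, baseScale, mul_zero, pow_zero, mul_one]
    field_simp
  | succ n ih =>
    rw [levelScale_succ]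
    simp only [scales]
    linear_combination (Real.goldenRatio : ℂ) ^ 2 * ih +
      (-(scales a b n).1 - (scales a b n).2 * (1 + Real.goldenRatio)) * goldenRatio_sq_complex

/-- The other eigendirection of the recursion contracts, with the factor 2 - τ = τ⁻² in (0, 1). -/
theorem norm_scales_diff_le (n : ℕ) :
    ‖(scales a b n).2 - Real.goldenRatio * (scales a b n).1‖ ≤
      ‖(scales a b 0).2 - Real.goldenRatio * (scales a b 0).1‖ := by
  induction n with
  | zero => exact le_rfl
  | succ n ih =>
    have e : (scales a b (n + 1)).2 - Real.goldenRatio * (scales a b (n + 1)).1 =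
        ((2 - Real.goldenRatio : ℝ) : ℂ) *
          ((scales a b n).2 - Real.goldenRatio * (scales a b n).1) := by
      simp only [scales, Complex.ofReal_sub, Complex.ofReal_ofNat]
      linear_combination (-(scales a b n).1) * goldenRatio_sq_complex
    rw [e, norm_mul, Complex.norm_real, Real.norm_eq_abs, abs_of_nonneg]
    · have := Real.one_lt_goldenRatio
      nlinarith [norm_nonneg ((scales a b n).2 - Real.goldenRatio * (scales a b n).1)]
    · linarith [Real.goldenRatio_lt_two]

/-- Up to an error that is bounded uniformly in the level, a formal position is its leading term
times the scale of the level. This reduces the geometry of large supertiles to finitely many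
inequalities in ℤ[τ, ω]. -/
theorem Pos.exists_norm_ev_sub_le (a b : ℝ) (S : Pos) :
    ∃ M, ∀ n, ‖S.ev a b n - levelScale a b n * S.lead‖ ≤ M := by
  -- The coefficient of the contracting component when the pair of α- and β-coefficients is expanded
  -- in the orthogonal eigenvectors (1, τ) and (-τ, 1).
  set d : ℂ := (eis S.2.1 - Real.goldenRatio * eis S.1) / (1 + Real.goldenRatio ^ 2)
  set e : ℂ := eis S.2.2.1 * (a * edgeUnit) + eis S.2.2.2 * (2 * b)
  refine ⟨‖d‖ * ‖(scales a b 0).2 - Real.goldenRatio * (scales a b 0).1‖ + ‖e‖, fun n => ?_⟩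
  have h0 : (1 + (Real.goldenRatio : ℂ) ^ 2) ≠ 0 := by
    have : (1 + Real.goldenRatio ^ 2 : ℝ) ≠ 0 := by positivity
    exact_mod_cast this
  have hd : d * (1 + Real.goldenRatio ^ 2) = eis S.2.1 - Real.goldenRatio * eis S.1 :=
    div_mul_cancel₀ _ h0
  have key : S.ev a b n - levelScale a b n * S.lead =
      d * ((scales a b n).2 - Real.goldenRatio * (scales a b n).1) + e := by
    apply mul_left_cancel₀ h0
    simp only [Pos.ev, Pos.lead, e]
    linear_combination (-(eis S.1 + Real.goldenRatio * eis S.2.1)) * -scales_lead (a := a) (b := b) n -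
      ((scales a b n).2 - Real.goldenRatio * (scales a b n).1) * hd
  rw [key]
  refine (norm_add_le _ _).trans (add_le_add ?_ le_rfl)
  rw [norm_mul]
  exact mul_le_mul_of_nonneg_left (norm_scales_diff_le n) (norm_nonneg _)

theorem exists_norm_ev_sub_le (a b : ℝ) (l : List Pos) :
    ∃ M, 0 ≤ M ∧ ∀ S ∈ l, ∀ n, ‖S.ev a b n - levelScale a b n * S.lead‖ ≤ M := by
  induction l with
  | nil => exact ⟨0, le_rfl, by simp⟩
  | cons S l ih =>
    obtain ⟨M, hM, h⟩ := ih
    obtain ⟨M', h'⟩ := S.exists_norm_ev_sub_le a b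
    refine ⟨max M M', le_max_of_le_left hM, ?_⟩
    intro S' hS' n
    rcases List.mem_cons.1 hS' with rfl | hS'
    · exact (h' n).trans (le_max_right _ _)
    · exact (h S' hS' n).trans (le_max_left _ _)

/-! ### Exact estimates of leading terms -/

/-- The square of the modulus of the leading term, as `m + n τ`. -/
def Pos.leadSq (S : Pos) : ℤ × ℤ :=
  (S.1.1 ^ 2 + S.2.1.1 ^ 2 + S.1.1 * S.1.2 + S.2.1.1 * S.2.1.2 + S.1.2 ^ 2 + S.2.1.2 ^ 2,
    2 * S.1.1 * S.2.1.1 + S.2.1.1 ^ 2 + S.1.1 * S.2.1.2 + S.2.1.1 * S.1.2 + S.2.1.1 * S.2.1.2 +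
      2 * S.1.2 * S.2.1.2 + S.2.1.2 ^ 2)

theorem normSq_add_mul_hexRoot (x y : ℝ) :
    ‖(x : ℂ) + y * hexRoot‖ ^ 2 = x ^ 2 + x * y + y ^ 2 := by
  rw [← Complex.normSq_eq_norm_sq, Complex.normSq_apply]
  have h : Real.sqrt 3 ^ 2 = 3 := Real.sq_sqrt (by norm_num)
  simp [hexRoot]
  linear_combination (y ^ 2 / 4) * h

theorem Pos.lead_eq (S : Pos) :
    S.lead = ((S.1.1 + Real.goldenRatio * S.2.1.1 : ℝ) : ℂ) +
      ((S.1.2 + Real.goldenRatio * S.2.1.2 : ℝ) : ℂ) * hexRoot := by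
  simp only [Pos.lead, eis]; push_cast; ring

/-- Squared moduli of leading terms lie in ℤ[τ], so with a rational enclosure of τ all estimates
become integer comparisons. -/
theorem Pos.norm_lead_sq (S : Pos) :
    ‖S.lead‖ ^ 2 = S.leadSq.1 + S.leadSq.2 * Real.goldenRatio := by
  rw [S.lead_eq, normSq_add_mul_hexRoot]
  simp only [Pos.leadSq]; push_cast
  linear_combination ((S.2.1.1 : ℝ) ^ 2 + S.2.1.1 * S.2.1.2 + S.2.1.2 ^ 2) * Real.goldenRatio_sq

theorem goldenRatio_bounds : 1.6180339 ≤ Real.goldenRatio ∧ Real.goldenRatio ≤ 1.6180340 := by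
  have h1 : 2.2360678 ≤ Real.sqrt 5 := Real.le_sqrt_of_sq_le (by norm_num)
  have h2 : Real.sqrt 5 ≤ 2.236068 := Real.sqrt_le_iff.2 ⟨by norm_num, by norm_num⟩
  rw [Real.goldenRatio]
  constructor <;> linarith

/-- An upper bound of `10 ^ 7 (m + n τ)`. -/
def upperBound (z : ℤ × ℤ) : ℤ := 10000000 * z.1 + z.2 * if 0 ≤ z.2 then 16180340 else 16180339

/-- A lower bound of `10 ^ 7 (m + n τ)`. -/
def lowerBound (z : ℤ × ℤ) : ℤ := 10000000 * z.1 + z.2 * if 0 ≤ z.2 then 16180339 else 16180340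

theorem le_upperBound (z : ℤ × ℤ) :
    (10000000 : ℝ) * (z.1 + z.2 * Real.goldenRatio) ≤ upperBound z := by
  obtain ⟨h1, h2⟩ := goldenRatio_bounds
  rw [upperBound]
  split_ifs with h
  · have : (0 : ℝ) ≤ z.2 := by exact_mod_cast h
    push_cast; nlinarith
  · have : (z.2 : ℝ) ≤ 0 := by exact_mod_cast (not_le.1 h).le
    push_cast; nlinarith

theorem lowerBound_le (z : ℤ × ℤ) :
    (lowerBound z : ℝ) ≤ 10000000 * (z.1 + z.2 * Real.goldenRatio) := by
  obtain ⟨h1, h2⟩ := goldenRatio_bounds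
  rw [lowerBound]
  split_ifs with h
  · have : (0 : ℝ) ≤ z.2 := by exact_mod_cast h
    push_cast; nlinarith
  · have : (z.2 : ℝ) ≤ 0 := by exact_mod_cast (not_le.1 h).le
    push_cast; nlinarith

/-- The bounds are scaled by 10⁷ and k counts millionths; the factor 10⁵ brings both sides to the
common denominator 10¹². -/
theorem Pos.norm_lead_le {S : Pos} {k : ℤ} (hk : 0 ≤ k)
    (h : upperBound S.leadSq * 100000 ≤ k ^ 2) : ‖S.lead‖ ≤ k / 1000000 := by
  have h1 := le_upperBound S.leadSq
  rw [← S.norm_lead_sq] at h1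
  have h2 : (upperBound S.leadSq : ℝ) * 100000 ≤ k ^ 2 := by exact_mod_cast h
  have h3 : (0 : ℝ) ≤ k := by exact_mod_cast hk
  refine abs_le_of_sq_le_sq' ?_ (by positivity) |>.2
  rw [div_pow]
  linarith

theorem Pos.le_norm_lead {S : Pos} {k : ℤ}
    (h : k ^ 2 ≤ lowerBound S.leadSq * 100000) : k / 1000000 ≤ ‖S.lead‖ := by
  have h1 := lowerBound_le S.leadSq
  rw [← S.norm_lead_sq] at h1
  have h2 : (k : ℝ) ^ 2 ≤ lowerBound S.leadSq * 100000 := by exact_mod_cast h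
  refine abs_le_of_sq_le_sq' ?_ (norm_nonneg _) |>.2
  rw [div_pow]
  linarith

end

/-! ### Superedges seen from a distance, and the winding number of the boundary of a supertile -/

noncomputable section

open Complex

variable {a b : ℝ} {n : ℕ}

/-! ### Arcs seen from a distance -/

/-- Difference of positions. -/
def Pos.minus (S S' : Pos) : Pos := S.plus (S'.rot 3)

theorem Pos.lead_minus (S S' : Pos) : (S.minus S').lead = S.lead - S'.lead := by
  rw [Pos.minus, Pos.lead_plus, Pos.lead_rot, hexRoot_pow_three]; ring

/-- The radius, in thousandths, of a disc that contains the arc in the limit. -/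
def Arc.reach : Arc → ℤ
  | .X => 1820 | .H => 1540 | .E => 589 | _ => 0

/-- The arc cannot be told from its chord outside the disc of its reach. -/
def IsTube (a b : ℝ) (C : ℝ) (n : ℕ) (k : Arc) : Prop :=
  ∀ p, k.reach / 1000 * ‖levelScale a b n‖ + C * (n + 1) ≤
      ‖p - levelScale a b n * (k.disp.lead / 2)‖ →
    sweep a b n k p = turnAngle (-p) (k.disp.ev a b n - p)

/-- The tube condition is stated for an arc at the origin. For a placed arc the start has to be
replaced by its leading term, which costs the extra M. -/
theorem straight_of_isTube {C M : ℝ} {t : Term} {p : ℂ} (h : IsTube a b C n t.arc)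
    (hM : ‖t.pos.ev a b n - levelScale a b n * t.pos.lead‖ ≤ M)
    (hp : t.arc.reach / 1000 * ‖levelScale a b n‖ + C * (n + 1) + M ≤
      ‖p - levelScale a b n * ((t.pos.lead + t.far.lead) / 2)‖) : Straight a b n p t := by
  have hω : hexRoot ^ t.r ≠ 0 := pow_ne_zero _ hexRoot_ne_zero
  have h2 : hexRoot ^ t.r * (hexRoot⁻¹) ^ t.r = 1 := by
    rw [← mul_pow, mul_inv_cancel₀ hexRoot_ne_zero, one_pow]
  have hn : ‖hexRoot ^ t.r‖ = 1 := by rw [norm_pow, norm_hexRoot, one_pow]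
  rw [Straight, sweepAt, h, ← turnAngle_mul_left hω]
  · congr 1
    · linear_combination (-(p - t.pos.ev a b n)) * h2
    · rw [Term.far, Pos.ev_plus, Pos.ev_rot]
      linear_combination (-(p - t.pos.ev a b n)) * h2
  · have e0 : ∀ z : ℂ, ‖z‖ = ‖hexRoot ^ t.r * z‖ := fun z => by rw [norm_mul, hn, one_mul]
    have e : hexRoot ^ t.r * (hexRoot⁻¹ ^ t.r * (p - t.pos.ev a b n) -
        levelScale a b n * (t.arc.disp.lead / 2)) =
        (p - levelScale a b n * ((t.pos.lead + t.far.lead) / 2)) -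
          (t.pos.ev a b n - levelScale a b n * t.pos.lead) := by
      rw [Term.far, Pos.lead_plus, Pos.lead_rot]
      linear_combination (p - t.pos.ev a b n) * h2
    rw [e0 (_ - _), e]
    have := norm_sub_norm_le (p - levelScale a b n * ((t.pos.lead + t.far.lead) / 2))
      (t.pos.ev a b n - levelScale a b n * t.pos.lead)
    linarith

/-- The origin of the position lattice. -/
def Pos.origin : Pos := ((0, 0), (0, 0), (0, 0), (0, 0))

theorem Pos.ev_origin : Pos.origin.ev a b n = 0 := by simp [Pos.ev, eis, Pos.origin]

theorem Pos.lead_origin : Pos.origin.lead = 0 := by simp [Pos.lead, eis, Pos.origin]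

/-- The discs of the parts of an arc lie in the disc of the arc. -/
def subdivides (k : Arc) : Bool :=
  isPath Pos.origin k.rule k.disp.shift && k.rule.all fun t =>
    decide (t.arc.code ≤ 2 ∧ 0 ≤ 2618 * k.reach - 1000 * t.arc.reach ∧
      upperBound (k.disp.shift.minus (t.pos.plus t.far)).leadSq * 100000 ≤
        (2 * (2618 * k.reach - 1000 * t.arc.reach)) ^ 2 ∧
      upperBound ((t.tgt.plus t.tgt).minus k.disp.shift).leadSq * 100000 ≤
        (2 * (2618 * k.reach)) ^ 2)

theorem subdivides_X : subdivides .X = true := by decide +kernel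
theorem subdivides_H : subdivides .H = true := by decide +kernel
theorem subdivides_E : subdivides .E = true := by decide +kernel

theorem norm_levelScale_succ : ‖levelScale a b (n + 1)‖ =
    Real.goldenRatio ^ 2 * ‖levelScale a b n‖ := by
  rw [levelScale_succ, norm_mul, norm_pow, Complex.norm_real, Real.norm_eq_abs,
    abs_of_pos Real.goldenRatio_pos]

theorem goldenRatio_sq_bound : 2.618 ≤ Real.goldenRatio ^ 2 := by
  rw [Real.goldenRatio_sq]; linarith [goldenRatio_bounds.1]

/-- The discs of the parts lie inside the disc of the whole arc, so an observer outside the large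
disc sees each part as its chord. All vertices of the resulting polygonal path lie in the large
disc, hence in one half-plane as seen by the observer, and the angles telescope to that of the long
chord. The rounding errors cost at most M + 1 per level, which explains the linear term C (n + 1).
-/
theorem isTube_succ {C M : ℝ} {k : Arc} (hMC : M + 1 ≤ C) (hk0 : k.code ≤ 2)
    (h0 : 0 ≤ M) (hk : subdivides k = true)
    (hM : ∀ t ∈ k.rule, ‖t.pos.ev a b n - levelScale a b n * t.pos.lead‖ ≤ M ∧
      ‖t.tgt.ev a b n - levelScale a b n * t.tgt.lead‖ ≤ M)
    (hM' : ‖k.disp.shift.ev a b n - levelScale a b n * k.disp.shift.lead‖ ≤ M)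
    (h : ∀ k' : Arc, k'.code ≤ 2 → IsTube a b C n k') : IsTube a b C (n + 1) k := by
  intro p hp
  rw [subdivides, Bool.and_eq_true, List.all_eq_true] at hk
  obtain ⟨hpath, hk⟩ := hk
  have hnn := norm_nonneg (levelScale a b n)
  have hτ := goldenRatio_sq_bound
  have hreach : (0 : ℝ) ≤ k.reach := by
    have : 0 ≤ k.reach := by cases k <;> simp [Arc.reach]
    exact_mod_cast this
  have hn0 : (0 : ℝ) ≤ n := Nat.cast_nonneg n
  have hcenter : levelScale a b (n + 1) * (k.disp.lead / 2) =
      levelScale a b n * (k.disp.shift.lead / 2) := by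
    rw [Pos.lead_shift, levelScale_succ]; ring
  rw [norm_levelScale_succ, hcenter] at hp
  push_cast at hp
  have hR : k.reach / 1000 * (2.618 * ‖levelScale a b n‖) ≤
      k.reach / 1000 * (Real.goldenRatio ^ 2 * ‖levelScale a b n‖) := by gcongr
  -- A vertex is compared with the centre through its leading term; 2618 / 1000 is the lower bound
  -- for τ² by which the radius grows from one level to the next.
  have point : ∀ S : Pos, ‖S.ev a b n - levelScale a b n * S.lead‖ ≤ M →
      ‖(S.plus S).lead - k.disp.shift.lead‖ ≤ 2 * (2618 * k.reach) / 1000000 →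
      ‖S.ev a b n - levelScale a b n * (k.disp.shift.lead / 2)‖ <
        k.reach / 1000 * (Real.goldenRatio ^ 2 * ‖levelScale a b n‖) + C * (n + 1 + 1) := by
    intro S h1 h2
    have e : S.ev a b n - levelScale a b n * (k.disp.shift.lead / 2) =
        (S.ev a b n - levelScale a b n * S.lead) +
          levelScale a b n * (((S.plus S).lead - k.disp.shift.lead) / 2) := by
      rw [Pos.lead_plus]; ring
    have h3 := norm_add_le (S.ev a b n - levelScale a b n * S.lead)
      (levelScale a b n * (((S.plus S).lead - k.disp.shift.lead) / 2))
    rw [← e, norm_mul, norm_div, RCLike.norm_ofNat] at h3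
    have h4 : ‖levelScale a b n‖ * (‖(S.plus S).lead - k.disp.shift.lead‖ / 2) ≤
        ‖levelScale a b n‖ * (2618 * k.reach / 1000000) :=
      mul_le_mul_of_nonneg_left (by linarith) hnn
    nlinarith
  have htgt : ∀ t ∈ k.rule, ‖t.tgt.ev a b n - levelScale a b n * (k.disp.shift.lead / 2)‖ <
        k.reach / 1000 * (Real.goldenRatio ^ 2 * ‖levelScale a b n‖) + C * (n + 1 + 1) := by
    intro t ht
    have := of_decide_eq_true (hk t ht)
    refine point _ (hM t ht).2 ?_
    rw [← Pos.lead_minus]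
    have h5 := Pos.norm_lead_le (by have : 0 ≤ k.reach := by exact_mod_cast hreach
                                    positivity) this.2.2.2
    push_cast at h5
    exact h5
  have hdisp : ‖k.disp.shift.lead‖ ≤ 2 * (2618 * k.reach) / 1000000 := by
    have h5 : upperBound k.disp.shift.leadSq * 100000 ≤ (2 * (2618 * k.reach)) ^ 2 := by
      cases k
      case A => simp [Arc.code] at hk0
      case B => simp [Arc.code] at hk0
      all_goals decide
    have h6 := Pos.norm_lead_le (by have : 0 ≤ k.reach := by exact_mod_cast hreach
                                    positivity) h5
    push_cast at h6
    exact h6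
  have := totalSweep_of_isPath_ball (a := a) (b := b) (n := n) (p := p)
    (c := levelScale a b n * (k.disp.shift.lead / 2)) _ _ _ hpath ?_ hp ?_ ?_ htgt
  · rw [sweep_succ, this, Pos.ev_origin, Pos.ev_shift, zero_sub]
  · intro t ht
    have h1 := of_decide_eq_true (hk t ht)
    refine straight_of_isTube (h t.arc h1.1) (hM t ht).1 ?_
    have h2 : (0 : ℤ) ≤ 2 * (2618 * k.reach - 1000 * t.arc.reach) := by linarith [h1.2.1]
    have h3 := Pos.norm_lead_le h2 h1.2.2.1
    rw [Pos.lead_minus, Pos.lead_plus] at h3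
    have e : p - levelScale a b n * (k.disp.shift.lead / 2) =
        (p - levelScale a b n * ((t.pos.lead + t.far.lead) / 2)) - levelScale a b n *
          ((k.disp.shift.lead - (t.pos.lead + t.far.lead)) / 2) := by ring
    have h4 := norm_sub_le (p - levelScale a b n * ((t.pos.lead + t.far.lead) / 2))
      (levelScale a b n * ((k.disp.shift.lead - (t.pos.lead + t.far.lead)) / 2))
    rw [← e, norm_mul, norm_div, RCLike.norm_ofNat] at h4
    push_cast at h3
    have h5 : ‖levelScale a b n‖ * (‖k.disp.shift.lead - (t.pos.lead + t.far.lead)‖ / 2) ≤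
        ‖levelScale a b n‖ * ((2618 * k.reach - 1000 * t.arc.reach) / 1000000) :=
      mul_le_mul_of_nonneg_left (by linarith) hnn
    nlinarith
  · refine point _ (by simp [Pos.ev_origin, Pos.lead_origin, h0]) ?_
    rw [Pos.lead_plus, Pos.lead_origin, add_zero, zero_sub, norm_neg]
    exact hdisp
  · refine point _ hM' ?_
    rw [Pos.lead_plus, add_sub_cancel_right]
    exact hdisp

/-- The end point of the path of an arc of the lowest level. -/
def pathEnd : Arc → Pos
  | .X => ((0, 0), (0, 0), (2, 0), (-2, 4))
  | .H => ((0, 0), (0, 0), (1, 0), (-1, 1))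
  | _ => Pos.origin

theorem isPath_path (k : Arc) (hk : k.code ≤ 2) :
    isPath Pos.origin k.path (pathEnd k) = true ∧ (pathEnd k).ground = k.disp.ground ∧
      ∀ t ∈ k.path, t.arc.code = 3 ∨ t.arc.code = 4 := by
  cases k
  case A => simp [Arc.code] at hk
  case B => simp [Arc.code] at hk
  all_goals decide

theorem straight_edge {t : Term} (h : t.arc.code = 3 ∨ t.arc.code = 4) (p : ℂ) :
    Straight a b n p t := by
  have hA : Arc.code .A = 3 := rfl
  have hB : Arc.code .B = 4 := rfl
  rw [← hA, ← hB] at h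
  have h' : t.arc = .A ∨ t.arc = .B :=
    h.imp (fun h => Arc.code_injective h) (fun h => Arc.code_injective h)
  rw [Straight, sweepAt_edge _ h', Term.far, Pos.ev_plus, Pos.ev_rot]
  congr 2
  rcases h' with h | h <;> simp [h, edgeVec, Arc.disp, Pos.ev, eis]

theorem turnAngle_self (z : ℂ) : turnAngle z z = 0 := by
  have := turnAngle_symm z z
  linarith

theorem exists_bound {α : Type*} (l : List α) (f : α → ℝ) : ∃ M, 0 ≤ M ∧ ∀ x ∈ l, f x ≤ M := by
  induction l with
  | nil => exact ⟨0, le_rfl, by simp⟩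
  | cons x l ih =>
    obtain ⟨M, hM, h⟩ := ih
    refine ⟨max M (f x), le_max_of_le_left hM, fun y hy => ?_⟩
    rcases List.mem_cons.1 hy with rfl | hy
    · exact le_max_right _ _
    · exact (h y hy).trans (le_max_left _ _)

/-- On the ground the arc is a finite path of edges, which lies in some disc around the centre.
Validity for every larger constant allows a common C for the three types of arcs. -/
theorem exists_isTube_zero (a b : ℝ) (k : Arc) (hk : k.code ≤ 2) :
    ∃ C₀, ∀ C, C₀ ≤ C → IsTube a b C 0 k := by
  obtain ⟨hp, hg, he⟩ := isPath_path k hk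
  obtain ⟨M, hM, hb⟩ := exists_bound (Pos.origin :: pathEnd k :: k.path.map Term.tgt)
    fun S => ‖S.ev a b 0 - levelScale a b 0 * (k.disp.lead / 2)‖
  refine ⟨M + 1, fun C hC p h => ?_⟩
  have hend : (pathEnd k).ev a b 0 = k.disp.ev a b 0 := by
    rw [← Pos.ev_ground, hg, Pos.ev_ground]
  have hreach : (0 : ℝ) ≤ k.reach / 1000 * ‖levelScale a b 0‖ := by
    have : 0 ≤ k.reach := by cases k <;> simp [Arc.reach]
    have : (0 : ℝ) ≤ k.reach := by exact_mod_cast this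
    positivity
  have h' : M + 1 ≤ ‖p - levelScale a b 0 * (k.disp.lead / 2)‖ := by
    push_cast at h; linarith
  have lt : ∀ S ∈ Pos.origin :: pathEnd k :: k.path.map Term.tgt,
      ‖S.ev a b 0 - levelScale a b 0 * (k.disp.lead / 2)‖ < M + 1 :=
    fun S hS => (hb S hS).trans_lt (by linarith)
  rw [sweep_zero, totalSweep_of_isPath_ball (c := levelScale a b 0 * (k.disp.lead / 2)) _ _ _ hp
    (fun t ht => straight_edge (he t ht) p) h' (lt _ (by simp)) (lt _ (by simp))
    (fun t ht => lt _ (by simp only [List.mem_cons, List.mem_map]; exact Or.inr (Or.inr ⟨t, ht, rfl⟩))), hend,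
    Pos.ev_origin, zero_sub]

/-- The three types are treated together because their rules refer to each other. One C serves all
levels, and the error C (n + 1) is negligible against the exponentially growing scale. -/
theorem exists_isTube (a b : ℝ) :
    ∃ C, 0 ≤ C ∧ ∀ n, ∀ k : Arc, k.code ≤ 2 → IsTube a b C n k := by
  have hsub : ∀ k : Arc, k.code ≤ 2 → subdivides k = true := by
    intro k hk
    cases k
    case X => exact subdivides_X
    case H => exact subdivides_H
    case E => exact subdivides_E
    all_goals simp [Arc.code] at hk
  obtain ⟨M, hM, hb⟩ := exists_norm_ev_sub_le a b
    ((ruleX ++ ruleH ++ ruleE).map Term.pos ++ (ruleX ++ ruleH ++ ruleE).map Term.tgt ++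
      [Arc.X.disp.shift, Arc.H.disp.shift, Arc.E.disp.shift])
  obtain ⟨CX, hX⟩ := exists_isTube_zero a b .X (by decide)
  obtain ⟨CH, hH⟩ := exists_isTube_zero a b .H (by decide)
  obtain ⟨CE, hE⟩ := exists_isTube_zero a b .E (by decide)
  refine ⟨max (max CX CH) (max CE (M + 1)),
    le_max_of_le_right (le_max_of_le_right (by linarith)), fun n => ?_⟩
  induction n with
  | zero =>
    intro k hk
    cases k
    case X => exact hX _ ((le_max_left _ _).trans (le_max_left _ _))
    case H => exact hH _ ((le_max_right _ _).trans (le_max_left _ _))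
    case E => exact hE _ ((le_max_left _ _).trans (le_max_right _ _))
    all_goals simp [Arc.code] at hk
  | succ n ih =>
    intro k hk
    have hrule : ∀ t ∈ k.rule, t ∈ ruleX ++ ruleH ++ ruleE := by
      intro t ht
      cases k
      case X => simp only [List.mem_append]; exact Or.inl (Or.inl ht)
      case H => simp only [List.mem_append]; exact Or.inl (Or.inr ht)
      case E => simp only [List.mem_append]; exact Or.inr ht
      all_goals simp [Arc.code] at hk
    refine isTube_succ ((le_max_right _ _).trans (le_max_right _ _)) hk hM (hsub k hk) ?_ ?_ ih
    · intro t ht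
      refine ⟨hb _ ?_ n, hb _ ?_ n⟩
      · exact List.mem_append_left _ (List.mem_append_left _ (List.mem_map_of_mem (hrule t ht)))
      · exact List.mem_append_left _ (List.mem_append_right _ (List.mem_map_of_mem (hrule t ht)))
    · refine hb _ (List.mem_append_right _ ?_) n
      cases k
      case A => simp [Arc.code] at hk
      case B => simp [Arc.code] at hk
      all_goals simp

/-! ### The winding number of a supertile around a disc in its interior -/

/-- Twice the real part of the leading term, as `m + n τ`. -/
def Pos.twiceRe (S : Pos) : ℤ × ℤ := (2 * S.1.1 + S.1.2, 2 * S.2.1.1 + S.2.1.2)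

theorem Pos.two_mul_lead_re (S : Pos) :
    2 * S.lead.re = S.twiceRe.1 + S.twiceRe.2 * Real.goldenRatio := by
  rw [S.lead_eq]
  simp only [Pos.twiceRe, hexRoot, Complex.add_re, Complex.mul_re, Complex.ofReal_re,
    Complex.ofReal_im, Complex.I_re, Complex.I_im, Complex.div_re, Complex.one_re]
  push_cast
  simp
  ring

/-- Four times the position of the centre of the disc. -/
def fourCenter : Pos := ((18, -17), (0, 0), (0, 0), (0, 0))

/-- The centre of the disc in units of the scale of the level. -/
def discCenter : ℂ := fourCenter.lead / 4

/-- The direction of the point from the centre has a large component along `ω ^ j`. -/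
def inHalfPlane (j : ℕ) (S : Pos) : Bool :=
  16000000 ≤ lowerBound
    (((S.plus S).plus (S.plus S)).minus fourCenter |>.rot (12 - j)).twiceRe

/-- The constant is 10⁷ · 2 · 4 · (1/5): the scale of `lowerBound`, the doubled real part, the
common denominator 4 of the centre, and the margin. -/
theorem re_of_inHalfPlane {j : ℕ} (hj : j ≤ 12) {S : Pos} (h : inHalfPlane j S = true) :
    1 / 5 ≤ ((S.lead - discCenter) * (starRingEnd ℂ) (hexRoot ^ j)).re := by
  rw [inHalfPlane, decide_eq_true_eq] at h
  set D := ((S.plus S).plus (S.plus S)).minus fourCenter |>.rot (12 - j)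
  have h1 : (16000000 : ℝ) ≤ lowerBound D.twiceRe := by exact_mod_cast h
  have h2 := lowerBound_le D.twiceRe
  rw [← D.two_mul_lead_re] at h2
  have e : D.lead = (4 : ℝ) * ((S.lead - discCenter) * (starRingEnd ℂ) (hexRoot ^ j)) := by
    simp only [D, Pos.lead_rot, Pos.lead_minus, Pos.lead_plus, conj_hexRoot_pow hj, discCenter]
    push_cast; ring
  rw [e, Complex.re_ofReal_mul] at h2
  linarith

/-- The margin 1/5 is shared equally by the rounding error of the position and the displacement of p
within the disc. -/
theorem re_pos_of_inHalfPlane {j : ℕ} (hj : j ≤ 12) {S : Pos} (h : inHalfPlane j S = true)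
    {p g : ℂ} {M : ℝ} (hS : ‖S.ev a b n - g * S.lead‖ ≤ M) (hM : M < ‖g‖ / 10)
    (hp : ‖p - g * discCenter‖ ≤ ‖g‖ / 10) :
    0 < ((S.ev a b n - p) * (starRingEnd ℂ) (g * hexRoot ^ j)).re := by
  have hg : 0 < ‖g‖ := by linarith [norm_nonneg (S.ev a b n - g * S.lead)]
  have h1 := re_of_inHalfPlane hj h
  have e : (S.ev a b n - p) * (starRingEnd ℂ) (g * hexRoot ^ j) =
      ((‖g‖ ^ 2 : ℝ) : ℂ) * ((S.lead - discCenter) * (starRingEnd ℂ) (hexRoot ^ j)) +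
      ((S.ev a b n - g * S.lead) - (p - g * discCenter)) *
        (starRingEnd ℂ) (g * hexRoot ^ j) := by
    rw [← Complex.normSq_eq_norm_sq, ← Complex.mul_conj, map_mul]
    ring
  have h2 := Complex.abs_re_le_norm (((S.ev a b n - g * S.lead) - (p - g * discCenter)) *
        (starRingEnd ℂ) (g * hexRoot ^ j))
  rw [norm_mul, Complex.norm_conj, norm_mul, norm_pow, norm_hexRoot, one_pow, mul_one] at h2
  have h3 := norm_sub_le (S.ev a b n - g * S.lead) (p - g * discCenter)
  have h4 : ‖(S.ev a b n - g * S.lead) - (p - g * discCenter)‖ * ‖g‖ < ‖g‖ / 5 * ‖g‖ :=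
    mul_lt_mul_of_pos_right (by linarith) hg
  have h5 := (abs_le.1 h2).1
  rw [e, Complex.add_re, Complex.re_ofReal_mul]
  nlinarith

/-- The disc is not reached by the arc. -/
def avoidsDisc (t : Term) : Bool :=
  decide (t.arc.code ≤ 2 ∧ (4 * (1000 * t.arc.reach + 200000)) ^ 2 ≤ lowerBound
    (fourCenter.minus ((t.pos.plus t.far).plus (t.pos.plus t.far))).leadSq * 100000)

theorem avoidsDisc_boundary8 : boundary8.all avoidsDisc = true := by decide +kernel

/-- Again a margin of 1/5, here 200000 millionths: one half for the position of p in the disc, the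
other for the error terms of the tube. -/
theorem straight_of_avoidsDisc {t : Term} (h : avoidsDisc t = true) {C M : ℝ} {p : ℂ}
    (hC : ∀ k : Arc, k.code ≤ 2 → IsTube a b C n k)
    (hM : ‖t.pos.ev a b n - levelScale a b n * t.pos.lead‖ ≤ M)
    (hg : C * (n + 1) + M ≤ ‖levelScale a b n‖ / 10)
    (hp : ‖p - levelScale a b n * discCenter‖ ≤ ‖levelScale a b n‖ / 10) :
    Straight a b n p t := by
  have h := of_decide_eq_true h
  refine straight_of_isTube (hC _ h.1) hM ?_
  have h1 := Pos.le_norm_lead h.2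
  have e : (fourCenter.minus ((t.pos.plus t.far).plus (t.pos.plus t.far))).lead =
      4 * (discCenter - (t.pos.lead + t.far.lead) / 2) := by
    simp only [Pos.lead_minus, Pos.lead_plus, discCenter]; ring
  rw [e, norm_mul, RCLike.norm_ofNat] at h1
  push_cast at h1
  have e2 : p - levelScale a b n * ((t.pos.lead + t.far.lead) / 2) =
      levelScale a b n * (discCenter - (t.pos.lead + t.far.lead) / 2) -
        -(p - levelScale a b n * discCenter) := by ring
  have h2 := norm_sub_norm_le
    (levelScale a b n * (discCenter - (t.pos.lead + t.far.lead) / 2))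
    (-(p - levelScale a b n * discCenter))
  rw [← e2, norm_mul, norm_neg] at h2
  have h3 : ‖levelScale a b n‖ * ((1000 * t.arc.reach + 200000) / 1000000) ≤
      ‖levelScale a b n‖ * ‖discCenter - (t.pos.lead + t.far.lead) / 2‖ := by
    gcongr; linarith
  linarith

/-- The boundary is cut at its terms 0, 4 and 14 into three paths. Seen from the disc, each lies in
one half-plane, in the directions ω, ω⁵ and ω⁹ respectively. -/
theorem boundary8_paths :
    isPath ((0,0),(0,0),(0,1),(0,0)) (boundary8.take 4) (boundary8[4]).src = true ∧
    isPath (boundary8[4]).src ((boundary8.drop 4).take 10) (boundary8[14]).src = true ∧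
    isPath (boundary8[14]).src (boundary8.drop 14) ((0,0),(0,0),(0,1),(0,0)) = true := by
  decide +kernel

theorem boundary8_halfPlanes :
    inHalfPlane 1 ((0,0),(0,0),(0,1),(0,0)) = true ∧
    inHalfPlane 9 ((0,0),(0,0),(0,1),(0,0)) = true ∧
    inHalfPlane 1 (boundary8[4]).src = true ∧ inHalfPlane 5 (boundary8[4]).src = true ∧
    inHalfPlane 5 (boundary8[14]).src = true ∧ inHalfPlane 9 (boundary8[14]).src = true ∧
    (∀ t ∈ boundary8.take 4, inHalfPlane 1 t.tgt = true) ∧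
    (∀ t ∈ (boundary8.drop 4).take 10, inHalfPlane 5 t.tgt = true) ∧
    (∀ t ∈ boundary8.drop 14, inHalfPlane 9 t.tgt = true) := by
  decide +kernel

theorem baseScale_ne_zero (ha : 0 ≤ a) (hb : 0 ≤ b) (hab : 0 < a + b) : baseScale a b ≠ 0 := by
  have h0 : (1 + (Real.goldenRatio : ℂ) ^ 2) ≠ 0 := by
    have : (1 + Real.goldenRatio ^ 2 : ℝ) ≠ 0 := by positivity
    exact_mod_cast this
  refine div_ne_zero (fun h => ?_) h0
  have h1 := congrArg Complex.re h
  have h3 : 0 < Real.sqrt 3 := by positivity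
  have hτ := Real.goldenRatio_pos
  have e : ((scales a b 0).1 + Real.goldenRatio * (scales a b 0).2).re =
      a * Real.sqrt 3 * (1 + Real.goldenRatio) + b := by
    simp only [scales, edgeUnit, hexRoot, Complex.add_re, Complex.mul_re, Complex.ofReal_re,
      Complex.ofReal_im, Complex.I_re, Complex.I_im, Complex.sub_re, Complex.sub_im,
      Complex.mul_im, Complex.add_im]
    norm_num
    ring
  rw [e, Complex.zero_re] at h1
  rcases ha.eq_or_lt with h | h
  · rw [← h] at h1 hab; linarith
  · have : 0 < a * Real.sqrt 3 * (1 + Real.goldenRatio) := by positivity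
    linarith

/-- The scale grows like τ^{2n} and beats every linear error term. -/
theorem eventually_le_levelScale (ha : 0 ≤ a) (hb : 0 ≤ b) (hab : 0 < a + b) (C M : ℝ) :
    ∀ᶠ n : ℕ in Filter.atTop, C * (n + 1) + M < ‖levelScale a b n‖ / 10 := by
  have hpos : 0 < ‖baseScale a b‖ := norm_pos_iff.2 (baseScale_ne_zero ha hb hab)
  have e : ∀ n, ‖levelScale a b n‖ = ‖baseScale a b‖ * (Real.goldenRatio ^ 2) ^ n := by
    intro n
    rw [levelScale, norm_mul, norm_pow, Complex.norm_real, Real.norm_eq_abs,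
      abs_of_pos Real.goldenRatio_pos, pow_mul]
  have h1 : (1 : ℝ) < Real.goldenRatio ^ 2 := by linarith [goldenRatio_sq_bound]
  have h2 := tendsto_pow_const_div_const_pow_of_one_lt 1 h1
  have h3 := tendsto_pow_const_div_const_pow_of_one_lt 0 h1
  have h4 := ((h2.const_mul C).add (h3.const_mul (C + M)))
  simp only [mul_zero, add_zero] at h4
  have h5 : (0 : ℝ) < ‖baseScale a b‖ / 10 := by positivity
  filter_upwards [h4.eventually_lt_const h5] with n hn
  have hp : (0 : ℝ) < (Real.goldenRatio ^ 2) ^ n := by positivity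
  rw [e]
  rw [pow_one, pow_zero, mul_div_assoc', mul_div_assoc', ← add_div, div_lt_iff₀ hp] at hn
  linarith

/-- From the disc each boundary arc looks like its chord, and the three paths telescope in their
half-planes. At each of the three cuts the reference direction turns by a third of a circle, and
these jumps sum to 2π. The boundary runs clockwise, the direction in which `turnAngle` counts
positively. -/
theorem exists_totalSweep_boundary8 (ha : 0 ≤ a) (hb : 0 ≤ b) (hab : 0 < a + b) :
    ∀ᶠ n : ℕ in Filter.atTop, ∀ p : ℂ,
      ‖p - levelScale a b n * discCenter‖ ≤ ‖levelScale a b n‖ / 10 →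
      totalSweep a b n p boundary8 = 2 * Real.pi := by
  obtain ⟨C, hC0, hC⟩ := exists_isTube a b
  obtain ⟨M, hM, hbd⟩ := exists_norm_ev_sub_le a b
    (boundary8.map Term.pos ++ boundary8.map Term.tgt ++ boundary8.map Term.src)
  filter_upwards [eventually_le_levelScale ha hb hab C M] with n hn p hp
  have hn0 : 0 ≤ C * (n + 1) := by positivity
  have hMg : M < ‖levelScale a b n‖ / 10 := by linarith
  have hpos : ∀ t ∈ boundary8, ‖t.pos.ev a b n - levelScale a b n * t.pos.lead‖ ≤ M :=
    fun t ht => hbd _ (by simp only [List.mem_append, List.mem_map]; exact Or.inl (Or.inl ⟨t, ht, rfl⟩)) n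
  have htgt : ∀ t ∈ boundary8, ‖t.tgt.ev a b n - levelScale a b n * t.tgt.lead‖ ≤ M :=
    fun t ht => hbd _ (by simp only [List.mem_append, List.mem_map]; exact Or.inl (Or.inr ⟨t, ht, rfl⟩)) n
  have hsrc : ∀ t ∈ boundary8, ‖t.src.ev a b n - levelScale a b n * t.src.lead‖ ≤ M :=
    fun t ht => hbd _ (by simp only [List.mem_append, List.mem_map]; exact Or.inr ⟨t, ht, rfl⟩) n
  have hstr : ∀ t ∈ boundary8, Straight a b n p t := fun t ht =>
    straight_of_avoidsDisc (List.all_eq_true.1 avoidsDisc_boundary8 t ht) (hC n) (hpos t ht)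
      hn.le hp
  obtain ⟨p1, p2, p3⟩ := boundary8_paths
  obtain ⟨a1, a9, b1, b5, c5, c9, t1, t5, t9⟩ := boundary8_halfPlanes
  have hP0 : ‖Pos.ev a b n ((0,0),(0,0),(0,1),(0,0)) -
      levelScale a b n * Pos.lead ((0,0),(0,0),(0,1),(0,0))‖ ≤ M :=
    hsrc boundary8[0] (by simp [boundary8])
  have hP4 := hsrc boundary8[4] (List.getElem_mem _)
  have hP14 := hsrc boundary8[14] (List.getElem_mem _)
  have m1 : ∀ t ∈ boundary8.take 4, t ∈ boundary8 := fun t ht => List.mem_of_mem_take ht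
  have m2 : ∀ t ∈ (boundary8.drop 4).take 10, t ∈ boundary8 :=
    fun t ht => List.mem_of_mem_drop (List.mem_of_mem_take ht)
  have m3 : ∀ t ∈ boundary8.drop 14, t ∈ boundary8 := fun t ht => List.mem_of_mem_drop ht
  have s1 := totalSweep_of_isPath (a := a) (b := b) (n := n) (p := p) _ _ _ p1
    (fun t ht => hstr t (m1 t ht))
    (re_pos_of_inHalfPlane (by norm_num) a1 hP0 hMg hp)
    (fun t ht => re_pos_of_inHalfPlane (by norm_num) (t1 t ht) (htgt t (m1 t ht)) hMg hp)
  have s2 := totalSweep_of_isPath (a := a) (b := b) (n := n) (p := p) _ _ _ p2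
    (fun t ht => hstr t (m2 t ht))
    (re_pos_of_inHalfPlane (by norm_num) b5 hP4 hMg hp)
    (fun t ht => re_pos_of_inHalfPlane (by norm_num) (t5 t ht) (htgt t (m2 t ht)) hMg hp)
  have s3 := totalSweep_of_isPath (a := a) (b := b) (n := n) (p := p) _ _ _ p3
    (fun t ht => hstr t (m3 t ht))
    (re_pos_of_inHalfPlane (by norm_num) c9 hP14 hMg hp)
    (fun t ht => re_pos_of_inHalfPlane (by norm_num) (t9 t ht) (htgt t (m3 t ht)) hMg hp)
  -- Consecutive reference directions differ by the factor ω⁴, cyclically, as ω¹³ = ω.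
  have e5 : levelScale a b n * hexRoot ^ 5 = levelScale a b n * hexRoot ^ 1 * hexRoot ^ 4 := by
    ring
  have e9 : levelScale a b n * hexRoot ^ 9 = levelScale a b n * hexRoot ^ 5 * hexRoot ^ 4 := by
    ring
  have e1 : levelScale a b n * hexRoot ^ 1 = levelScale a b n * hexRoot ^ 9 * hexRoot ^ 4 := by
    linear_combination (-levelScale a b n * (hexRoot ^ 7 + hexRoot)) * hexRoot_pow_six
  have r5 := arg_div_rotate (re_pos_of_inHalfPlane (by norm_num) b1 hP4 hMg hp)
    (by rw [← e5]; exact re_pos_of_inHalfPlane (by norm_num) b5 hP4 hMg hp)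
  have r9 := arg_div_rotate (re_pos_of_inHalfPlane (by norm_num) c5 hP14 hMg hp)
    (by rw [← e9]; exact re_pos_of_inHalfPlane (by norm_num) c9 hP14 hMg hp)
  have r1 := arg_div_rotate (re_pos_of_inHalfPlane (by norm_num) a9 hP0 hMg hp)
    (by rw [← e1]; exact re_pos_of_inHalfPlane (by norm_num) a1 hP0 hMg hp)
  rw [← e5] at r5
  rw [← e9] at r9
  rw [← e1] at r1
  have hsplit : boundary8 = boundary8.take 4 ++ ((boundary8.drop 4).take 10 ++
      boundary8.drop 14) := rfl
  rw [hsplit, totalSweep_append, totalSweep_append, s1, s2, s3]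
  linarith

end

/-! ### A disc criterion for regions between two arcs that are transversal to a pencil of lines -/

noncomputable section

open Complex

/-! ### Regions between two arcs that are transversal to a pencil of lines -/

/-- The abscissa with respect to the axis `ℝ ω`. -/
def hexRe (z : ℂ) : ℝ := ((starRingEnd ℂ) hexRoot * z).re

/-- The ordinate with respect to the axis `ℝ ω`. -/
def hexIm (z : ℂ) : ℝ := ((starRingEnd ℂ) hexRoot * z).im

/-- The point with given abscissa and ordinate with respect to the axis `ℝ ω`. -/
def hexPoint (x y : ℝ) : ℂ := hexRoot * (x + y * I)

theorem conj_hexRoot_mul_self : (starRingEnd ℂ) hexRoot * hexRoot = 1 := by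
  rw [conj_hexRoot_eq_inv, inv_mul_cancel₀ hexRoot_ne_zero]

theorem hexRe_hexPoint (x y : ℝ) : hexRe (hexPoint x y) = x := by
  rw [hexRe, hexPoint, ← mul_assoc, conj_hexRoot_mul_self]; simp

theorem hexIm_hexPoint (x y : ℝ) : hexIm (hexPoint x y) = y := by
  rw [hexIm, hexPoint, ← mul_assoc, conj_hexRoot_mul_self]; simp

theorem hexPoint_hexRe_hexIm (z : ℂ) : hexPoint (hexRe z) (hexIm z) = z := by
  rw [hexPoint, hexRe, hexIm, Complex.re_add_im, ← mul_assoc, mul_comm hexRoot,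
    conj_hexRoot_mul_self, one_mul]

theorem continuous_hexRe : Continuous hexRe := by unfold hexRe; fun_prop

theorem continuous_hexIm : Continuous hexIm := by unfold hexIm; fun_prop

theorem hexRe_combo (l m : ℝ) (z w : ℂ) :
    hexRe (l • z + m • w) = l * hexRe z + m * hexRe w := by
  simp only [hexRe, Complex.real_smul]
  rw [show (starRingEnd ℂ) hexRoot * ((l : ℂ) * z + m * w) =
    (l : ℂ) * ((starRingEnd ℂ) hexRoot * z) + (m : ℂ) * ((starRingEnd ℂ) hexRoot * w) by ring,
    Complex.add_re, Complex.re_ofReal_mul, Complex.re_ofReal_mul]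

theorem hexIm_combo (l m : ℝ) (z w : ℂ) :
    hexIm (l • z + m • w) = l * hexIm z + m * hexIm w := by
  simp only [hexIm, Complex.real_smul]
  rw [show (starRingEnd ℂ) hexRoot * ((l : ℂ) * z + m * w) =
    (l : ℂ) * ((starRingEnd ℂ) hexRoot * z) + (m : ℂ) * ((starRingEnd ℂ) hexRoot * w) by ring,
    Complex.add_im, Complex.im_ofReal_mul, Complex.im_ofReal_mul]

/-- The parameter of the line through the point and the vertex `(u, v)` of a pencil. -/
def pencil (u v : ℝ) (z : ℂ) : ℝ := (hexRe z - u) / (v - hexIm z)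

variable {u v : ℝ}

theorem pencil_lt_iff {z w : ℂ} (hz : hexIm z < v) (hw : hexIm w < v) :
    pencil u v z < pencil u v w ↔
      (hexRe z - u) * (v - hexIm w) < (hexRe w - u) * (v - hexIm z) :=
  div_lt_div_iff₀ (sub_pos.2 hz) (sub_pos.2 hw)

theorem pencil_hexPoint {s y : ℝ} (hy : y < v) :
    pencil u v (hexPoint (u + s * (v - y)) y) = s := by
  rw [pencil, hexRe_hexPoint, hexIm_hexPoint, add_sub_cancel_left,
    mul_div_cancel_right₀ _ (sub_pos.2 hy).ne']

theorem hexPoint_pencil {z : ℂ} (hz : hexIm z < v) :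
    hexPoint (u + pencil u v z * (v - hexIm z)) (hexIm z) = z := by
  rw [pencil, div_mul_cancel₀ _ (sub_pos.2 hz).ne', add_sub_cancel, hexPoint_hexRe_hexIm]

theorem eq_of_pencil_eq {z w : ℂ} (hz : hexIm z < v) (h : pencil u v z = pencil u v w)
    (h' : hexIm z = hexIm w) : z = w := by
  rw [← hexPoint_pencil (u := u) (z := z) hz, ← hexPoint_pencil (u := u) (z := w) (h' ▸ hz), h, h']

theorem continuousOn_pencil : ContinuousOn (pencil u v) {z | hexIm z < v} := by
  unfold pencil
  refine ContinuousOn.div ?_ ?_ fun z hz => (sub_pos.2 hz).ne'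
  · exact (continuous_hexRe.sub continuous_const).continuousOn
  · exact (continuous_const.sub continuous_hexIm).continuousOn

theorem combo_lt {x y k : ℝ} (hx : x < v) (hy : y < v) (h0 : 0 ≤ k) (h1 : k ≤ 1) :
    (1 - k) * x + k * y < v := by
  rcases h0.eq_or_lt with rfl | h0
  · linarith
  · nlinarith [mul_pos h0 (sub_pos.2 hy), mul_nonneg (sub_nonneg.2 h1) (sub_pos.2 hx).le]

/-- Along a segment the pencil parameter is a fractional linear function without a pole, hence
monotone. -/
theorem pencil_segment_lt {P Q : ℂ} (hP : hexIm P < v) (hQ : hexIm Q < v)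
    (h : pencil u v P < pencil u v Q) {l m : ℝ} (hl : 0 ≤ l) (hlm : l < m) (hm : m ≤ 1) :
    pencil u v ((1 - l) • P + l • Q) < pencil u v ((1 - m) • P + m • Q) := by
  rw [pencil_lt_iff hP hQ] at h
  have key : ∀ k : ℝ, 0 ≤ k → k ≤ 1 → hexIm ((1 - k) • P + k • Q) < v := by
    intro k h0 h1
    rw [hexIm_combo]
    exact combo_lt hP hQ h0 h1
  rw [pencil_lt_iff (key l hl (by linarith)) (key m (by linarith) hm)]
  simp only [hexRe_combo, hexIm_combo]
  nlinarith

/-- The polygonal arc through the points of a list. -/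
def chainSet : List ℂ → Set ℂ
  | [] => ∅
  | [P] => {P}
  | P :: Q :: l => segment ℝ P Q ∪ chainSet (Q :: l)

/-- Polygonal arcs that are transversal to the pencil. -/
def Rising (u v : ℝ) : List ℂ → Prop
  | [] => False
  | [P] => hexIm P < v
  | P :: Q :: l => hexIm P < v ∧ (P = Q ∨ pencil u v P < pencil u v Q) ∧ Rising u v (Q :: l)

/-- Compact arcs that meet each line of the pencil, in a given range, exactly once. -/
structure IsSection (u v : ℝ) (G : Set ℂ) (s₀ s₁ : ℝ) : Prop where
  compact : IsCompact G
  lt : ∀ z ∈ G, hexIm z < v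
  inj : Set.InjOn (pencil u v) G
  image : pencil u v '' G = Set.Icc s₀ s₁

theorem isSection_segment {P Q : ℂ} (hP : hexIm P < v) (hQ : hexIm Q < v)
    (h : P = Q ∨ pencil u v P < pencil u v Q) :
    IsSection u v (segment ℝ P Q) (pencil u v P) (pencil u v Q) := by
  rcases h with rfl | h
  · rw [segment_same]
    exact ⟨isCompact_singleton, by simpa using hP, Set.injOn_singleton _ _, by simp⟩
  have lt : ∀ z ∈ segment ℝ P Q, hexIm z < v := by
    rintro z ⟨l, m, hl, hm, hlm, rfl⟩
    rw [hexIm_combo]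
    obtain rfl : l = 1 - m := by linarith
    exact combo_lt hP hQ hm (by linarith)
  have form : ∀ z ∈ segment ℝ P Q, ∃ m : ℝ, 0 ≤ m ∧ m ≤ 1 ∧ z = (1 - m) • P + m • Q := by
    rintro z ⟨l, m, hl, hm, hlm, rfl⟩
    obtain rfl : l = 1 - m := by linarith
    exact ⟨m, hm, by linarith, rfl⟩
  have hcont : ContinuousOn (pencil u v) (segment ℝ P Q) := continuousOn_pencil.mono lt
  have hconv : IsPreconnected (segment ℝ P Q) := (convex_segment P Q).isPreconnected
  refine ⟨?_, lt, ?_, ?_⟩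
  · rw [segment_eq_image_lineMap]
    exact isCompact_Icc.image AffineMap.lineMap_continuous
  · intro z hz w hw hzw
    obtain ⟨l, hl, hl', rfl⟩ := form z hz
    obtain ⟨m, hm, hm', rfl⟩ := form w hw
    rcases lt_trichotomy l m with hlm | rfl | hlm
    · exact absurd hzw (pencil_segment_lt hP hQ h hl hlm hm').ne
    · rfl
    · exact absurd hzw (pencil_segment_lt hP hQ h hm hlm hl').ne'
  · apply Set.Subset.antisymm
    · rintro _ ⟨z, hz, rfl⟩
      obtain ⟨l, hl, hl', rfl⟩ := form z hz
      constructor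
      · rcases hl.eq_or_lt with rfl | hl
        · simp
        · have := pencil_segment_lt hP hQ h le_rfl hl hl'
          simp only [sub_zero, one_smul, zero_smul, add_zero] at this
          exact this.le
      · rcases hl'.eq_or_lt with rfl | hl'
        · simp
        · have := pencil_segment_lt hP hQ h hl hl' le_rfl
          simp only [sub_self, one_smul, zero_smul, zero_add] at this
          exact this.le
    · exact (hconv.image _ hcont).Icc_subset ⟨P, left_mem_segment ℝ P Q, rfl⟩
        ⟨Q, right_mem_segment ℝ P Q, rfl⟩

theorem mem_chainSet_head (P : ℂ) (l : List ℂ) : P ∈ chainSet (P :: l) := by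
  cases l with
  | nil => exact rfl
  | cons Q l => exact Or.inl (left_mem_segment ℝ P Q)

theorem Rising.head_lt {P : ℂ} {l : List ℂ} (h : Rising u v (P :: l)) : hexIm P < v := by
  cases l with
  | nil => exact h
  | cons Q l => exact h.1

/-- Segments with increasing parameter ranges are glued; adjacent ranges share one value, which is
attained on both sides only at the common vertex. -/
theorem isSection_chainSet : ∀ (l : List ℂ) (P : ℂ), Rising u v (P :: l) →
    IsSection u v (chainSet (P :: l)) (pencil u v P)
      (pencil u v ((P :: l).getLast (List.cons_ne_nil _ _)))
  | [], P, h => by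
    exact ⟨isCompact_singleton, by simpa [chainSet] using h.head_lt, Set.injOn_singleton _ _,
      by simp [chainSet]⟩
  | Q :: l, P, h => by
    have ih := isSection_chainSet l Q h.2.2
    have hQ := h.2.2.head_lt
    have hs := isSection_segment h.1 hQ h.2.1
    rw [List.getLast_cons (List.cons_ne_nil _ _)]
    have le1 : pencil u v P ≤ pencil u v Q := by
      rcases h.2.1 with h | h
      · rw [h]
      · exact h.le
    have le2 : pencil u v Q ≤ pencil u v ((Q :: l).getLast (List.cons_ne_nil _ _)) := by
      have : pencil u v Q ∈ pencil u v '' chainSet (Q :: l) := ⟨Q, mem_chainSet_head Q l, rfl⟩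
      rw [ih.image] at this
      exact this.2
    have cross : ∀ z ∈ segment ℝ P Q, ∀ w ∈ chainSet (Q :: l), pencil u v z = pencil u v w →
        z = w := by
      intro z hz w hw hzw
      have h1 : pencil u v z ∈ pencil u v '' segment ℝ P Q := ⟨z, hz, rfl⟩
      have h2 : pencil u v w ∈ pencil u v '' chainSet (Q :: l) := ⟨w, hw, rfl⟩
      rw [hs.image] at h1
      rw [ih.image] at h2
      have e : pencil u v z = pencil u v Q := le_antisymm h1.2 (hzw ▸ h2.1)
      rw [hs.inj hz (right_mem_segment ℝ P Q) e,
        ih.inj hw (mem_chainSet_head Q l) (hzw ▸ e)]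
    refine ⟨hs.compact.union ih.compact, ?_, ?_, ?_⟩
    · rintro z (hz | hz)
      · exact hs.lt z hz
      · exact ih.lt z hz
    · rintro z (hz | hz) w (hw | hw) hzw
      · exact hs.inj hz hw hzw
      · exact cross z hz w hw hzw
      · exact (cross w hw z hz hzw.symm).symm
      · exact ih.inj hz hw hzw
    · rw [chainSet, Set.image_union, hs.image, ih.image, Set.Icc_union_Icc_eq_Icc le1 le2]

/-- The pencil parameter is a continuous bijection from a compact set onto an interval, hence a
homeomorphism. The ordinate becomes a continuous function of the parameter, extended by constants.
-/
theorem IsSection.exists_graph {G : Set ℂ} {s₀ s₁ : ℝ} (h : IsSection u v G s₀ s₁)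
    (hs : s₀ ≤ s₁) : ∃ f : ℝ → ℝ, Continuous f ∧ ∀ z ∈ G, f (pencil u v z) = hexIm z := by
  have hc : ContinuousOn (pencil u v) G := continuousOn_pencil.mono h.lt
  have hmap : Set.MapsTo (pencil u v) G (Set.Icc s₀ s₁) := fun z hz => by
    rw [← h.image]; exact ⟨z, hz, rfl⟩
  have : CompactSpace G := isCompact_iff_compactSpace.1 h.compact
  let e₀ : G ≃ Set.Icc s₀ s₁ := Equiv.ofBijective (hmap.restrict _ _ _) (by
    constructor
    · intro z w hzw
      exact Subtype.ext (h.inj z.2 w.2 (congrArg Subtype.val hzw))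
    · rintro ⟨t, ht⟩
      rw [← h.image] at ht
      obtain ⟨z, hz, rfl⟩ := ht
      exact ⟨⟨z, hz⟩, rfl⟩)
  have hcont : Continuous e₀ := hc.mapsToRestrict hmap
  let e : G ≃ₜ Set.Icc s₀ s₁ := Continuous.homeoOfEquivCompactToT2 (f := e₀) hcont
  refine ⟨Set.IccExtend hs fun t => hexIm (e.symm t), ?_, ?_⟩
  · exact (continuous_hexIm.comp (continuous_subtype_val.comp e.symm.continuous)).Icc_extend'
  · intro z hz
    rw [Set.IccExtend_of_mem hs _ (hmap hz)]
    congr 1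
    have : (⟨pencil u v z, hmap hz⟩ : Set.Icc s₀ s₁) = e ⟨z, hz⟩ := rfl
    rw [this, e.symm_apply_apply]

/-- The closed region between two graphs over the pencil. -/
def lens (u v s₀ s₁ : ℝ) (L U : ℝ → ℝ) : Set ℂ :=
  {z | hexIm z < v ∧ pencil u v z ∈ Set.Icc s₀ s₁ ∧ L (pencil u v z) ≤ hexIm z ∧
    hexIm z ≤ U (pencil u v z)}

/-- The open region between two graphs over the pencil. -/
def openLens (u v s₀ s₁ : ℝ) (L U : ℝ → ℝ) : Set ℂ :=
  {z | hexIm z < v ∧ pencil u v z ∈ Set.Ioo s₀ s₁ ∧ L (pencil u v z) < hexIm z ∧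
    hexIm z < U (pencil u v z)}

section Lens

variable {s₀ s₁ : ℝ} {L U : ℝ → ℝ}

/-- The data of two graphs over the pencil with common end points. -/
structure IsLens (v s₀ s₁ : ℝ) (L U : ℝ → ℝ) : Prop where
  lt : s₀ < s₁
  contL : Continuous L
  contU : Continuous U
  eq₀ : L s₀ = U s₀
  eq₁ : L s₁ = U s₁
  pos : ∀ s ∈ Set.Ioo s₀ s₁, L s < U s
  below : ∀ s ∈ Set.Icc s₀ s₁, U s < v

theorem IsLens.le (h : IsLens v s₀ s₁ L U) {s : ℝ} (hs : s ∈ Set.Icc s₀ s₁) : L s ≤ U s := by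
  rcases hs.1.eq_or_lt with rfl | h0
  · exact h.eq₀.le
  rcases hs.2.eq_or_lt with rfl | h1
  · exact h.eq₁.le
  exact (h.pos s ⟨h0, h1⟩).le

/-- The abscissa of the parametrization of the lens by a disc. -/
def lensS (s₀ s₁ : ℝ) (z : ℂ) : ℝ := (s₀ + s₁) / 2 + z.re * ((s₁ - s₀) / 2)

/-- The ordinate of the parametrization of the lens by a disc. -/
def lensY (s₀ s₁ : ℝ) (L U : ℝ → ℝ) (z : ℂ) : ℝ :=
  (L (lensS s₀ s₁ z) + U (lensS s₀ s₁ z)) / 2 +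
    (U (lensS s₀ s₁ z) - L (lensS s₀ s₁ z)) / 2 * (z.im / Real.sqrt (1 - z.re ^ 2))

/-- The parametrization of the lens by a disc. -/
def lensMap (u v s₀ s₁ : ℝ) (L U : ℝ → ℝ) (z : ℂ) : ℂ :=
  hexPoint (u + lensS s₀ s₁ z * (v - lensY s₀ s₁ L U z)) (lensY s₀ s₁ L U z)

theorem sq_add_sq_le_of_mem {z : ℂ} (hz : z ∈ Metric.closedBall (0 : ℂ) 1) :
    z.re ^ 2 + z.im ^ 2 ≤ 1 := by
  rw [mem_closedBall_zero_iff] at hz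
  have h : z.re ^ 2 + z.im ^ 2 = ‖z‖ ^ 2 := by
    rw [← Complex.normSq_eq_norm_sq, Complex.normSq_apply]; ring
  rw [h]
  nlinarith [norm_nonneg z]

theorem mem_closedBall_of_sq {z : ℂ} (h : z.re ^ 2 + z.im ^ 2 ≤ 1) :
    z ∈ Metric.closedBall (0 : ℂ) 1 := by
  rw [mem_closedBall_zero_iff]
  have h' : z.re ^ 2 + z.im ^ 2 = ‖z‖ ^ 2 := by
    rw [← Complex.normSq_eq_norm_sq, Complex.normSq_apply]; ring
  nlinarith [norm_nonneg z]

theorem mem_ball_of_sq {z : ℂ} (h : z.re ^ 2 + z.im ^ 2 < 1) : z ∈ Metric.ball (0 : ℂ) 1 := by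
  rw [mem_ball_zero_iff]
  have h' : z.re ^ 2 + z.im ^ 2 = ‖z‖ ^ 2 := by
    rw [← Complex.normSq_eq_norm_sq, Complex.normSq_apply]; ring
  nlinarith [norm_nonneg z]

theorem sq_add_sq_lt_of_mem {z : ℂ} (hz : z ∈ Metric.ball (0 : ℂ) 1) :
    z.re ^ 2 + z.im ^ 2 < 1 := by
  rw [mem_ball_zero_iff] at hz
  have h' : z.re ^ 2 + z.im ^ 2 = ‖z‖ ^ 2 := by
    rw [← Complex.normSq_eq_norm_sq, Complex.normSq_apply]; ring
  nlinarith [norm_nonneg z]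

theorem abs_im_div_sqrt_le {z : ℂ} (hz : z ∈ Metric.closedBall (0 : ℂ) 1) :
    |z.im / Real.sqrt (1 - z.re ^ 2)| ≤ 1 := by
  have h := sq_add_sq_le_of_mem hz
  rw [abs_div, abs_of_nonneg (Real.sqrt_nonneg _)]
  exact div_le_one_of_le₀ (Real.abs_le_sqrt (by linarith)) (Real.sqrt_nonneg _)

theorem IsLens.lensS_mem (h : IsLens v s₀ s₁ L U) {z : ℂ}
    (hz : z ∈ Metric.closedBall (0 : ℂ) 1) : lensS s₀ s₁ z ∈ Set.Icc s₀ s₁ := by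
  have h1 := sq_add_sq_le_of_mem hz
  have h2 : |z.re| ≤ 1 := by rw [← sq_le_one_iff_abs_le_one]; nlinarith
  have h3 := abs_le.1 h2
  have h4 := h.lt
  rw [lensS]
  constructor <;> nlinarith

theorem IsLens.lensY_mem (h : IsLens v s₀ s₁ L U) {z : ℂ}
    (hz : z ∈ Metric.closedBall (0 : ℂ) 1) :
    L (lensS s₀ s₁ z) ≤ lensY s₀ s₁ L U z ∧ lensY s₀ s₁ L U z ≤ U (lensS s₀ s₁ z) := by
  have h1 := abs_le.1 (abs_im_div_sqrt_le hz)
  have h2 := h.le (h.lensS_mem hz)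
  rw [lensY]
  constructor <;> nlinarith

theorem IsLens.lensY_lt (h : IsLens v s₀ s₁ L U) {z : ℂ}
    (hz : z ∈ Metric.closedBall (0 : ℂ) 1) : lensY s₀ s₁ L U z < v :=
  (h.lensY_mem hz).2.trans_lt (h.below _ (h.lensS_mem hz))

/-- Only the points ±1 are critical: there the quotient is bounded but discontinuous, and the factor
U - L tends to 0 because the two graphs meet. -/
theorem IsLens.continuousOn_lensY (h : IsLens v s₀ s₁ L U) :
    ContinuousOn (lensY s₀ s₁ L U) (Metric.closedBall (0 : ℂ) 1) := by
  have hS : Continuous (lensS s₀ s₁) := by unfold lensS; fun_prop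
  have hL := h.contL.comp hS
  have hU := h.contU.comp hS
  have hd : Continuous fun z => (U (lensS s₀ s₁ z) - L (lensS s₀ s₁ z)) / 2 :=
    (hU.sub hL).div_const 2
  refine ContinuousOn.add ((hL.add hU).div_const 2).continuousOn ?_
  intro z hz
  by_cases h1 : z.re ^ 2 < 1
  · have : ContinuousAt (fun z : ℂ => z.im / Real.sqrt (1 - z.re ^ 2)) z := by
      refine ContinuousAt.div (by fun_prop) (by fun_prop) ?_
      exact (Real.sqrt_pos.2 (by linarith)).ne'
    exact (hd.continuousAt.mul this).continuousWithinAt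
  · have h2 := sq_add_sq_le_of_mem hz
    have h3 : z.im = 0 := by nlinarith [sq_nonneg z.im]
    have h4 : z.re ^ 2 = 1 := by nlinarith [sq_nonneg z.im]
    have h0 : U (lensS s₀ s₁ z) - L (lensS s₀ s₁ z) = 0 := by
      rcases mul_self_eq_one_iff.1 ((sq _).symm.trans h4) with h5 | h5
      · rw [show lensS s₀ s₁ z = s₁ by rw [lensS, h5]; ring, h.eq₁, sub_self]
      · rw [show lensS s₀ s₁ z = s₀ by rw [lensS, h5]; ring, h.eq₀, sub_self]
    have hval : (fun z : ℂ => (U (lensS s₀ s₁ z) - L (lensS s₀ s₁ z)) / 2 *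
        (z.im / Real.sqrt (1 - z.re ^ 2))) z = 0 := by simp [h0]
    rw [ContinuousWithinAt]
    rw [show ((U (lensS s₀ s₁ z) - L (lensS s₀ s₁ z)) / 2 *
        (z.im / Real.sqrt (1 - z.re ^ 2))) = 0 from hval]
    -- The quotient is at most 1 in modulus on the whole disc, so the product is dominated by the
    -- vanishing factor.
    refine squeeze_zero_norm' (a := fun z => |(U (lensS s₀ s₁ z) - L (lensS s₀ s₁ z)) / 2|) ?_ ?_
    · filter_upwards [self_mem_nhdsWithin] with w hw
      rw [Real.norm_eq_abs, abs_mul]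
      exact mul_le_of_le_one_right (abs_nonneg _) (abs_im_div_sqrt_le hw)
    · have := (hd.abs.tendsto z).mono_left (nhdsWithin_le_nhds (s := Metric.closedBall (0 : ℂ) 1))
      rw [h0] at this
      simpa using this

theorem IsLens.continuousOn_lensMap (h : IsLens v s₀ s₁ L U) :
    ContinuousOn (lensMap u v s₀ s₁ L U) (Metric.closedBall (0 : ℂ) 1) := by
  have hS : Continuous (lensS s₀ s₁) := by unfold lensS; fun_prop
  have hY := h.continuousOn_lensY
  have hX : ContinuousOn (fun z => u + lensS s₀ s₁ z * (v - lensY s₀ s₁ L U z))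
      (Metric.closedBall (0 : ℂ) 1) :=
    continuousOn_const.add (hS.continuousOn.mul (continuousOn_const.sub hY))
  unfold lensMap hexPoint
  exact continuousOn_const.mul ((Complex.continuous_ofReal.comp_continuousOn hX).add
    ((Complex.continuous_ofReal.comp_continuousOn hY).mul continuousOn_const))

theorem IsLens.pencil_lensMap (h : IsLens v s₀ s₁ L U) {z : ℂ}
    (hz : z ∈ Metric.closedBall (0 : ℂ) 1) :
    pencil u v (lensMap u v s₀ s₁ L U z) = lensS s₀ s₁ z := by
  rw [lensMap, pencil_hexPoint (h.lensY_lt hz)]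

theorem hexIm_lensMap (z : ℂ) :
    hexIm (lensMap u v s₀ s₁ L U z) = lensY s₀ s₁ L U z := by
  rw [lensMap, hexIm_hexPoint]

theorem IsLens.mapsTo (h : IsLens v s₀ s₁ L U) :
    Set.MapsTo (lensMap u v s₀ s₁ L U) (Metric.closedBall (0 : ℂ) 1) (lens u v s₀ s₁ L U) := by
  intro z hz
  rw [lens, Set.mem_ofPred_eq, h.pencil_lensMap hz, hexIm_lensMap]
  exact ⟨h.lensY_lt hz, h.lensS_mem hz, h.lensY_mem hz⟩

theorem IsLens.injOn (h : IsLens v s₀ s₁ L U) :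
    Set.InjOn (lensMap u v s₀ s₁ L U) (Metric.closedBall (0 : ℂ) 1) := by
  intro z hz w hw hzw
  have h1 : lensS s₀ s₁ z = lensS s₀ s₁ w := by
    rw [← h.pencil_lensMap (u := u) hz, hzw, h.pencil_lensMap hw]
  have h2 : lensY s₀ s₁ L U z = lensY s₀ s₁ L U w := by
    rw [← hexIm_lensMap (u := u) (v := v), hzw, hexIm_lensMap]
  have hlt := h.lt
  have hre : z.re = w.re := by
    rw [lensS, lensS] at h1
    have : z.re * ((s₁ - s₀) / 2) = w.re * ((s₁ - s₀) / 2) := by linarith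
    exact mul_right_cancel₀ (by linarith) this
  refine Complex.ext hre ?_
  have hz' := sq_add_sq_le_of_mem hz
  have hw' := sq_add_sq_le_of_mem hw
  by_cases h3 : z.re ^ 2 < 1
  · have hab : |z.re| < 1 := by rwa [← sq_lt_one_iff_abs_lt_one]
    have hab := abs_lt.1 hab
    have hmem : lensS s₀ s₁ z ∈ Set.Ioo s₀ s₁ := by
      rw [lensS]; constructor <;> nlinarith
    have hpos := h.pos _ hmem
    rw [lensY, lensY, ← h1, ← hre] at h2
    have h4 : (U (lensS s₀ s₁ z) - L (lensS s₀ s₁ z)) / 2 *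
        (z.im / Real.sqrt (1 - z.re ^ 2)) = (U (lensS s₀ s₁ z) - L (lensS s₀ s₁ z)) / 2 *
        (w.im / Real.sqrt (1 - z.re ^ 2)) := by linarith
    have h5 := mul_left_cancel₀ (by linarith) h4
    exact (div_left_inj' (Real.sqrt_pos.2 (by linarith)).ne').1 h5
  · rw [← hre] at hw'
    have e1 : z.im = 0 := by nlinarith [sq_nonneg z.im]
    have e2 : w.im = 0 := by nlinarith [sq_nonneg w.im]
    rw [e1, e2]

/-- The inverse of the abscissa of the parametrization. -/
theorem IsLens.exists_re (h : IsLens v s₀ s₁ L U) (s : ℝ) :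
    ∃ x : ℝ, (s₀ + s₁) / 2 + x * ((s₁ - s₀) / 2) = s := by
  have := h.lt
  refine ⟨(s - (s₀ + s₁) / 2) / ((s₁ - s₀) / 2), ?_⟩
  rw [div_mul_cancel₀ _ (by linarith)]
  ring

theorem IsLens.surjOn_open (h : IsLens v s₀ s₁ L U) :
    Set.SurjOn (lensMap u v s₀ s₁ L U) (Metric.ball (0 : ℂ) 1) (openLens u v s₀ s₁ L U) := by
  rintro z ⟨hv, hs, hL, hU⟩
  set s := pencil u v z
  have hlt := h.lt
  obtain ⟨x, hx⟩ := h.exists_re s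
  have hx1 : x ^ 2 < 1 := by
    rw [sq_lt_one_iff_abs_lt_one, abs_lt]
    constructor <;> by_contra hc <;> nlinarith [hs.1, hs.2]
  have hpos := h.pos s hs
  set q := (2 * hexIm z - L s - U s) / (U s - L s)
  have hq : q ^ 2 < 1 := by
    rw [sq_lt_one_iff_abs_lt_one, abs_lt]
    constructor
    · rw [lt_div_iff₀ (by linarith)]; linarith
    · rw [div_lt_iff₀ (by linarith)]; linarith
  have hr : 0 < Real.sqrt (1 - x ^ 2) := Real.sqrt_pos.2 (by linarith)
  have hr2 : Real.sqrt (1 - x ^ 2) ^ 2 = 1 - x ^ 2 := Real.sq_sqrt (by linarith)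
  have hmem : (⟨x, q * Real.sqrt (1 - x ^ 2)⟩ : ℂ) ∈ Metric.ball (0 : ℂ) 1 := by
    apply mem_ball_of_sq
    simp only [mul_pow, hr2]
    nlinarith
  have hmem' := Metric.ball_subset_closedBall hmem
  refine ⟨_, hmem, ?_⟩
  have hS : lensS s₀ s₁ ⟨x, q * Real.sqrt (1 - x ^ 2)⟩ = s := by rw [lensS]; exact hx
  have hY : lensY s₀ s₁ L U ⟨x, q * Real.sqrt (1 - x ^ 2)⟩ = hexIm z := by
    rw [lensY, hS]
    simp only [mul_div_cancel_right₀ _ hr.ne']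
    have hq' : q * (U s - L s) = 2 * hexIm z - L s - U s :=
      div_mul_cancel₀ _ (by linarith)
    linarith
  refine eq_of_pencil_eq (u := u) (v := v) ?_ ?_ ?_
  · rw [hexIm_lensMap, hY]; exact hv
  · rw [h.pencil_lensMap hmem', hS]
  · rw [hexIm_lensMap, hY]

theorem IsLens.surjOn (h : IsLens v s₀ s₁ L U) :
    Set.SurjOn (lensMap u v s₀ s₁ L U) (Metric.closedBall (0 : ℂ) 1) (lens u v s₀ s₁ L U) := by
  rintro z ⟨hv, hs, hL, hU⟩
  set s := pencil u v z
  have hlt := h.lt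
  obtain ⟨x, hx⟩ := h.exists_re s
  have hx1 : x ^ 2 ≤ 1 := by
    rw [sq_le_one_iff_abs_le_one, abs_le]
    constructor <;> by_contra hc <;> nlinarith [hs.1, hs.2]
  rcases hx1.eq_or_lt with hx1 | hx1
  · have hLU : L s = U s := by
      rcases mul_self_eq_one_iff.1 ((sq _).symm.trans hx1) with h5 | h5
      · rw [show s = s₁ by rw [← hx, h5]; ring, h.eq₁]
      · rw [show s = s₀ by rw [← hx, h5]; ring, h.eq₀]
    have hmem : (⟨x, 0⟩ : ℂ) ∈ Metric.closedBall (0 : ℂ) 1 := by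
      apply mem_closedBall_of_sq
      simp only
      linarith
    refine ⟨_, hmem, ?_⟩
    have hS : lensS s₀ s₁ ⟨x, 0⟩ = s := by rw [lensS]; exact hx
    have hY : lensY s₀ s₁ L U ⟨x, 0⟩ = hexIm z := by
      rw [lensY, hS]
      simp only [zero_div, mul_zero]
      linarith
    refine eq_of_pencil_eq (u := u) (v := v) ?_ ?_ ?_
    · rw [hexIm_lensMap, hY]; exact hv
    · rw [h.pencil_lensMap hmem, hS]
    · rw [hexIm_lensMap, hY]
  · have hs' : s ∈ Set.Ioo s₀ s₁ := by
      have := abs_lt.1 ((sq_lt_one_iff_abs_lt_one x).1 hx1)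
      constructor <;> nlinarith
    have hpos := h.pos s hs'
    set q := (2 * hexIm z - L s - U s) / (U s - L s)
    have hq : q ^ 2 ≤ 1 := by
      rw [sq_le_one_iff_abs_le_one, abs_le]
      constructor
      · rw [le_div_iff₀ (by linarith)]; linarith
      · rw [div_le_iff₀ (by linarith)]; linarith
    have hr : 0 < Real.sqrt (1 - x ^ 2) := Real.sqrt_pos.2 (by linarith)
    have hr2 : Real.sqrt (1 - x ^ 2) ^ 2 = 1 - x ^ 2 := Real.sq_sqrt (by linarith)
    have hmem : (⟨x, q * Real.sqrt (1 - x ^ 2)⟩ : ℂ) ∈ Metric.closedBall (0 : ℂ) 1 := by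
      apply mem_closedBall_of_sq
      simp only [mul_pow, hr2]
      nlinarith
    refine ⟨_, hmem, ?_⟩
    have hS : lensS s₀ s₁ ⟨x, q * Real.sqrt (1 - x ^ 2)⟩ = s := by rw [lensS]; exact hx
    have hY : lensY s₀ s₁ L U ⟨x, q * Real.sqrt (1 - x ^ 2)⟩ = hexIm z := by
      rw [lensY, hS]
      simp only [mul_div_cancel_right₀ _ hr.ne']
      have hq' : q * (U s - L s) = 2 * hexIm z - L s - U s :=
        div_mul_cancel₀ _ (by linarith)
      linarith
    refine eq_of_pencil_eq (u := u) (v := v) ?_ ?_ ?_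
    · rw [hexIm_lensMap, hY]; exact hv
    · rw [h.pencil_lensMap hmem, hS]
    · rw [hexIm_lensMap, hY]

theorem IsLens.mapsTo_open (h : IsLens v s₀ s₁ L U) :
    Set.MapsTo (lensMap u v s₀ s₁ L U) (Metric.ball (0 : ℂ) 1) (openLens u v s₀ s₁ L U) := by
  intro z hz
  have hz' := Metric.ball_subset_closedBall hz
  have h1 := sq_add_sq_lt_of_mem hz
  have hlt := h.lt
  have h3 : z.re ^ 2 < 1 := by nlinarith [sq_nonneg z.im]
  have hab := abs_lt.1 ((sq_lt_one_iff_abs_lt_one _).1 h3)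
  have hmem : lensS s₀ s₁ z ∈ Set.Ioo s₀ s₁ := by
    rw [lensS]; constructor <;> nlinarith
  have hr : 0 < Real.sqrt (1 - z.re ^ 2) := Real.sqrt_pos.2 (by linarith)
  have hq : |z.im / Real.sqrt (1 - z.re ^ 2)| < 1 := by
    rw [abs_div, abs_of_pos hr, div_lt_one hr]
    exact Real.lt_sqrt_of_sq_lt (by rw [sq_abs]; linarith)
  have hq := abs_lt.1 hq
  have hpos := h.pos _ hmem
  rw [openLens, Set.mem_ofPred_eq, h.pencil_lensMap hz', hexIm_lensMap]
  refine ⟨h.lensY_lt hz', hmem, ?_⟩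
  rw [lensY]
  constructor <;> nlinarith

theorem IsLens.image_ball (h : IsLens v s₀ s₁ L U) :
    lensMap u v s₀ s₁ L U '' Metric.ball (0 : ℂ) 1 = openLens u v s₀ s₁ L U :=
  Set.Subset.antisymm h.mapsTo_open.image_subset h.surjOn_open

theorem IsLens.image_closedBall (h : IsLens v s₀ s₁ L U) :
    lensMap u v s₀ s₁ L U '' Metric.closedBall (0 : ℂ) 1 = lens u v s₀ s₁ L U :=
  Set.Subset.antisymm h.mapsTo.image_subset h.surjOn

theorem IsLens.isCompact (h : IsLens v s₀ s₁ L U) : IsCompact (lens u v s₀ s₁ L U) := by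
  rw [← h.image_closedBall]
  exact (isCompact_closedBall _ _).image_of_continuousOn h.continuousOn_lensMap

theorem IsLens.nonempty_homeomorph (h : IsLens v s₀ s₁ L U) :
    Nonempty (lens u v s₀ s₁ L U ≃ₜ Metric.closedBall (0 : ℂ) 1) := by
  have : CompactSpace (Metric.closedBall (0 : ℂ) 1) :=
    isCompact_iff_compactSpace.1 (isCompact_closedBall _ _)
  let e₀ : Metric.closedBall (0 : ℂ) 1 ≃ lens u v s₀ s₁ L U :=
    Equiv.ofBijective (h.mapsTo.restrict _ _ _)
      ⟨fun z w hzw => Subtype.ext (h.injOn z.2 w.2 (congrArg Subtype.val hzw)),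
        fun z => by
          obtain ⟨w, hw, e⟩ := h.surjOn z.2
          exact ⟨⟨w, hw⟩, Subtype.ext e⟩⟩
  have hcont : Continuous e₀ := h.continuousOn_lensMap.mapsToRestrict h.mapsTo
  exact ⟨(Continuous.homeoOfEquivCompactToT2 (f := e₀) hcont).symm⟩

theorem openLens_subset : openLens u v s₀ s₁ L U ⊆ lens u v s₀ s₁ L U :=
  fun _ hz => ⟨hz.1, Set.Ioo_subset_Icc_self hz.2.1, hz.2.2.1.le, hz.2.2.2.le⟩

theorem IsLens.isOpen (h : IsLens v s₀ s₁ L U) : IsOpen (openLens u v s₀ s₁ L U) := by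
  have hH : IsOpen {z : ℂ | hexIm z < v} := isOpen_lt continuous_hexIm continuous_const
  have hp := continuousOn_pencil (u := u) (v := v)
  have h1 := hp.isOpen_inter_preimage hH (isOpen_Ioo (a := s₀) (b := s₁))
  have h2 := (continuous_hexIm.continuousOn.sub (h.contL.comp_continuousOn hp)).isOpen_inter_preimage
    hH (isOpen_Ioi (a := (0 : ℝ)))
  have h3 := ((h.contU.comp_continuousOn hp).sub continuous_hexIm.continuousOn).isOpen_inter_preimage
    hH (isOpen_Ioi (a := (0 : ℝ)))
  convert (h1.inter h2).inter h3 using 1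
  ext z
  simp only [openLens, Set.mem_ofPred_eq, Set.mem_inter_iff, Set.mem_preimage, Set.mem_Ioi,
    sub_pos, Pi.sub_apply, Function.comp]
  tauto

theorem IsLens.closure_open (h : IsLens v s₀ s₁ L U) :
    closure (openLens u v s₀ s₁ L U) = lens u v s₀ s₁ L U := by
  apply Set.Subset.antisymm
  · exact closure_minimal openLens_subset h.isCompact.isClosed
  · rw [← h.image_closedBall, ← h.image_ball, ← closure_ball (0 : ℂ) one_ne_zero]
    apply ContinuousOn.image_closure
    rw [closure_ball (0 : ℂ) one_ne_zero]
    exact h.continuousOn_lensMap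

theorem IsLens.isPreconnected_open (h : IsLens v s₀ s₁ L U) :
    IsPreconnected (openLens u v s₀ s₁ L U) := by
  rw [← h.image_ball]
  exact (convex_ball (0 : ℂ) 1).isPreconnected.image _
    (h.continuousOn_lensMap.mono Metric.ball_subset_closedBall)

theorem not_isBounded_of_hexIm {S : Set ℂ} (h : ∀ R : ℝ, ∃ z ∈ S, R < |hexIm z|) :
    ¬ Bornology.IsBounded S := by
  intro hb
  obtain ⟨R, hR⟩ := hb.exists_norm_le
  obtain ⟨z, hz, hz'⟩ := h R
  have h1 : |hexIm z| ≤ ‖z‖ := by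
    rw [hexIm]
    refine (Complex.abs_im_le_norm _).trans ?_
    rw [norm_mul, Complex.norm_conj, norm_hexRoot, one_mul]
  linarith [hR z hz]

/-- Points on the line of the pencil through `z`. -/
theorem pencil_line {z : ℂ} (hz : hexIm z < v) {l : ℝ} (hl : 0 < l) :
    hexIm (l • z + (1 - l) • hexPoint u v) < v ∧
      pencil u v (l • z + (1 - l) • hexPoint u v) = pencil u v z := by
  have h1 : hexIm (l • z + (1 - l) • hexPoint u v) = l * hexIm z + (1 - l) * v := by
    rw [hexIm_combo, hexIm_hexPoint]
  have h2 : hexRe (l • z + (1 - l) • hexPoint u v) = l * hexRe z + (1 - l) * u := by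
    rw [hexRe_combo, hexRe_hexPoint]
  refine ⟨by rw [h1]; nlinarith, ?_⟩
  rw [pencil, pencil, h1, h2, show l * hexRe z + (1 - l) * u - u = l * (hexRe z - u) by ring,
    show v - (l * hexIm z + (1 - l) * v) = l * (v - hexIm z) by ring,
    mul_div_mul_left _ _ hl.ne']

theorem convex_halfPlane_hexIm : Convex ℝ {z : ℂ | v ≤ hexIm z} := by
  intro z hz w hw l m hl hm hlm
  simp only [Set.mem_ofPred_eq] at hz hw ⊢
  rw [hexIm_combo]
  obtain rfl : l = 1 - m := by linarith
  nlinarith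

theorem not_isBounded_halfPlane {S : Set ℂ} (h : {z : ℂ | v ≤ hexIm z} ⊆ S) :
    ¬ Bornology.IsBounded S := by
  refine not_isBounded_of_hexIm fun R => ⟨hexPoint 0 (max v (|R| + 1)), h ?_, ?_⟩
  · rw [Set.mem_ofPred_eq, hexIm_hexPoint]; exact le_max_left _ _
  · rw [hexIm_hexPoint]
    exact (lt_of_lt_of_le (lt_of_le_of_lt (le_abs_self R) (lt_add_one _)) (le_max_right v _)).trans_le (le_abs_self _)

/-- The pencil parameter is constant on each line through the apex, so a point outside the lens
escapes along its line, either away from the apex or towards it and into the half-plane above. -/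
theorem exists_unbounded_of_notMem_lens {z : ℂ} (hz : z ∉ lens u v s₀ s₁ L U) :
    ∃ S : Set ℂ, z ∈ S ∧ IsPreconnected S ∧ ¬ Bornology.IsBounded S ∧
      Disjoint S (lens u v s₀ s₁ L U) := by
  have hup : Disjoint {z : ℂ | v ≤ hexIm z} (lens u v s₀ s₁ L U) :=
    Set.disjoint_left.2 fun w hw hw' => absurd hw'.1 (not_lt.2 hw)
  rcases le_or_gt v (hexIm z) with hv | hv
  · exact ⟨_, hv, convex_halfPlane_hexIm.isPreconnected, not_isBounded_halfPlane le_rfl, hup⟩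
  by_cases hL : hexIm z < L (pencil u v z)
  -- Below the lower graph: the ray away from the apex only descends.
  · refine ⟨{w | ∃ l : ℝ, 1 ≤ l ∧ w = l • z + (1 - l) • hexPoint u v}, ⟨1, le_rfl, by simp⟩,
      ?_, ?_, ?_⟩
    · have hcont : Continuous fun l : ℝ => l • z + (1 - l) • hexPoint u v := by fun_prop
      have := (isPreconnected_Ici (a := (1 : ℝ))).image _ hcont.continuousOn
      convert this using 1
      ext w
      simp only [Set.mem_ofPred_eq, Set.mem_image, Set.mem_Ici, eq_comm]
    · refine not_isBounded_of_hexIm fun R => ?_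
      have hd : 0 < v - hexIm z := by linarith
      set l := max 1 ((|v| + |R| + 1) / (v - hexIm z))
      refine ⟨_, ⟨l, le_max_left _ _, rfl⟩, ?_⟩
      rw [hexIm_combo, hexIm_hexPoint]
      have h1 : (|v| + |R| + 1) ≤ l * (v - hexIm z) := by
        rw [← div_le_iff₀ hd]; exact le_max_right _ _
      refine lt_of_lt_of_le ?_ (neg_le_abs _)
      have := le_abs_self v
      have := le_abs_self R
      linarith
    · refine Set.disjoint_left.2 ?_
      rintro w ⟨l, hl, rfl⟩ hw
      obtain ⟨h1, h2⟩ := pencil_line (u := u) hv (zero_lt_one.trans_le hl)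
      have := hw.2.2.1
      rw [h2, hexIm_combo, hexIm_hexPoint] at this
      nlinarith
  -- Above the upper graph, or on a line that misses the lens: the segment to the apex, joined to
  -- the half-plane.
  · refine ⟨{z : ℂ | v ≤ hexIm z} ∪ segment ℝ z (hexPoint u v),
      Or.inr (left_mem_segment ℝ _ _), ?_, not_isBounded_halfPlane Set.subset_union_left, ?_⟩
    · refine IsPreconnected.union (hexPoint u v) ?_ (right_mem_segment ℝ _ _)
        convex_halfPlane_hexIm.isPreconnected (convex_segment _ _).isPreconnected
      rw [Set.mem_ofPred_eq, hexIm_hexPoint]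
    · rw [Set.disjoint_union_left]
      refine ⟨hup, Set.disjoint_left.2 ?_⟩
      rintro w ⟨l, m, hl, hm, hlm, rfl⟩ hw
      obtain rfl : m = 1 - l := by linarith
      rcases hl.eq_or_lt with rfl | hl
      · have := hw.1
        rw [hexIm_combo, hexIm_hexPoint] at this
        linarith
      · obtain ⟨h1, h2⟩ := pencil_line (u := u) hv hl
        obtain ⟨-, h4, h5, h6⟩ := hw
        rw [h2] at h4 h5 h6
        rw [hexIm_combo, hexIm_hexPoint] at h6
        exact hz ⟨hv, h4, not_lt.1 hL, by nlinarith⟩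

end Lens

/-- The properties of a closed polygon that are used: it is a disc with a dense connected
interior, bounded by its curve, with an unbounded connected exterior. -/
structure IsDisc (T O G : Set ℂ) : Prop where
  compact : IsCompact T
  homeo : Nonempty (T ≃ₜ Metric.closedBall (0 : ℂ) 1)
  isOpen : IsOpen O
  nonempty : O.Nonempty
  closure_eq : closure O = T
  diff_eq : T \ O = G
  preconnected : IsPreconnected O
  exterior : ∀ z, z ∉ T → ∃ S : Set ℂ, z ∈ S ∧ IsPreconnected S ∧ ¬ Bornology.IsBounded S ∧
    Disjoint S T

/-- Both arcs are graphs over the pencil. As one lies weakly above the other and they meet only at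
the extreme parameters, the region between them is a lens, which the unit disc parametrizes. -/
theorem exists_isDisc_of_isSection {G₁ G₂ : Set ℂ} {s₀ s₁ : ℝ} (hs : s₀ < s₁)
    (h₁ : IsSection u v G₁ s₀ s₁) (h₂ : IsSection u v G₂ s₀ s₁)
    (hle : ∀ z ∈ G₁, ∀ w ∈ G₂, hexIm w ≤ hexIm z)
    (hends : ∀ z ∈ G₁ ∩ G₂, pencil u v z = s₀ ∨ pencil u v z = s₁)
    {A B : ℂ} (hA : A ∈ G₁ ∩ G₂) (hB : B ∈ G₁ ∩ G₂) (hA' : pencil u v A = s₀)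
    (hB' : pencil u v B = s₁) :
    ∃ T O, IsDisc T O (G₁ ∪ G₂) := by
  obtain ⟨U, hU, hU'⟩ := h₁.exists_graph hs.le
  obtain ⟨L, hL, hL'⟩ := h₂.exists_graph hs.le
  have ex₁ : ∀ s ∈ Set.Icc s₀ s₁, ∃ z ∈ G₁, pencil u v z = s := fun s h => by
    rw [← h₁.image] at h; exact h
  have ex₂ : ∀ s ∈ Set.Icc s₀ s₁, ∃ z ∈ G₂, pencil u v z = s := fun s h => by
    rw [← h₂.image] at h; exact h
  have mem₁ : ∀ z ∈ G₁, pencil u v z ∈ Set.Icc s₀ s₁ := fun z h => by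
    rw [← h₁.image]; exact ⟨z, h, rfl⟩
  have mem₂ : ∀ z ∈ G₂, pencil u v z ∈ Set.Icc s₀ s₁ := fun z h => by
    rw [← h₂.image]; exact ⟨z, h, rfl⟩
  have hlens : IsLens v s₀ s₁ L U := by
    refine ⟨hs, hL, hU, ?_, ?_, ?_, ?_⟩
    · rw [← hA', hL' A hA.2, hU' A hA.1]
    · rw [← hB', hL' B hB.2, hU' B hB.1]
    · intro s h
      obtain ⟨z, hz, rfl⟩ := ex₁ s (Set.Ioo_subset_Icc_self h)
      obtain ⟨w, hw, e⟩ := ex₂ _ (Set.Ioo_subset_Icc_self h)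
      have h1 : L (pencil u v z) = hexIm w := by rw [← e, hL' w hw]
      rw [h1, hU' z hz]
      refine lt_of_le_of_ne (hle z hz w hw) fun h2 => ?_
      have h3 := eq_of_pencil_eq (h₂.lt w hw) e h2
      rcases hends z ⟨hz, h3 ▸ hw⟩ with h4 | h4
      · exact h.1.ne' h4
      · exact h.2.ne h4
    · intro s h
      obtain ⟨z, hz, rfl⟩ := ex₁ s h
      rw [hU' z hz]
      exact h₁.lt z hz
  refine ⟨lens u v s₀ s₁ L U, openLens u v s₀ s₁ L U, hlens.isCompact,
    hlens.nonempty_homeomorph, hlens.isOpen, ?_, hlens.closure_open, ?_,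
    hlens.isPreconnected_open, fun z hz => exists_unbounded_of_notMem_lens hz⟩
  · rw [← hlens.image_ball]
    exact (Metric.nonempty_ball.2 one_pos).image _
  · ext z
    constructor
    · rintro ⟨⟨h1, h2, h3, h4⟩, h5⟩
      obtain ⟨z₁, hz₁, e₁⟩ := ex₁ _ h2
      obtain ⟨z₂, hz₂, e₂⟩ := ex₂ _ h2
      by_cases hUz : hexIm z = U (pencil u v z)
      · left
        rw [← e₁, hU' _ hz₁] at hUz
        rw [eq_of_pencil_eq h1 e₁.symm hUz]
        exact hz₁
      by_cases hLz : hexIm z = L (pencil u v z)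
      · right
        rw [← e₂, hL' _ hz₂] at hLz
        rw [eq_of_pencil_eq h1 e₂.symm hLz]
        exact hz₂
      refine absurd ⟨h1, ⟨lt_of_le_of_ne h2.1 ?_, lt_of_le_of_ne h2.2 ?_⟩,
        lt_of_le_of_ne h3 (Ne.symm hLz), lt_of_le_of_ne h4 hUz⟩ h5
      · intro h
        rw [← h, hlens.eq₀] at h3
        rw [← h] at h4 hUz
        exact hUz (le_antisymm h4 h3)
      · intro h
        rw [h, hlens.eq₁] at h3
        rw [h] at h4 hUz
        exact hUz (le_antisymm h4 h3)
    · rintro (hz | hz)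
      · refine ⟨⟨h₁.lt z hz, mem₁ z hz, ?_, (hU' z hz).ge⟩, fun h => ?_⟩
        · rw [← hU' z hz]; exact hlens.le (mem₁ z hz)
        · exact absurd (hU' z hz) h.2.2.2.ne'
      · have hlt : hexIm z < v := h₂.lt z hz
        refine ⟨⟨hlt, mem₂ z hz, (hL' z hz).le, ?_⟩, fun h => ?_⟩
        · rw [← hL' z hz]; exact hlens.le (mem₂ z hz)
        · exact absurd (hL' z hz) h.2.2.1.ne

/-- A point outside T lies in an unbounded connected set missing the curve, so its component is
unbounded. The component of an interior point cannot leave the open set O, because O and the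
complement of T separate the complement of the curve. -/
theorem IsDisc.polygonRegion_eq {m : ℕ} [NeZero m] {w : Fin m → ℂ} {T O : Set ℂ}
    (h : IsDisc T O (polygonCurve w)) : polygonRegion w = T := by
  have hsub : O ⊆ T := h.closure_eq ▸ subset_closure
  have hcurve : polygonCurve w ⊆ T := h.diff_eq ▸ Set.sdiff_subset
  apply Set.Subset.antisymm
  · rintro z (hz | ⟨hz, hb⟩)
    · exact hcurve hz
    · by_contra hzT
      obtain ⟨S, hzS, hS, hSb, hd⟩ := h.exterior z hzT
      refine hSb (hb.subset (hS.subset_connectedComponentIn hzS ?_))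
      exact fun x hx hxc => Set.disjoint_left.1 hd hx (hcurve hxc)
  · intro z hz
    by_cases hzc : z ∈ polygonCurve w
    · exact Or.inl hzc
    refine Or.inr ⟨hzc, h.compact.isBounded.subset ?_⟩
    have hzO : z ∈ O := by
      by_contra hO
      exact hzc (h.diff_eq ▸ ⟨hz, hO⟩)
    have hcl : IsPreconnected (connectedComponentIn (polygonCurve w)ᶜ z) :=
      isPreconnected_connectedComponentIn
    have hcover : connectedComponentIn (polygonCurve w)ᶜ z ⊆ O ∪ Tᶜ := by
      intro x hx
      have hx' : x ∉ polygonCurve w := connectedComponentIn_subset _ _ hx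
      by_cases hxT : x ∈ T
      · left
        by_contra hO
        exact hx' (h.diff_eq ▸ ⟨hxT, hO⟩)
      · exact Or.inr hxT
    refine (hcl.subset_left_of_subset_union h.isOpen h.compact.isClosed.isOpen_compl
      (Set.disjoint_left.2 fun x hx hx' => hx' (hsub hx)) hcover
      ⟨z, mem_connectedComponentIn hzc, hzO⟩).trans hsub

end

/-! ### The hat is a disc, and its boundary has constant winding number inside and winding number
zero outside -/

noncomputable section

open Complex

variable {a b : ℝ} {n : ℕ}

/-! ### The hat polygon is a disc -/

theorem sqrt_three_bounds : 1.7 < Real.sqrt 3 ∧ Real.sqrt 3 < 1.8 :=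
  ⟨Real.lt_sqrt_of_sq_lt (by norm_num), (Real.sqrt_lt' (by norm_num)).2 (by norm_num)⟩

/-- The determinant condition says that the edge direction (k, m) crosses the line to the apex in
the positive sense. The length e may vanish, which admits the degenerate hats c = 0 and c = 1. -/
theorem hexPoint_step {u v x y x' y' e k m : ℝ} (he : 0 ≤ e) (hx : x' = x + k * e)
    (hy : y' = y + m * e) (hv : y < v) (hv' : y' < v) (h : 0 < (v - y) * k - (u - x) * m) :
    hexPoint x y = hexPoint x' y' ∨
      pencil u v (hexPoint x y) < pencil u v (hexPoint x' y') := by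
  subst hx hy
  rcases he.eq_or_lt with rfl | he
  · left; simp
  · right
    rw [pencil_lt_iff (by rwa [hexIm_hexPoint]) (by rwa [hexIm_hexPoint])]
    simp only [hexRe_hexPoint, hexIm_hexPoint]
    nlinarith [mul_pos he h]

/-- The apex is so high that every edge progressing by at least 1 along the axis, per unit length
parameter, is transversal. -/
theorem steep_step {u v x y k m : ℝ} (hk : 1 ≤ k) (hy : y ≤ v - 90) (hux : |u - x| ≤ 20)
    (hm : |m| ≤ 2) : 0 < (v - y) * k - (u - x) * m := by
  have h1 : (u - x) * m ≤ 20 * 2 := (le_abs_self _).trans (by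
    rw [abs_mul]; exact mul_le_mul hux hm (abs_nonneg _) (by norm_num))
  nlinarith

/-- The upper half of the boundary of the hat, from left to right. -/
def upperChain (a b : ℝ) : List ℂ :=
  [hexPoint 0 0, hexPoint (Real.sqrt 3 * a) a, hexPoint (2 * Real.sqrt 3 * a) 0,
    hexPoint (2 * Real.sqrt 3 * a + b) (Real.sqrt 3 * b),
    hexPoint (2 * Real.sqrt 3 * a + 5 * b) (Real.sqrt 3 * b),
    hexPoint (2 * Real.sqrt 3 * a + 6 * b) 0]

/-- The lower half of the boundary of the hat, from left to right. -/
def lowerChain (a b : ℝ) : List ℂ :=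
  [hexPoint 0 0, hexPoint b (-(Real.sqrt 3 * b)), hexPoint (3 * b) (-(Real.sqrt 3 * b)),
    hexPoint (3 * b) (-(2 * a) - Real.sqrt 3 * b),
    hexPoint (Real.sqrt 3 * a + 3 * b) (-(3 * a) - Real.sqrt 3 * b),
    hexPoint (Real.sqrt 3 * a + 4 * b) (-(3 * a)), hexPoint (Real.sqrt 3 * a + 6 * b) (-(3 * a)),
    hexPoint (Real.sqrt 3 * a + 6 * b) (-a), hexPoint (2 * Real.sqrt 3 * a + 6 * b) 0]

theorem rising_upperChain (ha : 0 ≤ a) (hb : 0 ≤ b) (hab : a + b = 1) :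
    Rising ((Real.sqrt 3 * a + 9 * b) / 2) 100 (upperChain a b) := by
  obtain ⟨h1, h2⟩ := sqrt_three_bounds
  set s := Real.sqrt 3
  have ha1 : a ≤ 1 := by linarith
  have hb1 : b ≤ 1 := by linarith
  have sa : s * a ≤ 1.8 := by nlinarith
  have sb : s * b ≤ 1.8 := by nlinarith
  have sa0 : 0 ≤ s * a := by positivity
  have sb0 : 0 ≤ s * b := by positivity
  simp only [upperChain, Rising, hexIm_hexPoint]
  refine ⟨by norm_num, ?_, by linarith, ?_, by norm_num, ?_, by linarith, ?_, by linarith, ?_,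
    by norm_num⟩
  · refine hexPoint_step (k := s) (m := 1) ha (by ring) (by ring) (by linarith) (by linarith)
      (steep_step (by linarith) (by linarith) ?_ (by norm_num))
    rw [abs_le]; constructor <;> linarith
  · refine hexPoint_step (k := s) (m := -1) ha (by ring) (by ring) (by linarith) (by linarith)
      (steep_step (by linarith) (by linarith) ?_ (by norm_num))
    rw [abs_le]; constructor <;> linarith
  · refine hexPoint_step (k := 1) (m := s) hb (by ring) (by ring) (by linarith) (by linarith)
      (steep_step (by linarith) (by linarith) ?_ (by rw [abs_le]; constructor <;> linarith))
    rw [abs_le]; constructor <;> linarith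
  · refine hexPoint_step (k := 4) (m := 0) hb (by ring) (by ring) (by linarith) (by linarith)
      (steep_step (by linarith) (by linarith) ?_ (by norm_num))
    rw [abs_le]; constructor <;> linarith
  · refine hexPoint_step (k := 1) (m := -s) hb (by ring) (by ring) (by linarith) (by linarith)
      (steep_step (by linarith) (by linarith) ?_ (by rw [abs_le]; constructor <;> linarith))
    rw [abs_le]; constructor <;> linarith

/-- Two edges are perpendicular to the axis, at the abscissas 3b and √3 a + 6b, and so the lower
half is not a graph in the usual sense. The first descends and the second ascends; seen from an apex
whose abscissa lies strictly between theirs both progress. The apex is taken over their midpoint. -/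
theorem rising_lowerChain (ha : 0 ≤ a) (hb : 0 ≤ b) (hab : a + b = 1) :
    Rising ((Real.sqrt 3 * a + 9 * b) / 2) 100 (lowerChain a b) := by
  obtain ⟨h1, h2⟩ := sqrt_three_bounds
  set s := Real.sqrt 3
  have ha1 : a ≤ 1 := by linarith
  have hb1 : b ≤ 1 := by linarith
  have sa : s * a ≤ 1.8 := by nlinarith
  have sb : s * b ≤ 1.8 := by nlinarith
  have sa0 : 0 ≤ s * a := by positivity
  have sb0 : 0 ≤ s * b := by positivity
  have hpos : 0 < s * a + 3 * b := by nlinarith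
  simp only [lowerChain, Rising, hexIm_hexPoint]
  refine ⟨by norm_num, ?_, by linarith, ?_, by linarith, ?_, by linarith, ?_, by linarith, ?_,
    by linarith, ?_, by linarith, ?_, by linarith, ?_, by norm_num⟩
  · refine hexPoint_step (k := 1) (m := -s) hb (by ring) (by ring) (by linarith) (by linarith)
      (steep_step (by linarith) (by linarith) ?_ (by rw [abs_le]; constructor <;> linarith))
    rw [abs_le]; constructor <;> linarith
  · refine hexPoint_step (k := 2) (m := 0) hb (by ring) (by ring) (by linarith) (by linarith)
      (steep_step (by linarith) (by linarith) ?_ (by norm_num))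
    rw [abs_le]; constructor <;> linarith
  -- A perpendicular edge; the condition reduces to the apex lying to its right.
  · exact hexPoint_step (k := 0) (m := -2) ha (by ring) (by ring) (by linarith) (by linarith)
      (by linarith)
  · refine hexPoint_step (k := s) (m := -1) ha (by ring) (by ring) (by linarith) (by linarith)
      (steep_step (by linarith) (by linarith) ?_ (by norm_num))
    rw [abs_le]; constructor <;> linarith
  · refine hexPoint_step (k := 1) (m := s) hb (by ring) (by ring) (by linarith) (by linarith)
      (steep_step (by linarith) (by linarith) ?_ (by rw [abs_le]; constructor <;> linarith))
    rw [abs_le]; constructor <;> linarith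
  · refine hexPoint_step (k := 2) (m := 0) hb (by ring) (by ring) (by linarith) (by linarith)
      (steep_step (by linarith) (by linarith) ?_ (by norm_num))
    rw [abs_le]; constructor <;> linarith
  · exact hexPoint_step (k := 0) (m := 2) ha (by ring) (by ring) (by linarith) (by linarith)
      (by linarith)
  · refine hexPoint_step (k := s) (m := 1) ha (by ring) (by ring) (by linarith) (by linarith)
      (steep_step (by linarith) (by linarith) ?_ (by norm_num))
    rw [abs_le]; constructor <;> linarith

theorem chainSet_subset_of_convex {C : Set ℂ} (hC : Convex ℝ C) :
    ∀ l : List ℂ, (∀ P ∈ l, P ∈ C) → chainSet l ⊆ C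
  | [], _ => Set.empty_subset _
  | [P], h => by simpa [chainSet] using h
  | P :: Q :: l, h => by
    rw [chainSet]
    refine Set.union_subset (hC.segment_subset (h P (by simp)) (h Q (by simp)))
      (chainSet_subset_of_convex hC (Q :: l) fun P' h' => h P' (List.mem_cons_of_mem _ h'))

theorem upperChain_nonneg (ha : 0 ≤ a) (hb : 0 ≤ b) :
    ∀ z ∈ chainSet (upperChain a b), 0 ≤ hexIm z := by
  have : 0 ≤ Real.sqrt 3 * b := by positivity
  refine chainSet_subset_of_convex convex_halfPlane_hexIm _ ?_
  simp [upperChain, hexIm_hexPoint, ha, this]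

theorem convex_lower_halfPlane : Convex ℝ {z : ℂ | hexIm z ≤ 0} := by
  intro z hz w hw l m hl hm hlm
  simp only [Set.mem_ofPred_eq] at hz hw ⊢
  rw [hexIm_combo]
  nlinarith

theorem lowerChain_nonpos (ha : 0 ≤ a) (hb : 0 ≤ b) :
    ∀ z ∈ chainSet (lowerChain a b), hexIm z ≤ 0 := by
  have : 0 ≤ Real.sqrt 3 * b := by positivity
  refine chainSet_subset_of_convex convex_lower_halfPlane _ ?_
  simp only [lowerChain, List.mem_cons, List.not_mem_nil, or_false, Set.mem_ofPred_eq]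
  rintro P (rfl | rfl | rfl | rfl | rfl | rfl | rfl | rfl | rfl) <;> rw [hexIm_hexPoint] <;>
    linarith

theorem mem_segment_hexPoint {x y x' y' : ℝ} {z : ℂ}
    (h : z ∈ segment ℝ (hexPoint x y) (hexPoint x' y')) :
    ∃ m : ℝ, 0 ≤ m ∧ m ≤ 1 ∧ hexRe z = (1 - m) * x + m * x' ∧
      hexIm z = (1 - m) * y + m * y' := by
  obtain ⟨l, m, hl, hm, hlm, rfl⟩ := h
  obtain rfl : l = 1 - m := by linarith
  refine ⟨m, hm, by linarith, ?_, ?_⟩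
  · rw [hexRe_combo, hexRe_hexPoint, hexRe_hexPoint]
  · rw [hexIm_combo, hexIm_hexPoint, hexIm_hexPoint]

theorem upperChain_zero {z : ℂ}
    (hz : z ∈ chainSet (upperChain a b)) (h : hexIm z = 0) :
    hexRe z = 0 ∨ hexRe z = 2 * Real.sqrt 3 * a ∨ hexRe z = 2 * Real.sqrt 3 * a + 6 * b := by
  have hs : 0 < Real.sqrt 3 := by positivity
  simp only [upperChain, chainSet, Set.mem_union] at hz
  rcases hz with hz | hz | hz | hz | hz | hz
  · obtain ⟨m, hm, hm', h1, h2⟩ := mem_segment_hexPoint hz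
    left
    have : m * a = 0 := by linarith
    rw [h1]; linear_combination Real.sqrt 3 * this
  · obtain ⟨m, hm, hm', h1, h2⟩ := mem_segment_hexPoint hz
    right; left
    have : (1 - m) * a = 0 := by linarith
    rw [h1]; linear_combination (-Real.sqrt 3) * this
  · obtain ⟨m, hm, hm', h1, h2⟩ := mem_segment_hexPoint hz
    right; left
    have : m * b = 0 := by
      have : Real.sqrt 3 * (m * b) = 0 := by linarith
      exact (mul_eq_zero.1 this).resolve_left hs.ne'
    rw [h1]; linear_combination this
  · obtain ⟨m, hm, hm', h1, h2⟩ := mem_segment_hexPoint hz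
    right; left
    have : b = 0 := by
      have : Real.sqrt 3 * b = 0 := by linarith
      exact (mul_eq_zero.1 this).resolve_left hs.ne'
    rw [h1, this]; ring
  · obtain ⟨m, hm, hm', h1, h2⟩ := mem_segment_hexPoint hz
    right; right
    have : (1 - m) * b = 0 := by
      have : Real.sqrt 3 * ((1 - m) * b) = 0 := by linarith
      exact (mul_eq_zero.1 this).resolve_left hs.ne'
    rw [h1]; linear_combination -this
  · right; right
    rw [Set.mem_singleton_iff.1 hz, hexRe_hexPoint]

/-- The third alternative is the degenerate case a = 0, where part of the lower half rises to the
axis. There the upper half has only the two extreme points on the axis, so no new common point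
arises. -/
theorem lowerChain_zero (ha : 0 ≤ a) (hb : 0 ≤ b) {z : ℂ}
    (hz : z ∈ chainSet (lowerChain a b)) (h : hexIm z = 0) :
    hexRe z = 0 ∨ hexRe z = 2 * Real.sqrt 3 * a + 6 * b ∨ a = 0 ∧ 4 * b ≤ hexRe z := by
  have hs : 0 < Real.sqrt 3 := by positivity
  have hsb : 0 ≤ Real.sqrt 3 * b := by positivity
  have hb0 : Real.sqrt 3 * b = 0 → b = 0 := fun h => (mul_eq_zero.1 h).resolve_left hs.ne'
  simp only [lowerChain, chainSet, Set.mem_union] at hz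
  rcases hz with hz | hz | hz | hz | hz | hz | hz | hz | hz
  · obtain ⟨m, hm, hm', h1, h2⟩ := mem_segment_hexPoint hz
    left
    have : m * b = 0 := by
      have : Real.sqrt 3 * (m * b) = 0 := by linarith
      exact (mul_eq_zero.1 this).resolve_left hs.ne'
    rw [h1]; linear_combination this
  · obtain ⟨m, hm, hm', h1, h2⟩ := mem_segment_hexPoint hz
    left
    rw [h1, hb0 (by linarith)]; ring
  · obtain ⟨m, hm, hm', h1, h2⟩ := mem_segment_hexPoint hz
    left
    have := mul_nonneg hm ha
    rw [h1, hb0 (by linarith)]; ring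
  · obtain ⟨m, hm, hm', h1, h2⟩ := mem_segment_hexPoint hz
    left
    have := mul_nonneg hm ha
    have ha0 : a = 0 := by linarith
    rw [h1, ha0, hb0 (by linarith)]; ring
  · obtain ⟨m, hm, hm', h1, h2⟩ := mem_segment_hexPoint hz
    right; right
    have h3 := mul_nonneg (sub_nonneg.2 hm') hsb
    have ha0 : a = 0 := by linarith
    have h4 : (1 - m) * b = 0 := by
      have : Real.sqrt 3 * ((1 - m) * b) = 0 := by linarith
      exact (mul_eq_zero.1 this).resolve_left hs.ne'
    refine ⟨ha0, ?_⟩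
    rw [h1, ha0]; linarith
  · obtain ⟨m, hm, hm', h1, h2⟩ := mem_segment_hexPoint hz
    right; right
    have ha0 : a = 0 := by linarith
    have := mul_nonneg hm hb
    refine ⟨ha0, ?_⟩
    rw [h1, ha0]; linarith
  · obtain ⟨m, hm, hm', h1, h2⟩ := mem_segment_hexPoint hz
    right; right
    have := mul_nonneg (sub_nonneg.2 hm') ha
    have ha0 : a = 0 := by linarith
    refine ⟨ha0, ?_⟩
    rw [h1, ha0]; linarith
  · obtain ⟨m, hm, hm', h1, h2⟩ := mem_segment_hexPoint hz
    right; left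
    have : (1 - m) * a = 0 := by linarith
    rw [h1]; linear_combination (-Real.sqrt 3) * this
  · right; left
    rw [Set.mem_singleton_iff.1 hz, hexRe_hexPoint]

theorem getLast_mem_chainSet : ∀ (l : List ℂ) (h : l ≠ []), l.getLast h ∈ chainSet l
  | [_], _ => rfl
  | _ :: Q :: l, _ => Or.inr (getLast_mem_chainSet (Q :: l) (List.cons_ne_nil _ _))

theorem exists_isDisc_chains (ha : 0 ≤ a) (hb : 0 ≤ b) (hab : a + b = 1) :
    ∃ T O, IsDisc T O (chainSet (upperChain a b) ∪ chainSet (lowerChain a b)) := by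
  have hs : 0 < Real.sqrt 3 := by positivity
  have hU := isSection_chainSet _ _ (rising_upperChain ha hb hab)
  have hL := isSection_chainSet _ _ (rising_lowerChain ha hb hab)
  have hUB := getLast_mem_chainSet (upperChain a b) (List.cons_ne_nil _ _)
  have hLB := getLast_mem_chainSet (lowerChain a b) (List.cons_ne_nil _ _)
  refine exists_isDisc_of_isSection ?_ hU hL
    (fun z hz w hw => (lowerChain_nonpos ha hb w hw).trans (upperChain_nonneg ha hb z hz)) ?_
    (A := hexPoint 0 0) (B := hexPoint (2 * Real.sqrt 3 * a + 6 * b) 0)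
    ⟨mem_chainSet_head _ _, mem_chainSet_head _ _⟩ ⟨hUB, hLB⟩ rfl rfl
  · change pencil _ _ (hexPoint 0 0) < pencil _ _ (hexPoint (2 * Real.sqrt 3 * a + 6 * b) 0)
    rw [pencil_lt_iff (by rw [hexIm_hexPoint]; norm_num) (by rw [hexIm_hexPoint]; norm_num)]
    simp only [hexRe_hexPoint, hexIm_hexPoint]
    obtain ⟨h1, -⟩ := sqrt_three_bounds
    nlinarith
  · rintro z ⟨hz1, hz2⟩
    have h0 : hexIm z = 0 :=
      le_antisymm (lowerChain_nonpos ha hb z hz2) (upperChain_nonneg ha hb z hz1)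
    have key : hexRe z = 0 ∨ hexRe z = 2 * Real.sqrt 3 * a + 6 * b := by
      rcases lowerChain_zero ha hb hz2 h0 with h | h | ⟨h1, h2⟩
      · exact Or.inl h
      · exact Or.inr h
      · rcases upperChain_zero hz1 h0 with h | h | h
        · exact Or.inl h
        · rw [h1, mul_zero] at h
          exact Or.inl h
        · exact Or.inr h
    rcases key with h | h
    · left
      rw [← hexPoint_hexRe_hexIm z, h, h0]
    · right
      rw [← hexPoint_hexRe_hexIm z, h, h0]
      rfl

theorem hatVertex_eq (c : ℝ) : hatVertex c =
    ![hexPoint 0 0, hexPoint (Real.sqrt 3 * (1 - c)) (1 - c),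
      hexPoint (2 * Real.sqrt 3 * (1 - c)) 0,
      hexPoint (2 * Real.sqrt 3 * (1 - c) + c) (Real.sqrt 3 * c),
      hexPoint (2 * Real.sqrt 3 * (1 - c) + 5 * c) (Real.sqrt 3 * c),
      hexPoint (2 * Real.sqrt 3 * (1 - c) + 6 * c) 0,
      hexPoint (Real.sqrt 3 * (1 - c) + 6 * c) (-(1 - c)),
      hexPoint (Real.sqrt 3 * (1 - c) + 6 * c) (-(3 * (1 - c))),
      hexPoint (Real.sqrt 3 * (1 - c) + 4 * c) (-(3 * (1 - c))),
      hexPoint (Real.sqrt 3 * (1 - c) + 3 * c) (-(3 * (1 - c)) - Real.sqrt 3 * c),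
      hexPoint (3 * c) (-(2 * (1 - c)) - Real.sqrt 3 * c),
      hexPoint (3 * c) (-(Real.sqrt 3 * c)), hexPoint c (-(Real.sqrt 3 * c))] := by
  have h : Real.sqrt 3 ^ 2 = 3 := Real.sq_sqrt (by norm_num)
  funext i
  fin_cases i <;> apply Complex.ext <;>
    simp [hatVertex, hexPoint, hexRoot] <;> first | done | (ring_nf; (try rw [h]); try ring)

theorem subset_polygonCurve {m : ℕ} [NeZero m] (w : Fin m → ℂ) (i : Fin m) {S : Set ℂ}
    (h : S ⊆ segment ℝ (w i) (w (i + 1))) : S ⊆ polygonCurve w :=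
  Set.subset_iUnion_of_subset i h

theorem subset_polygonCurve' {m : ℕ} [NeZero m] (w : Fin m → ℂ) (i : Fin m) {S : Set ℂ}
    (h : S ⊆ segment ℝ (w (i + 1)) (w i)) : S ⊆ polygonCurve w :=
  subset_polygonCurve w i (by rwa [segment_symm])

theorem polygonCurve_hatVertex (c : ℝ) : polygonCurve (hatVertex c) =
    chainSet (upperChain (1 - c) c) ∪ chainSet (lowerChain (1 - c) c) := by
  rw [hatVertex_eq]
  apply Set.Subset.antisymm
  · intro z hz
    obtain ⟨i, hi⟩ := Set.mem_iUnion.1 hz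
    simp only [upperChain, lowerChain, chainSet, Set.mem_union]
    fin_cases i
    · exact Or.inl (Or.inl hi)
    · exact Or.inl (Or.inr (Or.inl hi))
    · exact Or.inl (Or.inr (Or.inr (Or.inl hi)))
    · exact Or.inl (Or.inr (Or.inr (Or.inr (Or.inl hi))))
    · exact Or.inl (Or.inr (Or.inr (Or.inr (Or.inr (Or.inl hi)))))
    all_goals
      rw [segment_symm] at hi
      right
    · exact Or.inr (Or.inr (Or.inr (Or.inr (Or.inr (Or.inr (Or.inr (Or.inl hi)))))))
    · exact Or.inr (Or.inr (Or.inr (Or.inr (Or.inr (Or.inr (Or.inl hi))))))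
    · exact Or.inr (Or.inr (Or.inr (Or.inr (Or.inr (Or.inl hi)))))
    · exact Or.inr (Or.inr (Or.inr (Or.inr (Or.inl hi))))
    · exact Or.inr (Or.inr (Or.inr (Or.inl hi)))
    · exact Or.inr (Or.inr (Or.inl hi))
    · exact Or.inr (Or.inl hi)
    · exact Or.inl hi
  · simp only [upperChain, lowerChain, chainSet]
    have last : ∀ P Q : ℂ, {Q} ⊆ segment ℝ P Q := fun P Q => by
      rw [Set.singleton_subset_iff]; exact right_mem_segment ℝ P Q
    refine Set.union_subset (Set.union_subset (subset_polygonCurve _ 0 subset_rfl) (Set.union_subset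
      (subset_polygonCurve _ 1 subset_rfl) (Set.union_subset (subset_polygonCurve _ 2 subset_rfl) (Set.union_subset
      (subset_polygonCurve _ 3 subset_rfl) (Set.union_subset (subset_polygonCurve _ 4 subset_rfl) (subset_polygonCurve _ 4 (last _ _)))))))
      (Set.union_subset (subset_polygonCurve' _ 12 subset_rfl) (Set.union_subset (subset_polygonCurve' _ 11 subset_rfl)
      (Set.union_subset (subset_polygonCurve' _ 10 subset_rfl) (Set.union_subset (subset_polygonCurve' _ 9 subset_rfl)
      (Set.union_subset (subset_polygonCurve' _ 8 subset_rfl) (Set.union_subset (subset_polygonCurve' _ 7 subset_rfl)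
      (Set.union_subset (subset_polygonCurve' _ 6 subset_rfl) (Set.union_subset (subset_polygonCurve' _ 5 subset_rfl)
      (subset_polygonCurve' _ 5 (last _ _))))))))))

/-- The interior of the hat. -/
def hatInterior (c : ℝ) : Set ℂ := hatTile c \ polygonCurve (hatVertex c)

theorem isDisc_hatTile {c : ℝ} (hc : c ∈ Set.Icc (0 : ℝ) 1) :
    IsDisc (hatTile c) (hatInterior c) (polygonCurve (hatVertex c)) := by
  obtain ⟨T, O, h⟩ := exists_isDisc_chains (a := 1 - c) (b := c) (by linarith [hc.2]) hc.1
    (by ring)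
  rw [← polygonCurve_hatVertex] at h
  have h1 : hatTile c = T := h.polygonRegion_eq
  have h2 : hatInterior c = O := by
    rw [hatInterior, h1, ← h.diff_eq, Set.sdiff_sdiff_cancel_left]
    exact h.closure_eq ▸ subset_closure
  rwa [h1, h2]

/-! ### The winding number of the boundary of the hat -/

theorem ev_edge_position (x y z w : ℤ) : Pos.ev a b n ((0, 0), (0, 0), (x, y), (z, w)) =
    hexPoint (Real.sqrt 3 * a * (x + y) + b * (z + 2 * w)) (a * (y - x) - Real.sqrt 3 * b * z) := by
  simp only [Pos.ev, eis, edgeUnit, hexPoint]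
  push_cast
  rw [hexRoot]
  linear_combination ((Real.sqrt 3 : ℂ) * x * a / 2 + 3 / 2 * z * b) * I_sq +
    (-I * x * a / 2 + z * b / 2 * I ^ 2) * sqrt_three_sq

/-! ### Continuity of angles -/

/-- The quotient of the two directions is a nonpositive real exactly when p lies between P and Q, or
equals P; these points of the segment are excluded. -/
theorem div_mem_slitPlane {P Q p : ℂ} (hp : p ∉ segment ℝ P Q) :
    (P - p) / (Q - p) ∈ slitPlane := by
  have hQ : Q - p ≠ 0 := fun h => hp (by
    rw [sub_eq_zero] at h; rw [← h]; exact right_mem_segment ℝ P Q)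
  rw [Complex.mem_slitPlane_iff_not_le_zero]
  intro h
  obtain ⟨r, hr, e⟩ : ∃ r : ℝ, 0 ≤ r ∧ (P - p) / (Q - p) = -(r : ℂ) := by
    have h1 := Complex.le_def.1 h
    refine ⟨-((P - p) / (Q - p)).re, by simpa using h1.1, ?_⟩
    apply Complex.ext
    · simp
    · simpa using h1.2
  rw [div_eq_iff hQ] at e
  apply hp
  have h1 : (0 : ℝ) < 1 + r := by linarith
  have h2 : (1 + r : ℂ) ≠ 0 := by exact_mod_cast h1.ne'
  refine ⟨1 / (1 + r), r / (1 + r), by positivity, by positivity, by field_simp, ?_⟩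
  simp only [Complex.real_smul]
  push_cast
  field_simp
  linear_combination e

theorem turnAngle_of_notMem {P Q p : ℂ} (hp : p ∉ segment ℝ P Q) :
    turnAngle (P - p) (Q - p) = arg ((P - p) / (Q - p)) := by
  rw [turnAngle, if_neg]
  exact (Complex.mem_slitPlane_iff_arg.1 (div_mem_slitPlane hp)).1

theorem continuousAt_turnAngle {P Q p : ℂ} (hp : p ∉ segment ℝ P Q) :
    ContinuousAt (fun p => turnAngle (P - p) (Q - p)) p := by
  have hopen : IsOpen (segment ℝ P Q)ᶜ := by
    rw [segment_eq_image_lineMap]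
    exact (isCompact_Icc.image AffineMap.lineMap_continuous).isClosed.isOpen_compl
  have hQ : Q - p ≠ 0 := fun h => hp (by
    rw [sub_eq_zero] at h; rw [← h]; exact right_mem_segment ℝ P Q)
  have h1 : ContinuousAt (fun p => arg ((P - p) / (Q - p))) p := by
    refine ContinuousAt.comp (g := arg) (Complex.continuousAt_arg (div_mem_slitPlane hp)) ?_
    exact ContinuousAt.div (by fun_prop) (by fun_prop) hQ
  refine h1.congr ?_
  filter_upwards [hopen.mem_nhds hp] with q hq
  exact (turnAngle_of_notMem hq).symm

theorem exp_turnAngle {P Q p : ℂ} (hp : p ∉ segment ℝ P Q) :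
    Complex.exp (turnAngle (P - p) (Q - p) * I) =
      ((P - p) / ‖P - p‖) / ((Q - p) / ‖Q - p‖) := by
  have hP : P - p ≠ 0 := fun h => hp (by
    rw [sub_eq_zero] at h; rw [← h]; exact left_mem_segment ℝ P Q)
  have hQ : Q - p ≠ 0 := fun h => hp (by
    rw [sub_eq_zero] at h; rw [← h]; exact right_mem_segment ℝ P Q)
  have h0 : (‖(P - p) / (Q - p)‖ : ℂ) ≠ 0 := by
    exact_mod_cast (norm_pos_iff.2 (div_ne_zero hP hQ)).ne'
  have h1 : (‖P - p‖ : ℂ) ≠ 0 := by exact_mod_cast (norm_pos_iff.2 hP).ne'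
  have h2 : (‖Q - p‖ : ℂ) ≠ 0 := by exact_mod_cast (norm_pos_iff.2 hQ).ne'
  have h3 := Complex.norm_mul_exp_arg_mul_I ((P - p) / (Q - p))
  rw [turnAngle_of_notMem hp]
  apply mul_left_cancel₀ h0
  rw [h3, norm_div]
  push_cast
  field_simp

/-- The edges of the list avoid the point. -/
def Avoids (a b : ℝ) (n : ℕ) (l : List Term) (p : ℂ) : Prop :=
  ∀ t ∈ l, p ∉ segment ℝ (t.pos.ev a b n) (t.far.ev a b n)

theorem continuousAt_totalSweep {p : ℂ} :
    ∀ l : List Term, (∀ t ∈ l, t.arc.code = 3 ∨ t.arc.code = 4) → Avoids a b n l p →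
      ContinuousAt (fun p => totalSweep a b n p l) p
  | [], _, _ => by simp only [totalSweep_nil]; exact continuousAt_const
  | t :: l, he, h => by
    simp only [totalSweep_cons]
    refine ContinuousAt.add (continuousAt_const.mul ?_) (continuousAt_totalSweep l
      (fun t' h' => he t' (List.mem_cons_of_mem _ h'))
      fun t' h' => h t' (List.mem_cons_of_mem _ h'))
    have : (fun p => sweepAt a b n p t.arc t.r t.pos) =
        fun p => turnAngle (t.pos.ev a b n - p) (t.far.ev a b n - p) :=
      funext fun p => straight_edge (he t List.mem_cons_self) p
    rw [this]
    exact continuousAt_turnAngle (h t List.mem_cons_self)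

/-- Exponentiated angles are quotients of unit vectors and telescope along any path that avoids p,
without a half-plane condition. For a closed path the sweep is therefore a multiple of 2π. -/
theorem exp_totalSweep {p : ℂ} :
    ∀ (S : Pos) (l : List Term) (T : Pos), isPath S l T = true →
      (∀ t ∈ l, t.arc.code = 3 ∨ t.arc.code = 4) → Avoids a b n l p → (∀ t ∈ l, t.s = 1) →
      S.ev a b n - p ≠ 0 →
      Complex.exp (totalSweep a b n p l * I) =
        ((S.ev a b n - p) / ‖S.ev a b n - p‖) / ((T.ev a b n - p) / ‖T.ev a b n - p‖)
  | S, [], T, h, _, _, _, h0 => by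
    rw [isPath, beq_iff_eq] at h
    rw [h] at h0 ⊢
    have h1 : (‖T.ev a b n - p‖ : ℂ) ≠ 0 := by exact_mod_cast (norm_pos_iff.2 h0).ne'
    rw [totalSweep_nil, div_self (div_ne_zero h0 h1)]
    simp
  | S, t :: l, T, h, he, hav, hs, h0 => by
    rw [isPath, Bool.and_eq_true, Bool.and_eq_true, beq_iff_eq] at h
    obtain ⟨⟨h1, -⟩, h3⟩ := h
    have hs1 := hs t List.mem_cons_self
    have ht := hav t List.mem_cons_self
    have hfar : t.far.ev a b n - p ≠ 0 := fun h => ht (by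
      rw [sub_eq_zero] at h; rw [← h]; exact right_mem_segment ℝ _ _)
    have hn : (‖t.far.ev a b n - p‖ : ℂ) ≠ 0 := by exact_mod_cast (norm_pos_iff.2 hfar).ne'
    rw [Term.src, if_pos hs1] at h1
    rw [Term.tgt, if_pos hs1] at h3
    have ih := exp_totalSweep t.far l T h3 (fun t' h' => he t' (List.mem_cons_of_mem _ h'))
      (fun t' h' => hav t' (List.mem_cons_of_mem _ h'))
      (fun t' h' => hs t' (List.mem_cons_of_mem _ h')) hfar
    rw [totalSweep_cons, hs1, straight_edge (he t List.mem_cons_self) p, Int.cast_one, one_mul,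
      Complex.ofReal_add, add_mul, Complex.exp_add, ih, exp_turnAngle ht, h1,
      div_mul_div_cancel₀ (div_ne_zero hfar hn)]

theorem tileEdges_edges : ∀ t ∈ tileEdges, (t.arc.code = 3 ∨ t.arc.code = 4) ∧ t.s = 1 := by
  decide +kernel

theorem isPath_tileEdges : isPath Pos.origin tileEdges Pos.origin = true := by decide +kernel

theorem segment_subset_segment_of_mem {P Q R : ℂ} (h : R ∈ segment ℝ P Q) :
    segment ℝ P R ⊆ segment ℝ P Q ∧ segment ℝ R Q ⊆ segment ℝ P Q :=
  ⟨(convex_segment P Q).segment_subset (left_mem_segment ℝ P Q) h,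
    (convex_segment P Q).segment_subset h (right_mem_segment ℝ P Q)⟩

theorem hexPoint_midpoint_mem {x x' y : ℝ} :
    hexPoint ((x + x') / 2) y ∈ segment ℝ (hexPoint x y) (hexPoint x' y) := by
  refine ⟨1 / 2, 1 / 2, by norm_num, by norm_num, by norm_num, ?_⟩
  simp only [hexPoint, Complex.real_smul]
  push_cast
  ring

/-- The 14 edges of the path make up the 13 sides of the polygon: the side from vertex 3 to vertex 4
consists of two collinear edges B. -/
theorem segment_tileEdges_subset (c : ℝ) (t : Term) (ht : t ∈ tileEdges) :
    segment ℝ (t.pos.ev (1 - c) c 0) (t.far.ev (1 - c) c 0) ⊆ polygonCurve (hatVertex c) := by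
  have hv := hatVertex_eq c
  have key : ∀ (i : Fin 13) (t : Term) (S : Pos), t.far = S →
      hatVertex c i = t.pos.ev (1 - c) c 0 → hatVertex c (i + 1) = S.ev (1 - c) c 0 →
      segment ℝ (t.pos.ev (1 - c) c 0) (t.far.ev (1 - c) c 0) ⊆ polygonCurve (hatVertex c) := by
    intro i t S hS h h'
    rw [hS, ← h, ← h']
    exact subset_polygonCurve _ i subset_rfl
  have hmid : ∀ S ⊆ segment ℝ (hatVertex c 3) (hatVertex c 4), S ⊆ polygonCurve (hatVertex c) :=
    fun S h => subset_polygonCurve _ 3 h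
  have mid := segment_subset_segment_of_mem (hexPoint_midpoint_mem
    (x := 2 * Real.sqrt 3 * (1 - c) + c) (x' := 2 * Real.sqrt 3 * (1 - c) + 5 * c)
    (y := Real.sqrt 3 * c))
  simp only [tileEdges, List.mem_cons, List.not_mem_nil, or_false] at ht
  rcases ht with rfl | rfl | rfl | rfl | rfl | rfl | rfl | rfl | rfl | rfl | rfl | rfl | rfl | rfl
  · refine key 0 _ ((0, 0), (0, 0), (0, 1), (0, 0)) (by decide) ?_ ?_ <;>
      simp only [hv, ev_edge_position] <;> push_cast <;> simp
  · refine key 1 _ ((0, 0), (0, 0), (1, 1), (0, 0)) (by decide) ?_ ?_ <;>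
      simp only [hv, ev_edge_position] <;> push_cast <;> simp <;> ring_nf
  · refine key 2 _ ((0, 0), (0, 0), (1, 1), (-1, 1)) (by decide) ?_ ?_ <;>
      simp only [hv, ev_edge_position] <;> push_cast <;> simp <;> ring_nf
  · have hfar : Term.far ⟨1, .B, 1, ((0, 0), (0, 0), (1, 1), (-1, 1))⟩ = ((0, 0), (0, 0), (1, 1), (-1, 2)) := by decide
    refine hmid _ ?_
    rw [hv, hfar]
    rw [ev_edge_position, ev_edge_position]
    convert mid.1 using 2 <;> push_cast <;> ring_nf
  · have hfar : Term.far ⟨1, .B, 1, ((0, 0), (0, 0), (1, 1), (-1, 2))⟩ = ((0, 0), (0, 0), (1, 1), (-1, 3)) := by decide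
    refine hmid _ ?_
    rw [hv, hfar]
    rw [ev_edge_position, ev_edge_position]
    convert mid.2 using 2 <;> push_cast <;> ring_nf
  · refine key 4 _ ((0, 0), (0, 0), (1, 1), (0, 3)) (by decide) ?_ ?_ <;>
      simp only [hv, ev_edge_position] <;> push_cast <;> simp <;> ring_nf
  · refine key 5 _ ((0, 0), (0, 0), (1, 0), (0, 3)) (by decide) ?_ ?_ <;>
      simp only [hv, ev_edge_position] <;> push_cast <;> simp <;> ring_nf
  · refine key 6 _ ((0, 0), (0, 0), (2, -1), (0, 3)) (by decide) ?_ ?_ <;>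
      simp only [hv, ev_edge_position] <;> push_cast <;> simp <;> ring_nf
  · refine key 7 _ ((0, 0), (0, 0), (2, -1), (0, 2)) (by decide) ?_ ?_ <;>
      simp only [hv, ev_edge_position] <;> push_cast <;> simp <;> ring_nf
  · refine key 8 _ ((0, 0), (0, 0), (2, -1), (1, 1)) (by decide) ?_ ?_ <;>
      simp only [hv, ev_edge_position] <;> push_cast <;> simp <;> ring_nf
  · refine key 9 _ ((0, 0), (0, 0), (1, -1), (1, 1)) (by decide) ?_ ?_ <;>
      simp only [hv, ev_edge_position] <;> push_cast <;> simp <;> ring_nf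
  · refine key 10 _ ((0, 0), (0, 0), (0, 0), (1, 1)) (by decide) ?_ ?_ <;>
      simp only [hv, ev_edge_position] <;> push_cast <;> simp <;> ring_nf
  · refine key 11 _ ((0, 0), (0, 0), (0, 0), (1, 0)) (by decide) ?_ ?_ <;>
      simp only [hv, ev_edge_position] <;> push_cast <;> simp <;> ring_nf
  · refine key 12 _ ((0, 0), (0, 0), (0, 0), (0, 0)) (by decide) ?_ ?_ <;>
      simp only [hv, ev_edge_position] <;> push_cast <;> simp

theorem avoids_tileEdges {c : ℝ} {p : ℂ} (hp : p ∉ polygonCurve (hatVertex c)) :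
    Avoids (1 - c) c 0 tileEdges p :=
  fun t ht h => hp (segment_tileEdges_subset c t ht h)

theorem exists_tileSweep_eq {c : ℝ} {p : ℂ} (hp : p ∉ polygonCurve (hatVertex c)) :
    ∃ m : ℤ, tileSweep (1 - c) c p = m * (2 * Real.pi) := by
  have hav := avoids_tileEdges hp
  have h0 : Pos.origin.ev (1 - c) c 0 - p ≠ 0 := by
    intro h
    rw [sub_eq_zero] at h
    refine hav _ (List.mem_cons_self (l := tileEdges.tail)) ?_
    rw [← h]
    exact left_mem_segment ℝ _ _
  have h1 : (‖Pos.origin.ev (1 - c) c 0 - p‖ : ℂ) ≠ 0 := by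
    exact_mod_cast (norm_pos_iff.2 h0).ne'
  have h := exp_totalSweep _ _ _ isPath_tileEdges (fun t ht => (tileEdges_edges t ht).1) hav
    (fun t ht => (tileEdges_edges t ht).2) h0
  rw [div_self (div_ne_zero h0 h1), Complex.exp_eq_one_iff] at h
  obtain ⟨m, hm⟩ := h
  refine ⟨m, ?_⟩
  have : (totalSweep (1 - c) c 0 p tileEdges : ℂ) = m * (2 * Real.pi) := by
    apply mul_right_cancel₀ Complex.I_ne_zero
    rw [hm]; ring
  exact_mod_cast this

/-- Off the curve the sweep is continuous with values in the discrete group 2πℤ. -/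
theorem tileSweep_eq_of_isPreconnected {c : ℝ} {S : Set ℂ} (hS : IsPreconnected S)
    (hd : Disjoint S (polygonCurve (hatVertex c))) {p q : ℂ} (hp : p ∈ S) (hq : q ∈ S) :
    tileSweep (1 - c) c p = tileSweep (1 - c) c q := by
  have hdisc : DiscreteTopology (AddSubgroup.zmultiples (2 * Real.pi) : Set ℝ) :=
    inferInstanceAs (DiscreteTopology (AddSubgroup.zmultiples (2 * Real.pi)))
  refine hS.constant_of_mapsTo (f := tileSweep (1 - c) c)
    (T := (AddSubgroup.zmultiples (2 * Real.pi) : Set ℝ)) (isDiscrete_iff_discreteTopology.2 hdisc) ?_ ?_ hp hq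
  · intro x hx
    exact (continuousAt_totalSweep tileEdges (fun t ht => (tileEdges_edges t ht).1)
      (avoids_tileEdges (Set.disjoint_left.1 hd hx))).continuousWithinAt
  · intro x hx
    obtain ⟨m, hm⟩ := exists_tileSweep_eq (Set.disjoint_left.1 hd hx)
    rw [SetLike.mem_coe, AddSubgroup.mem_zmultiples_iff]
    exact ⟨m, by rw [hm, zsmul_eq_mul]⟩

/-- The value of m is not computed here; the covering argument does not need it. -/
theorem exists_tileSweep_interior {c : ℝ} (hc : c ∈ Set.Icc (0 : ℝ) 1) :
    ∃ m : ℤ, ∀ p ∈ hatInterior c, tileSweep (1 - c) c p = m * (2 * Real.pi) := by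
  have h := isDisc_hatTile hc
  obtain ⟨p, hp⟩ := h.nonempty
  obtain ⟨m, hm⟩ := exists_tileSweep_eq hp.2
  refine ⟨m, fun q hq => ?_⟩
  rw [← hm]
  exact tileSweep_eq_of_isPreconnected h.preconnected
    (Set.disjoint_left.2 fun x hx => hx.2) hq hp

/-- The point is connected to points far away, which see the whole polygon within a half-plane; a
closed path then sweeps no angle. -/
theorem tileSweep_exterior {c : ℝ} (hc : c ∈ Set.Icc (0 : ℝ) 1) {p : ℂ}
    (hp : p ∉ hatTile c) : tileSweep (1 - c) c p = 0 := by
  have h := isDisc_hatTile hc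
  obtain ⟨S, hpS, hS, hb, hd⟩ := h.exterior p hp
  obtain ⟨R, hR, hbd⟩ := exists_bound (Pos.origin :: tileEdges.map Term.tgt)
    fun S => ‖S.ev (1 - c) c 0 - 0‖
  obtain ⟨q, hq, hqR⟩ : ∃ q ∈ S, R + 1 ≤ ‖q - 0‖ := by
    by_contra! hcon
    refine hb (isBounded_iff_forall_norm_le.2 ⟨R + 1, fun x hx => ?_⟩)
    have := hcon x hx
    rw [sub_zero] at this
    exact this.le
  rw [tileSweep_eq_of_isPreconnected hS (hd.mono_right (h.diff_eq ▸ Set.sdiff_subset)) hpS hq,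
    tileSweep, totalSweep_of_isPath_ball (R := R + 1) _ _ _ isPath_tileEdges
      (fun t ht => straight_edge (tileEdges_edges t ht).1 q) hqR, turnAngle_self]
  · exact (hbd _ (by simp)).trans_lt (by linarith)
  · exact (hbd _ (by simp)).trans_lt (by linarith)
  · intro t ht
    exact (hbd _ (List.mem_cons_of_mem _ (List.mem_map_of_mem ht))).trans_lt (by linarith)

end

/-! ### Covering numbers: the tiles of a supertile do not overlap and large supertiles cover discs
-/

noncomputable section

open Complex
open scoped Classical

variable {a b c : ℝ} {n : ℕ}

/-! ### Covering numbers -/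

/-- The number of tiles of the list that have the point in their interior. -/
def coverCount (c : ℝ) (l : List (ℂ ≃ᵢ ℂ)) (p : ℂ) : ℕ :=
  l.countP fun U => decide (U.symm p ∈ hatInterior c)

/-- The point is on none of the boundaries of the tiles of the list. -/
def Generic (c : ℝ) (l : List (ℂ ≃ᵢ ℂ)) (p : ℂ) : Prop :=
  ∀ U ∈ l, U.symm p ∉ polygonCurve (hatVertex c)

theorem isClosed_hatCurve (hc : c ∈ Set.Icc (0 : ℝ) 1) :
    IsClosed (polygonCurve (hatVertex c)) := by
  have h := isDisc_hatTile hc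
  rw [← h.diff_eq]
  exact h.compact.isClosed.sdiff h.isOpen

/-- The boundary of a tile has no interior, because it lies in the closure of the open interior of
the tile. Finitely many such boundaries do not fill an open set. -/
theorem exists_generic (hc : c ∈ Set.Icc (0 : ℝ) 1) (l : List (ℂ ≃ᵢ ℂ)) {S : Set ℂ}
    (hS : IsOpen S) (hne : S.Nonempty) : ∃ p ∈ S, Generic c l p := by
  have h := isDisc_hatTile hc
  induction l generalizing S with
  | nil =>
    obtain ⟨p, hp⟩ := hne
    exact ⟨p, hp, by simp [Generic]⟩
  | cons U l ih =>
    have hopen : IsOpen (S ∩ U.symm ⁻¹' (polygonCurve (hatVertex c))ᶜ) :=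
      hS.inter ((isClosed_hatCurve hc).isOpen_compl.preimage U.symm.continuous)
    have hne' : (S ∩ U.symm ⁻¹' (polygonCurve (hatVertex c))ᶜ).Nonempty := by
      by_contra hcon
      rw [Set.not_nonempty_iff_eq_empty] at hcon
      obtain ⟨p, hp⟩ := hne
      have hsub : U ⁻¹' S ⊆ polygonCurve (hatVertex c) := by
        intro x hx
        by_contra hx'
        have : U x ∈ S ∩ U.symm ⁻¹' (polygonCurve (hatVertex c))ᶜ := ⟨hx, by simpa using hx'⟩
        rw [hcon] at this
        exact this
      have hp' : U.symm p ∈ closure (hatInterior c) := by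
        rw [h.closure_eq]
        exact (h.diff_eq ▸ Set.sdiff_subset : polygonCurve (hatVertex c) ⊆ hatTile c)
          (hsub (by simpa using hp))
      obtain ⟨x, hx, hx'⟩ := mem_closure_iff.1 hp' (U ⁻¹' S) (hS.preimage U.continuous)
        (by simpa using hp)
      exact hx'.2 (hsub hx)
    obtain ⟨p, hp, hg⟩ := ih hopen hne'
    refine ⟨p, hp.1, fun U' hU' => ?_⟩
    rcases List.mem_cons.1 hU' with rfl | hU'
    · exact hp.2
    · exact hg U' hU'

theorem frameSweep_eq_coverCount (hc : c ∈ Set.Icc (0 : ℝ) 1) {m : ℤ}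
    (hm : ∀ p ∈ hatInterior c, tileSweep (1 - c) c p = m * (2 * Real.pi))
    (l : List (ℂ ≃ᵢ ℂ)) {p : ℂ} (hp : Generic c l p) :
    frameSweep (1 - c) c l p = m * coverCount c l p * (2 * Real.pi) := by
  induction l with
  | nil => simp [frameSweep, coverCount]
  | cons U l ih =>
    have ih := ih fun U' h => hp U' (List.mem_cons_of_mem _ h)
    rw [frameSweep, List.map_cons, List.sum_cons, ← frameSweep, ih, coverCount, coverCount,
      List.countP_cons]
    by_cases h : U.symm p ∈ hatInterior c
    · rw [hm _ h]; simp [h]; ring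
    · rw [tileSweep_exterior hc fun h' => h ⟨h', hp U List.mem_cons_self⟩]; simp [h]

/-- The sum of the windings of the tiles is m times the covering number, and equals the winding
number 1 of the boundary. An integer product equal to 1 with a natural factor forces that factor to
be 1. -/
theorem eventually_coverCount_eq_one (hc : c ∈ Set.Icc (0 : ℝ) 1) :
    ∀ᶠ n : ℕ in Filter.atTop, ∀ p : ℂ,
      ‖p - levelScale (1 - c) c n * discCenter‖ ≤ ‖levelScale (1 - c) c n‖ / 10 →
      Generic c (frames (1 - c) c n).1 p → coverCount c (frames (1 - c) c n).1 p = 1 := by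
  obtain ⟨m, hm⟩ := exists_tileSweep_interior hc
  filter_upwards [exists_totalSweep_boundary8 (a := 1 - c) (b := c) (by linarith [hc.2]) hc.1
    (by linarith)] with n hn p hp hg
  have h1 := hn p hp
  rw [← (frameSweep_frames n p).1, frameSweep_eq_coverCount hc hm _ hg] at h1
  have h2 : (m : ℝ) * coverCount c (frames (1 - c) c n).1 p = 1 := by
    have := Real.pi_pos
    have h3 : (2 * Real.pi) ≠ 0 := by positivity
    exact mul_right_cancel₀ h3 (by rw [h1, one_mul])
  have h3 : m * (coverCount c (frames (1 - c) c n).1 p : ℤ) = 1 := by exact_mod_cast h2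
  have h4 := Int.isUnit_iff.1 (IsUnit.of_mul_eq_one _ (by rw [mul_comm]; exact h3) : IsUnit
    (coverCount c (frames (1 - c) c n).1 p : ℤ))
  omega

/-! ### Supertiles within supertiles -/

theorem sublist_flatMap {α β : Type*} {l : List α} {f : α → List β} {x : α} (h : x ∈ l) :
    (f x).Sublist (l.flatMap f) := by
  induction l with
  | nil => simp at h
  | cons y l ih =>
    rw [List.flatMap_cons]
    rcases List.mem_cons.1 h with rfl | h
    · exact List.sublist_append_left _ _
    · exact (ih h).trans (List.sublist_append_right _ _)

/-- The list is a copy of a supertile of level `k`. -/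
def IsCopy (a b : ℝ) (k : ℕ) (l : List (ℂ ≃ᵢ ℂ)) : Prop :=
  ∃ V : ℂ ≃ᵢ ℂ, l = (frames a b k).1.map (fun U => U.trans V) ∨
    l = (frames a b k).2.map fun U => U.trans V

theorem IsCopy.map {k : ℕ} {l : List (ℂ ≃ᵢ ℂ)} (h : IsCopy a b k l) (V : ℂ ≃ᵢ ℂ) :
    IsCopy a b k (l.map fun U => U.trans V) := by
  obtain ⟨W, h | h⟩ := h
  · refine ⟨W.trans V, Or.inl ?_⟩
    rw [h, List.map_map]; rfl
  · refine ⟨W.trans V, Or.inr ?_⟩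
    rw [h, List.map_map]; rfl

theorem exists_isCopy_nextFrames {k : ℕ} {lo : List (Fin 7)} {p : List (ℂ ≃ᵢ ℂ) × List (ℂ ≃ᵢ ℂ)}
    (h1 : ∀ W ∈ p.1, ∃ l, IsCopy a b k l ∧ W ∈ l ∧ l.Sublist p.1)
    (h2 : ∀ W ∈ p.2, ∃ l, IsCopy a b k l ∧ W ∈ l ∧ l.Sublist p.2) :
    ∀ W ∈ nextFrames a b n lo p, ∃ l, IsCopy a b k l ∧ W ∈ l ∧
      l.Sublist (nextFrames a b n lo p) := by
  intro W hW
  rw [nextFrames, List.mem_append] at hW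
  rcases hW with hW | hW
  · obtain ⟨i, hi, hW⟩ := List.mem_flatMap.1 hW
    obtain ⟨W', hW', rfl⟩ := List.mem_map.1 hW
    obtain ⟨l, hl, hm, hs⟩ := h1 W' hW'
    refine ⟨l.map fun U => U.trans (hatMove a b n i), hl.map _, List.mem_map_of_mem hm, ?_⟩
    refine (hs.map _).trans ((sublist_flatMap
      (f := fun i => p.1.map fun U => U.trans (hatMove a b n i)) hi).trans
        (List.sublist_append_left _ _))
  · obtain ⟨W', hW', rfl⟩ := List.mem_map.1 hW
    obtain ⟨l, hl, hm, hs⟩ := h2 W' hW'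
    exact ⟨l.map fun U => U.trans (hatMove a b n 6), hl.map _, List.mem_map_of_mem hm,
      (hs.map _).trans (List.sublist_append_right _ _)⟩

/-- Each tile of a large supertile belongs to a copy of a supertile of given lower level. Sublists,
and not subsets, are used because tiles are counted with multiplicity. -/
theorem exists_isCopy (k m : ℕ) :
    (∀ W ∈ (frames a b (k + m)).1, ∃ l, IsCopy a b k l ∧ W ∈ l ∧
      l.Sublist (frames a b (k + m)).1) ∧
    ∀ W ∈ (frames a b (k + m)).2, ∃ l, IsCopy a b k l ∧ W ∈ l ∧
      l.Sublist (frames a b (k + m)).2 := by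
  induction m with
  | zero =>
    have e : ∀ l : List (ℂ ≃ᵢ ℂ), l = l.map fun U => U.trans (IsometryEquiv.refl ℂ) := by
      intro l
      conv_lhs => rw [← List.map_id l]
      rfl
    exact ⟨fun W hW => ⟨_, ⟨IsometryEquiv.refl ℂ, Or.inl (e _)⟩, hW, List.Sublist.refl _⟩,
      fun W hW => ⟨_, ⟨IsometryEquiv.refl ℂ, Or.inr (e _)⟩, hW, List.Sublist.refl _⟩⟩
  | succ m ih =>
    rw [← add_assoc, frames]
    exact ⟨exists_isCopy_nextFrames ih.1 ih.2, exists_isCopy_nextFrames ih.1 ih.2⟩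

/-- The second place carries an H₈-supertile in both kinds of supertile, so it does not matter which
kind is found. -/
theorem IsCopy.exists_sublist {k : ℕ} {l : List (ℂ ≃ᵢ ℂ)} (h : IsCopy a b (k + 1) l) :
    ∃ V : ℂ ≃ᵢ ℂ, ((frames a b k).1.map fun U => U.trans V).Sublist l := by
  have key : ∀ lo : List (Fin 7), 1 ∈ lo →
      ((frames a b k).1.map fun U => U.trans (hatMove a b (k + 1) 1)).Sublist
        (nextFrames a b (k + 1) lo (frames a b k)) := fun lo h1 =>
    (sublist_flatMap (f := fun i => (frames a b k).1.map fun U => U.trans (hatMove a b (k + 1) i))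
      h1).trans (List.sublist_append_left _ _)
  obtain ⟨V, rfl | rfl⟩ := h
  · have := (key [0, 1, 2, 3, 4, 5] (by simp)).map fun U => U.trans V
    rw [List.map_map] at this
    exact ⟨(hatMove a b (k + 1) 1).trans V, this⟩
  · have := (key [1, 2, 3, 4, 5] (by simp)).map fun U => U.trans V
    rw [List.map_map] at this
    exact ⟨(hatMove a b (k + 1) 1).trans V, this⟩

theorem exists_diam_bound (hc : c ∈ Set.Icc (0 : ℝ) 1) (k : ℕ) :
    ∃ D, 0 ≤ D ∧ ∀ l, IsCopy (1 - c) c k l → ∀ U ∈ l, ∀ U' ∈ l, ∀ x ∈ hatTile c,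
      ∀ x' ∈ hatTile c, dist (U x) (U' x') ≤ D := by
  obtain ⟨r, hr⟩ := (isDisc_hatTile hc).compact.isBounded.exists_norm_le
  obtain ⟨R, hR, hb⟩ := exists_bound ((frames (1 - c) c k).1 ++ (frames (1 - c) c k).2)
    fun U => ‖U 0‖
  have key : ∀ U ∈ (frames (1 - c) c k).1 ++ (frames (1 - c) c k).2, ∀ x ∈ hatTile c,
      dist (U x) 0 ≤ r + R := by
    intro U hU x hx
    refine (dist_triangle _ (U 0) _).trans (add_le_add ?_ ?_)
    · rw [U.isometry.dist_eq, dist_zero_right]; exact hr x hx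
    · rw [dist_zero_right]; exact hb U hU
  obtain ⟨x₀, hx₀⟩ := (isDisc_hatTile hc).nonempty
  have hr0 : 0 ≤ r := (norm_nonneg _).trans (hr x₀ hx₀.1)
  refine ⟨2 * (r + R), by positivity, ?_⟩
  rintro l ⟨V, h⟩ U hU U' hU' x hx x' hx'
  have hmem : ∀ U ∈ l, ∃ W ∈ (frames (1 - c) c k).1 ++ (frames (1 - c) c k).2,
      U = W.trans V := by
    intro U hU
    rcases h with rfl | rfl
    · obtain ⟨W, hW, rfl⟩ := List.mem_map.1 hU
      exact ⟨W, List.mem_append_left _ hW, rfl⟩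
    · obtain ⟨W, hW, rfl⟩ := List.mem_map.1 hU
      exact ⟨W, List.mem_append_right _ hW, rfl⟩
  obtain ⟨W, hW, rfl⟩ := hmem U hU
  obtain ⟨W', hW', rfl⟩ := hmem U' hU'
  rw [IsometryEquiv.trans_apply, IsometryEquiv.trans_apply, V.isometry.dist_eq]
  refine (dist_triangle_right _ _ 0).trans ?_
  linarith [key W hW x hx, key W' hW' x' hx']

/-- The tiles of a supertile do not overlap. -/
theorem pairwise_frames (hc : c ∈ Set.Icc (0 : ℝ) 1) (k : ℕ) :
    (frames (1 - c) c k).1.Pairwise fun U W : ℂ ≃ᵢ ℂ =>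
      Disjoint (U '' hatInterior c) (W '' hatInterior c) := by
  have hd := isDisc_hatTile hc
  have hsub : hatInterior c ⊆ hatTile c := Set.sdiff_subset
  rw [List.pairwise_iff_forall_sublist]
  intro U W hUW
  rw [Set.disjoint_iff_inter_eq_empty, ← Set.not_nonempty_iff_eq_empty]
  intro hne
  -- D bounds the diameter of every copy of a supertile of level k + 1; the level n is then chosen
  -- so large that the good disc has radius above D.
  obtain ⟨D, hD, hdiam⟩ := exists_diam_bound hc (k + 1)
  obtain ⟨n, hn, hnk, hnD⟩ := ((eventually_coverCount_eq_one hc).and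
    ((Filter.eventually_ge_atTop (k + 1)).and (eventually_le_levelScale (a := 1 - c) (b := c)
      (by linarith [hc.2]) hc.1 (by linarith) 0 D))).exists
  rw [zero_mul, zero_add] at hnD
  obtain ⟨m, rfl⟩ := Nat.exists_eq_add_of_le hnk
  set g := levelScale (1 - c) c (k + 1 + m)
  -- In the disc shrunk by D, the supertile of level k + 1 around the tile at p stays inside the
  -- good disc.
  obtain ⟨p, hp, hgen⟩ := exists_generic hc (frames (1 - c) c (k + 1 + m)).1
    (Metric.isOpen_ball (x := g * discCenter) (ε := ‖g‖ / 10 - D))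
    (Metric.nonempty_ball.2 (by linarith))
  rw [Metric.mem_ball, dist_eq_norm] at hp
  have h1 := hn p (by linarith) hgen
  obtain ⟨X, hX, hXp⟩ := List.countP_pos_iff.1 (by rw [← coverCount, h1]; exact one_pos)
  have hXp := of_decide_eq_true hXp
  obtain ⟨l, hl, hXl, hs⟩ := (exists_isCopy (k + 1) m).1 X hX
  obtain ⟨V, hV⟩ := hl.exists_sublist
  have hUWl := (hUW.map fun U => U.trans V).trans hV
  -- An overlap of two tiles is transported into the good disc. As it is open, it contains a generic
  -- point.
  have hopen : IsOpen (V '' (U '' hatInterior c ∩ W '' hatInterior c)) :=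
    V.toHomeomorph.isOpenMap _ ((U.toHomeomorph.isOpenMap _ hd.isOpen).inter
      (W.toHomeomorph.isOpenMap _ hd.isOpen))
  obtain ⟨q, hq, hqg⟩ := exists_generic hc (frames (1 - c) c (k + 1 + m)).1 hopen
    (hne.image V)
  obtain ⟨-, ⟨⟨x, hx, rfl⟩, ⟨y, hy, hxy⟩⟩, rfl⟩ := hq
  have hUl : U.trans V ∈ l := hUWl.subset (by simp)
  have h2 := hn (V (U x)) (by
    have h3 := hdiam l hl _ hUl X hXl x (hsub hx) (X.symm p) (hsub hXp)
    rw [IsometryEquiv.trans_apply, X.apply_symm_apply] at h3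
    rw [← dist_eq_norm] at hp ⊢
    linarith [dist_triangle (V (U x)) p (g * discCenter)]) hqg
  -- The pair of overlapping tiles is a sublist of the large supertile, so the covering number at
  -- this point is at least 2.
  have h3 := ((hUWl.trans hs).countP_le (p := fun Y : ℂ ≃ᵢ ℂ =>
    decide (Y.symm (V (U x)) ∈ hatInterior c)))
  rw [← coverCount, ← coverCount, h2, coverCount] at h3
  have e1 : (U.trans V).symm (V (U x)) = x := by
    rw [IsometryEquiv.symm_apply_eq]; rfl
  have e2 : (W.trans V).symm (V (U x)) = y := by
    rw [IsometryEquiv.symm_apply_eq, ← hxy]; rfl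
  simp [e1, e2, hx, hy] at h3

/-- The tiles of large supertiles cover large discs. -/
theorem eventually_covers (hc : c ∈ Set.Icc (0 : ℝ) 1) :
    ∀ᶠ n : ℕ in Filter.atTop,
      Metric.ball (levelScale (1 - c) c n * discCenter) (‖levelScale (1 - c) c n‖ / 10) ⊆
        ⋃ U ∈ (frames (1 - c) c n).1, U '' hatTile c := by
  have hd := isDisc_hatTile hc
  filter_upwards [eventually_coverCount_eq_one hc] with n hn
  intro p hp
  by_contra hcon
  -- If p were uncovered, the uncovered part of the disc would be open and nonempty, and would
  -- contain a generic point, which is covered once.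
  have hclosed : IsClosed (⋃ U ∈ (frames (1 - c) c n).1, U '' hatTile c) := by
    refine Set.Finite.isClosed_biUnion (List.finite_toSet _) fun U _ => ?_
    exact (hd.compact.image U.continuous).isClosed
  obtain ⟨q, hq, hg⟩ := exists_generic hc (frames (1 - c) c n).1
    (Metric.isOpen_ball.inter hclosed.isOpen_compl) ⟨p, hp, hcon⟩
  have h1 := hn q (by rw [← dist_eq_norm]; exact (Metric.mem_ball.1 hq.1).le) hg
  obtain ⟨X, hX, hXp⟩ := List.countP_pos_iff.1 (by rw [← coverCount, h1]; exact one_pos)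
  have hXp := of_decide_eq_true hXp
  refine hq.2 (Set.mem_biUnion hX ⟨_, hXp.1, X.apply_symm_apply q⟩)

end

/-! ### The explicit maps as rigid motions at unit scale -/

noncomputable section

open Complex

variable {a b c : ℝ} {n : ℕ}

/-! ### The maps of the system as motions at unit scale -/

/-- The place of a letter; the letter `8` repeats the letter `6`. -/
def letterPlace (i : Fin 8) : Fin 7 := ![0, 1, 2, 3, 4, 5, 6, 5] i

/-- The motion of the `i`-th map of the `n + 1`-st system. -/
def levelMove (a b : ℝ) (n : ℕ) (i : Fin 8) : ℂ ≃ᵢ ℂ :=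
  if n = 0 ∧ i = 7 then mirrorMove a b else hatMove a b n (letterPlace i)

theorem fibR_succ_two (n : ℕ) : fibR (2 * (n + 1)) = fibR (2 * n) + fibR (2 * n + 1) := by
  simp only [fibR]
  rw [show 2 * (n + 1) = 2 * n + 2 by ring, Nat.fib_add_two]; push_cast; ring

theorem fibR_succ_three (n : ℕ) : fibR (2 * (n + 1) + 1) = fibR (2 * n) + 2 * fibR (2 * n + 1) := by
  simp only [fibR]
  rw [show 2 * (n + 1) + 1 = 2 * n + 1 + 2 by ring, Nat.fib_add_two,
    show 2 * n + 1 + 1 = 2 * n + 2 by ring, Nat.fib_add_two]; push_cast; ring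

theorem scales_succ (n : ℕ) : scales a b (n + 1) =
    ((scales a b n).1 + (scales a b n).2, (scales a b n).1 + 2 * (scales a b n).2) := rfl

/-- The recursion of the scales is the square of the Fibonacci recursion; this is the origin of the
Fibonacci coefficients in the maps. -/
theorem scales_eq_fib (n : ℕ) : scales a b n =
    ((fibR (2 * n + 1) - fibR (2 * n)) * (scales a b 0).1 + fibR (2 * n) * (scales a b 0).2,
      fibR (2 * n) * (scales a b 0).1 + fibR (2 * n + 1) * (scales a b 0).2) := by
  induction n with
  | zero => simp [fibR]
  | succ n ih =>
    rw [scales_succ, ih, fibR_succ_two, fibR_succ_three]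
    ext <;> push_cast <;> ring

theorem exp_eq_hexRoot_zpow (m : ℤ) :
    Complex.exp (I * ((m : ℂ) * (Real.pi : ℂ) / 3)) = hexRoot ^ m := by
  rw [hexRoot_eq_exp, ← Complex.exp_int_mul]
  congr 1
  ring

theorem hexRoot_zpow_sub (m : ℤ) (r : ℕ) (h : m + 6 = r) : hexRoot ^ m = hexRoot ^ r := by
  rw [← zpow_natCast, ← h, zpow_add₀ hexRoot_ne_zero]
  have : hexRoot ^ (6 : ℤ) = 1 := by exact_mod_cast hexRoot_pow_six
  rw [this, mul_one]

theorem hatAffine_scaled (φ : ℂ) (hφ : φ = hatRatio) (n : ℕ) (m : ℤ) (r : ℕ) (A B : ℝ) (S : Pos)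
    (hr : hexRoot ^ m = hexRoot ^ r) (hS : S.ev a b n = (A : ℂ) + I * B) (z : ℂ) :
    hatAffine (n + 1) m A B (φ ^ n * z) = φ ^ (n + 1) * frame a b n r S z := by
  rw [hatAffine, exp_eq_hexRoot_zpow, hr, frame_apply, hS, hφ]
  ring

theorem fibR_succ_four (n : ℕ) :
    fibR (2 * (n + 1) + 2) = 2 * fibR (2 * n) + 3 * fibR (2 * n + 1) := by
  have h1 := fibR_succ_two n
  have h2 := fibR_succ_three n
  have : fibR (2 * (n + 1) + 2) = fibR (2 * (n + 1)) + fibR (2 * (n + 1) + 1) := by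
    simp only [fibR]
    rw [Nat.fib_add_two]; push_cast; ring
  rw [this, h1, h2]; ring

theorem hatSix_scaled (n : ℕ) (z : ℂ) : hatSix c (n + 1) ((hatRatio : ℂ) ^ n * z) =
    (hatRatio : ℂ) ^ (n + 1) * hatMove (1 - c) c n 5 z := by
  have h3 : Real.sqrt 3 ^ 2 = 3 := Real.sq_sqrt (by norm_num)
  refine hatAffine_scaled _ rfl n 0 0 _ _ _ (by simp) ?_ z
  rw [fibR_succ_two, show 2 * (n + 1) - 2 = 2 * n by omega,
    show 2 * (n + 1) - 1 = 2 * n + 1 by omega, Pos.ev, scales_eq_fib]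
  apply Complex.ext <;> simp [motion, eis, scales, hexRoot, edgeUnit] <;> ring_nf <;>
    (try rw [h3]) <;> ring

/-- The bridge between the given formulas and the lattice: for each letter the translation part is
matched with the formal position in `motion`. The letter `8` is a reflection at the lowest level and
repeats `6` afterwards. -/
theorem hatSIFS_scaled (n : ℕ) (i : Fin 8) (z : ℂ) :
    hatSIFS c (n + 1) i ((hatRatio : ℂ) ^ n * z) =
      (hatRatio : ℂ) ^ (n + 1) * levelMove (1 - c) c n i z := by
  have h3 : Real.sqrt 3 ^ 2 = 3 := Real.sq_sqrt (by norm_num)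
  have e1 : 2 * (n + 1) - 2 = 2 * n := by omega
  have e2 : 2 * (n + 1) - 1 = 2 * n + 1 := by omega
  fin_cases i
  · have h : levelMove (1 - c) c n 0 = hatMove (1 - c) c n 0 := by simp [levelMove, letterPlace]
    change (hatRatio : ℂ) * ((hatRatio : ℂ) ^ n * z) =
      (hatRatio : ℂ) ^ (n + 1) * levelMove (1 - c) c n 0 z
    rw [h, hatMove, frame_apply]
    simp [motion, Pos.ev, eis]
    ring
  · have h : levelMove (1 - c) c n 1 = hatMove (1 - c) c n 1 := by simp [levelMove, letterPlace]
    change hatAffine _ _ _ _ _ = (hatRatio : ℂ) ^ (n + 1) * levelMove (1 - c) c n 1 z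
    rw [h]
    refine hatAffine_scaled _ rfl n (-1) 5 _ _ _ (hexRoot_zpow_sub _ _ (by norm_num)) ?_ z
    rw [fibR_succ_four, fibR_succ_three, e2, Pos.ev, scales_eq_fib]
    apply Complex.ext <;> simp [motion, eis, scales, hexRoot, edgeUnit] <;> ring_nf <;>
      (try rw [h3]) <;> ring
  · have h : levelMove (1 - c) c n 2 = hatMove (1 - c) c n 2 := by simp [levelMove, letterPlace]
    change hatAffine _ _ _ _ _ = (hatRatio : ℂ) ^ (n + 1) * levelMove (1 - c) c n 2 z
    rw [h]
    refine hatAffine_scaled _ rfl n (-2) 4 _ _ _ (hexRoot_zpow_sub _ _ (by norm_num)) ?_ z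
    rw [fibR_succ_three, e1, e2, Pos.ev, scales_eq_fib]
    apply Complex.ext <;> simp [motion, eis, scales, hexRoot, edgeUnit] <;> ring_nf <;>
      (try rw [h3]) <;> ring
  · have h : levelMove (1 - c) c n 3 = hatMove (1 - c) c n 3 := by simp [levelMove, letterPlace]
    change hatAffine _ _ _ _ _ = (hatRatio : ℂ) ^ (n + 1) * levelMove (1 - c) c n 3 z
    rw [h]
    refine hatAffine_scaled _ rfl n 2 2 _ _ _ (by norm_cast) ?_ z
    rw [fibR_succ_four, fibR_succ_three, e2, Pos.ev, scales_eq_fib]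
    apply Complex.ext <;> simp [motion, eis, scales, hexRoot, edgeUnit] <;> ring_nf <;>
      (try rw [h3]) <;> ring
  · have h : levelMove (1 - c) c n 4 = hatMove (1 - c) c n 4 := by simp [levelMove, letterPlace]
    change hatAffine _ _ _ _ _ = (hatRatio : ℂ) ^ (n + 1) * levelMove (1 - c) c n 4 z
    rw [h]
    refine hatAffine_scaled _ rfl n 1 1 _ _ _ (by norm_cast) ?_ z
    rw [fibR_succ_three, fibR_succ_two, e2, Pos.ev, scales_eq_fib]
    apply Complex.ext <;> simp [motion, eis, scales, hexRoot, edgeUnit] <;> ring_nf <;>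
      (try rw [h3]) <;> ring
  · have h : levelMove (1 - c) c n 5 = hatMove (1 - c) c n 5 := by simp [levelMove, letterPlace]
    change hatSix c (n + 1) _ = (hatRatio : ℂ) ^ (n + 1) * levelMove (1 - c) c n 5 z
    rw [h, hatSix_scaled]
  · have h : levelMove (1 - c) c n 6 = hatMove (1 - c) c n 6 := by simp [levelMove, letterPlace]
    change hatAffine _ _ _ _ _ = (hatRatio : ℂ) ^ (n + 1) * levelMove (1 - c) c n 6 z
    rw [h]
    refine hatAffine_scaled _ rfl n 0 0 _ _ _ (by simp) ?_ z
    rw [fibR_succ_three, fibR_succ_two, e2, Pos.ev, scales_eq_fib]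
    apply Complex.ext <;> simp [motion, eis, scales, hexRoot, edgeUnit] <;> ring_nf <;>
      (try rw [h3]) <;> ring
  · change (if n + 1 = 1 then _ else hatSix c (n + 1) : ℂ → ℂ) _ =
      (hatRatio : ℂ) ^ (n + 1) * levelMove (1 - c) c n 7 z
    by_cases hn : n = 0
    · subst hn
      have h : levelMove (1 - c) c 0 7 = mirrorMove (1 - c) c := by simp [levelMove]
      rw [if_pos rfl, h, mirrorMove_apply]
      have hev : mirrorPos.ev (1 - c) c 0 =
          ((2 * Real.sqrt 3 * (1 - c) + 6 * c : ℝ) : ℂ) +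
            I * ((4 * Real.sqrt 3 * c : ℝ) : ℂ) := by
        rw [Pos.ev]
        apply Complex.ext <;> simp [mirrorPos, eis, scales, hexRoot, edgeUnit] <;> ring_nf <;>
          (try rw [h3]) <;> ring
      rw [hev, pow_zero, one_mul]
      ring
    · have h : levelMove (1 - c) c n 7 = hatMove (1 - c) c n 5 := by
        simp [levelMove, letterPlace, hn]
      rw [if_neg (by omega), h, hatSix_scaled]

end

/-! ### Words, processed tiles and supertiles -/

noncomputable section

open Complex

variable {a b c : ℝ} {n k : ℕ}

/-! ### Tiles of words -/

theorem hatRatio_pos : 0 < hatRatio := inv_pos.2 (pow_pos Real.goldenRatio_pos 2)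

theorem hatRatio_lt_one : hatRatio < 1 :=
  inv_lt_one_of_one_lt₀ (by linarith [goldenRatio_sq_bound])

theorem hatRatio_ne_zero : (hatRatio : ℂ) ≠ 0 := by exact_mod_cast hatRatio_pos.ne'

theorem hatSIFS_eq (n : ℕ) (i : Fin 8) (z : ℂ) : hatSIFS c (n + 1) i z =
    (hatRatio : ℂ) ^ (n + 1) * levelMove (1 - c) c n i (((hatRatio : ℂ) ^ n)⁻¹ * z) := by
  rw [← hatSIFS_scaled, mul_inv_cancel_left₀ (pow_ne_zero n hatRatio_ne_zero)]

/-- The motion of the tile of a word, at unit scale. -/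
def wordMove (a b : ℝ) : (k : ℕ) → (Fin (k + 1) → Fin 8) → ℂ ≃ᵢ ℂ
  | 0, w => levelMove a b 0 (w 0)
  | k + 1, w => (wordMove a b k fun l => w l.succ).trans (levelMove a b (k + 1) (w 0))

theorem wordMap_eq : ∀ (k : ℕ) (w : Fin (k + 1) → Fin 8) (z : ℂ),
    wordMap (hatSIFS c) (k + 1) w z = (hatRatio : ℂ) ^ (k + 1) * wordMove (1 - c) c k w z
  | 0, w, z => by
    have := hatSIFS_scaled (c := c) 0 (w 0) z
    rw [pow_zero, one_mul] at this
    exact this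
  | k + 1, w, z => by
    change hatSIFS c (k + 2) (w 0) (wordMap (hatSIFS c) (k + 1) (fun l => w l.succ) z) = _
    rw [wordMap_eq k, hatSIFS_scaled]
    rfl

/-- The map of a word as a homeomorphism. -/
def wordHomeo (c : ℝ) (w : Fin (k + 1) → Fin 8) : ℂ ≃ₜ ℂ :=
  (wordMove (1 - c) c k w).toHomeomorph.trans
    (Homeomorph.mulLeft₀ ((hatRatio : ℂ) ^ (k + 1)) (pow_ne_zero _ hatRatio_ne_zero))

theorem wordHomeo_apply (w : Fin (k + 1) → Fin 8) (z : ℂ) :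
    wordHomeo c w z = wordMap (hatSIFS c) (k + 1) w z := by
  rw [wordMap_eq]; rfl

theorem tileAt_eq (w : Fin (k + 1) → Fin 8) :
    tileAt (hatSIFS c) (fun _ => hatTile c) w = wordHomeo c w '' hatTile c := by
  rw [tileAt]
  exact Set.image_congr fun z _ => (wordHomeo_apply w z).symm

/-- The words that do not contain `71` and contain the letter `8` at most at the end. -/
def Admissible (w : Fin (k + 1) → Fin 8) : Prop :=
  Avoids71 w ∧ ∀ l : Fin k, w l.castSucc ≠ 7

theorem Admissible.tail {w : Fin (k + 2) → Fin 8} (h : Admissible w) :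
    Admissible fun l => w l.succ :=
  ⟨fun l => h.1 l.succ, fun l => h.2 l.succ⟩

theorem admissible_iff {w : Fin (k + 2) → Fin 8} : Admissible w ↔
    w 0 ≠ 7 ∧ ¬ (w 0 = 6 ∧ w 1 = 0) ∧ Admissible fun l => w l.succ := by
  constructor
  · exact fun h => ⟨h.2 0, h.1 0, h.tail⟩
  · rintro ⟨h1, h2, h3⟩
    refine ⟨fun l => ?_, fun l => ?_⟩
    · refine Fin.cases ?_ (fun l => ?_) l
      · exact h2
      · exact h3.1 l
    · refine Fin.cases ?_ (fun l => ?_) l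
      · exact h1
      · exact h3.2 l

/-- The part of a supertile in the place of a letter. -/
def block (a b : ℝ) (k : ℕ) (i : Fin 7) : List (ℂ ≃ᵢ ℂ) :=
  (if i = 6 then (frames a b k).2 else (frames a b k).1).map
    fun U => U.trans (hatMove a b (k + 1) i)

theorem frames_succ_eq (k : ℕ) : (frames a b (k + 1)).1 =
    [0, 1, 2, 3, 4, 5, 6].flatMap (block a b k) ∧
    (frames a b (k + 1)).2 = [1, 2, 3, 4, 5, 6].flatMap (block a b k) := by
  simp [frames, nextFrames, block]

theorem frames_zero_eq : (frames a b 0).1 =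
    [0, 1, 2, 3, 4, 5, 6, 7].map (levelMove a b 0) ∧
    (frames a b 0).2 = [1, 2, 3, 4, 5, 6, 7].map (levelMove a b 0) := by
  simp [frames, baseFrames, levelMove, letterPlace]

theorem levelMove_of_ne (n : ℕ) {i : Fin 8} (hi : i ≠ 7) :
    levelMove a b n i = hatMove a b n (letterPlace i) := by
  rw [levelMove, if_neg fun h => hi h.2]

theorem wordMove_mem_block {w : Fin (k + 2) → Fin 8} (h : Admissible w)
    (h1 : wordMove a b k (fun l => w l.succ) ∈ (frames a b k).1)
    (h2 : w 1 ≠ 0 → wordMove a b k (fun l => w l.succ) ∈ (frames a b k).2) :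
    wordMove a b (k + 1) w ∈ block a b k (letterPlace (w 0)) := by
  have h7 : w 0 ≠ 7 := h.2 0
  rw [wordMove, levelMove_of_ne _ h7, block]
  refine List.mem_map_of_mem ?_
  have key : ∀ i : Fin 8, i ≠ 7 → letterPlace i = 6 → i = 6 := by decide
  split_ifs with h6
  · exact h2 fun h0 => h.1 0 ⟨key _ h7 h6, h0⟩
  · exact h1

theorem wordMove_mem_frames : ∀ (k : ℕ) (w : Fin (k + 1) → Fin 8), Admissible w →
    wordMove a b k w ∈ (frames a b k).1 ∧ (w 0 ≠ 0 → wordMove a b k w ∈ (frames a b k).2)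
  | 0, w, _ => by
    rw [frames_zero_eq.1, frames_zero_eq.2]
    have key : ∀ i : Fin 8, i ∈ [0, 1, 2, 3, 4, 5, 6, 7] ∧ (i ≠ 0 → i ∈ [1, 2, 3, 4, 5, 6, 7]) := by
      decide
    exact ⟨List.mem_map_of_mem (key (w 0)).1, fun h => List.mem_map_of_mem ((key (w 0)).2 h)⟩
  | k + 1, w, h => by
    obtain ⟨ih1, ih2⟩ := wordMove_mem_frames k (fun l => w l.succ) h.tail
    have hm := wordMove_mem_block h ih1 ih2
    have key : ∀ i : Fin 8, i ≠ 7 → letterPlace i ∈ [0, 1, 2, 3, 4, 5, 6] ∧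
        (i ≠ 0 → letterPlace i ∈ [1, 2, 3, 4, 5, 6]) := by decide
    rw [(frames_succ_eq k).1, (frames_succ_eq k).2]
    exact ⟨List.mem_flatMap.2 ⟨_, (key _ (h.2 0)).1, hm⟩,
      fun h0 => List.mem_flatMap.2 ⟨_, (key _ (h.2 0)).2 h0, hm⟩⟩

/-- Words with the same first letter are compared after removing it. Words with different first
letters lie in different parts of one supertile, where `pairwise_frames` applies. -/
theorem disjoint_wordMove (hc : c ∈ Set.Icc (0 : ℝ) 1) : ∀ (k : ℕ) (w v : Fin (k + 1) → Fin 8),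
    Admissible w → Admissible v → w ≠ v →
    Disjoint (wordMove (1 - c) c k w '' hatInterior c) (wordMove (1 - c) c k v '' hatInterior c)
  | 0, w, v, _, _, hwv => by
    have h := pairwise_frames hc 0
    rw [frames_zero_eq.1, List.pairwise_map] at h
    have hne : w 0 ≠ v 0 := fun h => hwv (funext fun i => by rwa [Fin.fin_one_eq_zero i])
    have key : ∀ i : Fin 8, i ∈ [0, 1, 2, 3, 4, 5, 6, 7] := by decide
    have : Std.Symm fun i j : Fin 8 => Disjoint (levelMove (1 - c) c 0 i '' hatInterior c)
        (levelMove (1 - c) c 0 j '' hatInterior c) := ⟨fun _ _ h => h.symm⟩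
    exact h.forall (key _) (key _) hne
  | k + 1, w, v, hw, hv, hwv => by
    by_cases h0 : w 0 = v 0
    · have ht : (fun l : Fin (k + 1) => w l.succ) ≠ fun l => v l.succ := by
        intro h
        refine hwv (funext fun i => Fin.cases h0 (fun l => congrFun h l) i)
      have ih := disjoint_wordMove hc k _ _ hw.tail hv.tail ht
      have e : ∀ w : Fin (k + 2) → Fin 8, wordMove (1 - c) c (k + 1) w '' hatInterior c =
          levelMove (1 - c) c (k + 1) (w 0) ''
            (wordMove (1 - c) c k (fun l => w l.succ) '' hatInterior c) := fun w => by
        rw [← Set.image_comp]; rfl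
      rw [e, e, h0]
      exact (Set.disjoint_image_iff (IsometryEquiv.injective _)).2 ih
    · have h := pairwise_frames hc (k + 1)
      rw [(frames_succ_eq k).1, List.pairwise_flatMap] at h
      have key : ∀ i : Fin 8, i ≠ 7 → letterPlace i ∈ [0, 1, 2, 3, 4, 5, 6] := by decide
      have inj : ∀ i j : Fin 8, i ≠ 7 → j ≠ 7 → i ≠ j → letterPlace i ≠ letterPlace j := by decide
      have hw1 := wordMove_mem_frames (a := 1 - c) (b := c) k (fun l => w l.succ) hw.tail
      have hv1 := wordMove_mem_frames (a := 1 - c) (b := c) k (fun l => v l.succ) hv.tail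
      have : Std.Symm fun i j : Fin 7 => ∀ U ∈ block (1 - c) c k i, ∀ W ∈ block (1 - c) c k j,
          Disjoint (U '' hatInterior c) (W '' hatInterior c) :=
        ⟨fun _ _ h U hU W hW => (h W hW U hU).symm⟩
      exact h.2.forall (key _ (hw.2 0)) (key _ (hv.2 0))
        (inj _ _ (hw.2 0) (hv.2 0) h0) _ (wordMove_mem_block hw hw1.1 hw1.2) _
        (wordMove_mem_block hv hv1.1 hv1.2)

/-! ### Words with the same map -/

/-- None of the three motions involved rotates, so the claim is an identity of translations: the
place 7 of level n and the place 6 of level n + 1 add up to the place 7 of level n + 1. -/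
theorem hatSIFS_comp (n : ℕ) :
    hatSIFS c (n + 2) 5 ∘ hatSIFS c (n + 1) 6 = hatSIFS c (n + 2) 6 ∘ hatSIFS c (n + 1) 0 := by
  funext z
  have hz : z = (hatRatio : ℂ) ^ n * (((hatRatio : ℂ) ^ n)⁻¹ * z) :=
    (mul_inv_cancel_left₀ (pow_ne_zero n hatRatio_ne_zero) z).symm
  rw [Function.comp_apply, Function.comp_apply, hz, hatSIFS_scaled, hatSIFS_scaled,
    hatSIFS_scaled, hatSIFS_scaled]
  congr 1
  simp only [levelMove_of_ne _ (show (5 : Fin 8) ≠ 7 by decide),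
    levelMove_of_ne _ (show (6 : Fin 8) ≠ 7 by decide),
    levelMove_of_ne _ (show (0 : Fin 8) ≠ 7 by decide), hatMove, frame_apply, ← Pos.ev_shift]
  simp [letterPlace, motion, Pos.shift, Pos.ev, eis]
  ring

theorem hatSIFS_seven (n : ℕ) : hatSIFS c (n + 2) 7 = hatSIFS c (n + 2) 5 := by
  have h (g : ℂ → ℂ) : (if n + 2 = 1 then g else hatSix c (n + 2)) = hatSix c (n + 2) :=
    if_neg (by omega)
  exact h fun z => (hatRatio : ℂ) * (starRingEnd ℂ) z + (hatRatio : ℂ) *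
    (((2 * Real.sqrt 3 * (1 - c) + 6 * c : ℝ) : ℂ) + I * ((4 * Real.sqrt 3 * c : ℝ) : ℂ))

theorem topGT_cons {M : ℕ} (i : Fin M) {u v : Fin k → Fin M} (h : TopGT u v) :
    TopGT (Fin.cons i u : Fin (k + 1) → Fin M) (Fin.cons i v) := by
  obtain ⟨m, h1, h2⟩ := h
  refine ⟨m.succ, fun l hl => ?_, by simpa using h2⟩
  induction l using Fin.cases with
  | zero => simp
  | succ l => simpa using h1 l (Fin.succ_lt_succ_iff.1 hl)

/-- Rewriting `71` to `67`, or an `8` above the lowest level to `6`, keeps the map and enlarges the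
word. -/
theorem exists_topGT_of_not_admissible : ∀ (k : ℕ) (w : Fin (k + 1) → Fin 8), ¬ Admissible w →
    ∃ v, TopGT v w ∧ wordMap (hatSIFS c) (k + 1) v = wordMap (hatSIFS c) (k + 1) w
  | 0, w, h => absurd ⟨fun l => l.elim0, fun l => l.elim0⟩ h
  | k + 1, w, h => by
    have hw : w = Fin.cons (w 0) fun l => w l.succ := (Fin.cons_self_tail w).symm
    by_cases ht : Admissible fun l => w l.succ
    · by_cases h7 : w 0 = 7
      · refine ⟨Fin.cons 5 fun l => w l.succ, ⟨0, fun l hl => absurd hl (Fin.not_lt_zero l), ?_⟩, ?_⟩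
        · rw [h7]; simp only [Fin.cons_zero]; decide
        · change hatSIFS c (k + 2) _ ∘ _ = hatSIFS c (k + 2) (w 0) ∘ _
          rw [h7, hatSIFS_seven]
          simp only [Fin.cons_zero, Fin.cons_succ]
      · have h6 : w 0 = 6 ∧ w 1 = 0 := by
          by_contra h6
          exact h (admissible_iff.2 ⟨h7, h6, ht⟩)
        refine ⟨Fin.cons 5 (Fin.cons 6 fun l => w l.succ.succ),
          ⟨0, fun l hl => absurd hl (Fin.not_lt_zero l), ?_⟩, ?_⟩
        · rw [h6.1]; simp only [Fin.cons_zero]; decide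
        · change hatSIFS c (k + 2) _ ∘ (hatSIFS c (k + 1) _ ∘ _) =
            hatSIFS c (k + 2) (w 0) ∘ (hatSIFS c (k + 1) (w 1) ∘ _)
          simp only [Fin.cons_zero, Fin.cons_succ]
          rw [h6.1, h6.2, ← Function.comp_assoc, ← Function.comp_assoc, hatSIFS_comp]
    · obtain ⟨v, hv, e⟩ := exists_topGT_of_not_admissible k _ ht
      refine ⟨Fin.cons (w 0) v, ?_, ?_⟩
      · rw [hw]
        simp only [Fin.cons_zero]
        exact topGT_cons _ hv
      · change hatSIFS c (k + 2) _ ∘ wordMap (hatSIFS c) (k + 1) _ =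
          hatSIFS c (k + 2) (w 0) ∘ wordMap (hatSIFS c) (k + 1) _
        simp only [Fin.cons_zero, Fin.cons_succ]
        rw [e]

/-- Among the finitely many words that are at least as large and have the same map, the largest
cannot be rewritten any more, so it is admissible. -/
theorem exists_admissible (w : Fin (k + 1) → Fin 8) :
    ∃ v, Admissible v ∧ (v = w ∨ TopGT v w) ∧
      wordMap (hatSIFS c) (k + 1) v = wordMap (hatSIFS c) (k + 1) w := by
  -- `TopGT u v` unfolds to `toLex u < toLex v`, so the largest word is a minimal element for the
  -- order of `Lex`.
  have hfin : Set.Finite {v : Lex (Fin (k + 1) → Fin 8) | v ≤ toLex w ∧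
      wordMap (hatSIFS c) (k + 1) (ofLex v) = wordMap (hatSIFS c) (k + 1) w} := Set.toFinite _
  obtain ⟨v, hv⟩ := hfin.exists_minimal ⟨toLex w, le_rfl, rfl⟩
  refine ⟨ofLex v, ?_, ?_, hv.1.2⟩
  · by_contra hcon
    obtain ⟨u, hu, e⟩ := exists_topGT_of_not_admissible (c := c) k _ hcon
    have hlt : toLex u < v := hu
    exact hlt.not_ge (hv.2 ⟨hlt.le.trans hv.1.1, e.trans hv.1.2⟩ hlt.le)
  · rcases hv.1.1.eq_or_lt with h | h
    · left; rw [h]; rfl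
    · exact Or.inr h

/-! ### Processed tiles -/

theorem topGT_trans {u v w : Fin (k + 1) → Fin 8} (h : TopGT u v) (h' : TopGT v w) :
    TopGT u w := by
  have h1 : toLex u < toLex v := h
  have h2 : toLex v < toLex w := h'
  exact h1.trans h2

theorem not_topGT_self {u : Fin (k + 1) → Fin 8} : ¬ TopGT u u := by
  rintro ⟨m, -, h⟩
  exact lt_irrefl _ h

theorem tileAt_congr {w v : Fin (k + 1) → Fin 8}
    (h : wordMap (hatSIFS c) (k + 1) v = wordMap (hatSIFS c) (k + 1) w) :
    tileAt (hatSIFS c) (fun _ => hatTile c) v = tileAt (hatSIFS c) (fun _ => hatTile c) w := by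
  rw [tileAt, tileAt, h]

theorem processedTile_of_not_admissible {w : Fin (k + 1) → Fin 8} (h : ¬ Admissible w) :
    processedTile (hatSIFS c) (fun _ => hatTile c) w = ∅ := by
  obtain ⟨v, hv, e⟩ := exists_topGT_of_not_admissible (c := c) k w h
  rw [processedTile, closure_empty_iff, Set.sdiff_eq_empty, ← tileAt_congr e]
  exact Set.subset_biUnion_of_mem (u := fun v => tileAt (hatSIFS c) (fun _ => hatTile c) v)
    (show v ∈ {v | TopGT v w} from hv)

theorem disjoint_tiles (hc : c ∈ Set.Icc (0 : ℝ) 1) {w v : Fin (k + 1) → Fin 8}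
    (hw : Admissible w) (hv : Admissible v) (hwv : w ≠ v) :
    Disjoint (wordHomeo c w '' hatInterior c)
      (tileAt (hatSIFS c) (fun _ => hatTile c) v) := by
  have hd := isDisc_hatTile hc
  have h := disjoint_wordMove hc k w v hw hv hwv
  have e : ∀ w : Fin (k + 1) → Fin 8, wordHomeo c w '' hatInterior c =
      (Homeomorph.mulLeft₀ ((hatRatio : ℂ) ^ (k + 1)) (pow_ne_zero _ hatRatio_ne_zero)) ''
        (wordMove (1 - c) c k w '' hatInterior c) := fun w => by
    rw [← Set.image_comp]; rfl
  have h' : Disjoint (wordHomeo c w '' hatInterior c) (wordHomeo c v '' hatInterior c) := by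
    rw [e, e]
    exact (Set.disjoint_image_iff (Homeomorph.injective _)).2 h
  rw [tileAt_eq, ← hd.closure_eq, (wordHomeo c v).image_closure]
  exact h'.closure_right ((wordHomeo c w).isOpenMap _ hd.isOpen)

/-- The tile of any larger word is also the tile of an admissible word that is larger still, hence
different from w. It misses the interior of the tile of w, and that interior is dense in the tile.
-/
theorem processedTile_of_admissible (hc : c ∈ Set.Icc (0 : ℝ) 1) {w : Fin (k + 1) → Fin 8}
    (h : Admissible w) : processedTile (hatSIFS c) (fun _ => hatTile c) w =
      tileAt (hatSIFS c) (fun _ => hatTile c) w := by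
  have hd := isDisc_hatTile hc
  have hcl : closure (wordHomeo c w '' hatInterior c) =
      tileAt (hatSIFS c) (fun _ => hatTile c) w := by
    rw [tileAt_eq, ← hd.closure_eq, (wordHomeo c w).image_closure]
  apply Set.Subset.antisymm
  · refine closure_minimal Set.sdiff_subset ?_
    rw [← hcl]
    exact isClosed_closure
  · conv_lhs => rw [← hcl]
    refine closure_mono fun x hx => ⟨hcl ▸ subset_closure hx, fun hx' => ?_⟩
    simp only [Set.mem_iUnion] at hx'
    obtain ⟨v, hv, hxv⟩ := hx'
    obtain ⟨u, hu, huv, e⟩ := exists_admissible (c := c) v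
    rw [← tileAt_congr e] at hxv
    have huw : TopGT u w := by
      rcases huv with rfl | huv
      · exact hv
      · exact topGT_trans huv hv
    have hne : w ≠ u := by
      rintro rfl
      exact not_topGT_self huw
    exact Set.disjoint_left.1 (disjoint_tiles hc h hu hne) hx hxv

theorem isCopyOf_tileAt (w : Fin (k + 1) → Fin 8) :
    IsCopyOf (hatRatio ^ (k + 1)) {hatTile c} (tileAt (hatSIFS c) (fun _ => hatTile c) w) := by
  have hr : hatRatio ^ (k + 1) ≠ 0 := (pow_pos hatRatio_pos _).ne'
  have hr' : ((hatRatio ^ (k + 1) : ℝ) : ℂ) ≠ 0 := by exact_mod_cast hr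
  let m := Homeomorph.mulLeft₀ ((hatRatio ^ (k + 1) : ℝ) : ℂ) hr'
  have hm : ∀ z, m z = ((hatRatio ^ (k + 1) : ℝ) : ℂ) * z := fun _ => rfl
  have hm' : ∀ z, m.symm z = ((hatRatio ^ (k + 1) : ℝ) : ℂ)⁻¹ * z := fun _ => rfl
  -- The motion of the word conjugated by the homothety: a similarity equals a homothety followed by
  -- this isometry.
  let e : ℂ ≃ ℂ := m.symm.toEquiv.trans ((wordMove (1 - c) c k w).toEquiv.trans m.toEquiv)
  have he : ∀ z, e z = m (wordMove (1 - c) c k w (m.symm z)) := fun _ => rfl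
  have hiso : Isometry e := by
    refine Isometry.of_dist_eq fun x y => ?_
    have hn : 0 < ‖((hatRatio ^ (k + 1) : ℝ) : ℂ)‖ := norm_pos_iff.2 hr'
    rw [he, he, hm, hm, dist_eq_norm, ← mul_sub, norm_mul, ← dist_eq_norm,
      (wordMove (1 - c) c k w).isometry.dist_eq, hm', hm', dist_eq_norm, ← mul_sub, norm_mul,
      norm_inv, mul_inv_cancel_left₀ hn.ne', dist_eq_norm]
  refine ⟨hatTile c, rfl, ⟨e, hiso⟩, ?_⟩
  rw [tileAt]
  refine Set.image_congr fun z _ => ?_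
  change _ = m (wordMove (1 - c) c k w (m.symm ((hatRatio ^ (k + 1)) • z)))
  rw [wordMap_eq, hm', Complex.real_smul, inv_mul_cancel_left₀ hr', hm]
  push_cast
  rfl

theorem not_isCopyOf_empty (hc : c ∈ Set.Icc (0 : ℝ) 1) (r : ℝ) :
    ¬ IsCopyOf r {hatTile c} (∅ : Set ℂ) := by
  rintro ⟨t, rfl, g, h⟩
  obtain ⟨x, hx⟩ := (isDisc_hatTile hc).nonempty
  exact (h ▸ (⟨x, hx.1, rfl⟩ : g (r • x) ∈ (fun x => g (r • x)) '' hatTile c) :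
    g (r • x) ∈ (∅ : Set ℂ))

theorem tileAddresses_eq (hc : c ∈ Set.Icc (0 : ℝ) 1) (k : ℕ) :
    tileAddresses hatRatio (hatSIFS c) {hatTile c} (fun _ => hatTile c) k =
      {w | Admissible w} := by
  ext w
  rw [tileAddresses, Set.mem_ofPred_eq, Set.mem_ofPred_eq]
  constructor
  · intro h
    by_contra hw
    rw [processedTile_of_not_admissible hw] at h
    exact not_isCopyOf_empty hc _ h
  · intro h
    rw [processedTile_of_admissible hc h]
    exact isCopyOf_tileAt w

theorem firstCondition (hc : c ∈ Set.Icc (0 : ℝ) 1) :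
    FirstCondition hatRatio (hatSIFS c) {hatTile c} (fun _ => hatTile c) := by
  intro k w
  by_cases h : Admissible w
  · right
    rw [processedTile_of_admissible hc h]
    exact isCopyOf_tileAt w
  · exact Or.inl (processedTile_of_not_admissible h)

/-! ### Supertiles -/

/-- The tiles of a set of words. -/
def tilesOf (c : ℝ) (P : (Fin (k + 1) → Fin 8) → Prop) : Set (Set ℂ) :=
  {s | ∃ w, P w ∧ s = tileAt (hatSIFS c) (fun _ => hatTile c) w}

theorem mapCollection_tilesOf (i : Fin 8) (P : (Fin (k + 1) → Fin 8) → Prop) :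
    mapCollection (hatSIFS c (k + 2) i) (tilesOf c P) =
      tilesOf c fun w : Fin (k + 2) → Fin 8 => w 0 = i ∧ P fun l => w l.succ := by
  have e : ∀ w : Fin (k + 2) → Fin 8, tileAt (hatSIFS c) (fun _ => hatTile c) w =
      hatSIFS c (k + 2) (w 0) '' tileAt (hatSIFS c) (fun _ => hatTile c) fun l => w l.succ :=
    fun w => Set.image_comp _ _ _
  ext s
  constructor
  · rintro ⟨_, ⟨w, hw, rfl⟩, rfl⟩
    refine ⟨Fin.cons i w, ⟨rfl, by simpa using hw⟩, ?_⟩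
    rw [e]
    simp
  · rintro ⟨w, ⟨rfl, hw⟩, rfl⟩
    exact ⟨_, ⟨_, hw, rfl⟩, (e w).symm⟩

/-- Avoiding `71` is the substitution in terms of words: the part in place 7 has no tile with first
letter 1, which is what distinguishes H₇ from H₈. -/
theorem hatSupertiles_eq : ∀ k : ℕ, (hatSupertiles c k).1 = tilesOf c (k := k) Admissible ∧
    (hatSupertiles c k).2 = tilesOf c (k := k) fun w => Admissible w ∧ w 0 ≠ 0
  | 0 => by
    have e : ∀ w : Fin 1 → Fin 8, tileAt (hatSIFS c) (fun _ => hatTile c) w =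
        hatSIFS c 1 (w 0) '' hatTile c := fun w => rfl
    have hadm : ∀ w : Fin 1 → Fin 8, Admissible w := fun w =>
      ⟨fun l => l.elim0, fun l => l.elim0⟩
    have h2 : (hatSupertiles c 0).2 = tilesOf c (k := 0) fun w => Admissible w ∧ w 0 ≠ 0 := by
      ext s
      constructor
      · rintro ⟨i, hi, rfl⟩
        exact ⟨fun _ => i, ⟨hadm _, hi⟩, rfl⟩
      · rintro ⟨w, ⟨-, hw⟩, rfl⟩
        exact ⟨w 0, hw, rfl⟩
    refine ⟨?_, h2⟩
    change {hatSIFS c 1 0 '' hatTile c} ∪ (hatSupertiles c 0).2 = _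
    rw [h2]
    ext s
    constructor
    · rintro (rfl | ⟨w, hw, rfl⟩)
      · exact ⟨fun _ => 0, hadm _, rfl⟩
      · exact ⟨w, hadm _, rfl⟩
    · rintro ⟨w, -, rfl⟩
      by_cases hw : w 0 = 0
      · left; rw [e, hw]; rfl
      · exact Or.inr ⟨w, ⟨hadm _, hw⟩, rfl⟩
  | k + 1 => by
    obtain ⟨ih1, ih2⟩ := hatSupertiles_eq k
    have h2 : (hatSupertiles c (k + 1)).2 =
        tilesOf c (k := k + 1) fun w => Admissible w ∧ w 0 ≠ 0 := by
      change mapCollection (hatSIFS c (k + 2) 1) (hatSupertiles c k).1 ∪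
        mapCollection (hatSIFS c (k + 2) 2) (hatSupertiles c k).1 ∪
        mapCollection (hatSIFS c (k + 2) 3) (hatSupertiles c k).1 ∪
        mapCollection (hatSIFS c (k + 2) 4) (hatSupertiles c k).1 ∪
        mapCollection (hatSIFS c (k + 2) 5) (hatSupertiles c k).1 ∪
        mapCollection (hatSIFS c (k + 2) 6) (hatSupertiles c k).2 = _
      simp only [ih1, ih2, mapCollection_tilesOf]
      ext s
      constructor
      · rintro (((((⟨w, ⟨h0, hw⟩, rfl⟩ | ⟨w, ⟨h0, hw⟩, rfl⟩) | ⟨w, ⟨h0, hw⟩, rfl⟩) |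
          ⟨w, ⟨h0, hw⟩, rfl⟩) | ⟨w, ⟨h0, hw⟩, rfl⟩) | ⟨w, ⟨h0, hw, h1⟩, rfl⟩)
        all_goals refine ⟨w, ⟨admissible_iff.2 ⟨by rw [h0]; decide, ?_, hw⟩, by rw [h0]; decide⟩, rfl⟩
        · rw [h0]; exact fun h => absurd h.1 (by decide)
        · rw [h0]; exact fun h => absurd h.1 (by decide)
        · rw [h0]; exact fun h => absurd h.1 (by decide)
        · rw [h0]; exact fun h => absurd h.1 (by decide)
        · rw [h0]; exact fun h => absurd h.1 (by decide)
        · exact fun h => h1 h.2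
      · rintro ⟨w, ⟨hw, h0⟩, rfl⟩
        obtain ⟨h7, h6, ht⟩ := admissible_iff.1 hw
        have cases : ∀ i : Fin 8, i ≠ 0 → i ≠ 7 →
            i = 1 ∨ i = 2 ∨ i = 3 ∨ i = 4 ∨ i = 5 ∨ i = 6 := by decide
        rcases cases _ h0 h7 with h | h | h | h | h | h
        · exact Or.inl (Or.inl (Or.inl (Or.inl (Or.inl ⟨w, ⟨h, ht⟩, rfl⟩))))
        · exact Or.inl (Or.inl (Or.inl (Or.inl (Or.inr ⟨w, ⟨h, ht⟩, rfl⟩))))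
        · exact Or.inl (Or.inl (Or.inl (Or.inr ⟨w, ⟨h, ht⟩, rfl⟩)))
        · exact Or.inl (Or.inl (Or.inr ⟨w, ⟨h, ht⟩, rfl⟩))
        · exact Or.inl (Or.inr ⟨w, ⟨h, ht⟩, rfl⟩)
        · exact Or.inr ⟨w, ⟨h, ht, fun h1 => h6 ⟨h, h1⟩⟩, rfl⟩
    refine ⟨?_, h2⟩
    change mapCollection (hatSIFS c (k + 2) 0) (hatSupertiles c k).1 ∪
      (hatSupertiles c (k + 1)).2 = _
    rw [h2, ih1, mapCollection_tilesOf]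
    ext s
    constructor
    · rintro (⟨w, ⟨h0, hw⟩, rfl⟩ | ⟨w, ⟨hw, -⟩, rfl⟩)
      · refine ⟨w, admissible_iff.2 ⟨by rw [h0]; decide, ?_, hw⟩, rfl⟩
        rw [h0]; exact fun h => absurd h.1 (by decide)
      · exact ⟨w, hw, rfl⟩
    · rintro ⟨w, hw, rfl⟩
      by_cases h0 : w 0 = 0
      · exact Or.inl ⟨w, ⟨h0, hw.tail⟩, rfl⟩
      · exact Or.inr ⟨w, ⟨hw, h0⟩, rfl⟩

theorem processedCollection_eq (hc : c ∈ Set.Icc (0 : ℝ) 1) (k : ℕ) :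
    processedCollection (hatSIFS c) (fun _ => hatTile c) k = (hatSupertiles c k).1 := by
  rw [(hatSupertiles_eq k).1]
  ext s
  constructor
  · rintro ⟨hne, w, rfl⟩
    have hw : Admissible w := by
      by_contra h
      rw [processedTile_of_not_admissible h] at hne
      exact Set.not_nonempty_empty hne
    exact ⟨w, hw, processedTile_of_admissible hc hw⟩
  · rintro ⟨w, hw, rfl⟩
    refine ⟨?_, w, (processedTile_of_admissible hc hw).symm⟩
    obtain ⟨x, hx⟩ := (isDisc_hatTile hc).nonempty
    exact ⟨_, ⟨x, hx.1, rfl⟩⟩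

end

/-! ### Address maps of contractive systems, and largest strings of closed sets -/

noncomputable section

open Filter Topology

/-! ### Codings of attractors -/

section Coding

variable {E : Type*} {M : ℕ} {f : Fin M → E → E}

/-- The string with first letter `i` and remainder `s`. -/
def strCons (i : Fin M) (s : ℕ → Fin M) : ℕ → Fin M
  | 0 => i
  | l + 1 => s l

theorem strCons_tail (s : ℕ → Fin M) : strCons (s 0) (fun l => s (l + 1)) = s := by
  funext l
  cases l <;> rfl

/-- The image of a point under the maps of the first letters of a string. -/
def prefixMap (f : Fin M → E → E) (m : ℕ) (j : ℕ → Fin M) (y : E) : E :=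
  wordMap (fun _ => f) m (fun l => j l) y

theorem prefixMap_succ (m : ℕ) (j : ℕ → Fin M) (y : E) :
    prefixMap f (m + 1) j y = f (j 0) (prefixMap f m (fun l => j (l + 1)) y) := rfl

theorem prefixMap_succ' : ∀ (m : ℕ) (j : ℕ → Fin M) (y : E),
    prefixMap f (m + 1) j y = prefixMap f m j (f (j m) y)
  | 0, _, _ => rfl
  | m + 1, j, y => by
    rw [prefixMap_succ, prefixMap_succ' m, prefixMap_succ]

variable [NormedAddCommGroup E] {r : ℝ}

theorem dist_prefixMap_le (hr : 0 ≤ r) (hf : ∀ i x y, dist (f i x) (f i y) ≤ r * dist x y) :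
    ∀ (m : ℕ) (j : ℕ → Fin M) (x y : E),
      dist (prefixMap f m j x) (prefixMap f m j y) ≤ r ^ m * dist x y
  | 0, _, x, y => by simp [prefixMap, wordMap]
  | m + 1, j, x, y => by
    rw [prefixMap_succ, prefixMap_succ, pow_succ', mul_assoc]
    exact (hf _ _ _).trans (mul_le_mul_of_nonneg_left (dist_prefixMap_le hr hf m _ x y) hr)

/-- The point with a given address. -/
def codePoint (f : Fin M → E → E) (j : ℕ → Fin M) : E :=
  limUnder atTop fun m => prefixMap f m j 0

theorem exists_dist_bound (f : Fin M → E → E) : ∃ C, ∀ i, dist 0 (f i 0) ≤ C := by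
  obtain ⟨C, hC⟩ := (Set.finite_range fun i => dist 0 (f i 0)).bddAbove
  exact ⟨C, fun i => hC ⟨i, rfl⟩⟩

theorem dist_prefixMap_succ_le (hr : 0 ≤ r)
    (hf : ∀ i x y, dist (f i x) (f i y) ≤ r * dist x y) {C : ℝ} (hC : ∀ i, dist 0 (f i 0) ≤ C)
    (j : ℕ → Fin M) (m : ℕ) :
    dist (prefixMap f m j 0) (prefixMap f (m + 1) j 0) ≤ C * r ^ m := by
  rw [prefixMap_succ', mul_comm]
  exact (dist_prefixMap_le hr hf m j _ _).trans (mul_le_mul_of_nonneg_left (hC _) (pow_nonneg hr m))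

variable [CompleteSpace E]

theorem tendsto_prefixMap_zero (hr : 0 ≤ r) (hr1 : r < 1)
    (hf : ∀ i x y, dist (f i x) (f i y) ≤ r * dist x y) (j : ℕ → Fin M) :
    Tendsto (fun m => prefixMap f m j 0) atTop (𝓝 (codePoint f j)) := by
  obtain ⟨C, hC⟩ := exists_dist_bound f
  exact (cauchySeq_of_le_geometric r C hr1 (dist_prefixMap_succ_le hr hf hC j)).tendsto_limUnder

theorem isAddress_iff (hr : 0 ≤ r) (hr1 : r < 1)
    (hf : ∀ i x y, dist (f i x) (f i y) ≤ r * dist x y) {j : ℕ → Fin M} {x : E} :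
    IsAddress f j x ↔ codePoint f j = x := by
  have h0 := tendsto_prefixMap_zero hr hr1 hf j
  constructor
  · exact fun h => tendsto_nhds_unique h0 (h 0)
  · rintro rfl y
    refine h0.congr_dist ?_
    refine squeeze_zero (fun _ => dist_nonneg) (fun m => dist_prefixMap_le hr hf m j 0 y) ?_
    simpa using (tendsto_pow_atTop_nhds_zero_of_lt_one hr hr1).mul_const (dist 0 y)

theorem codePoint_strCons (hr : 0 ≤ r) (hr1 : r < 1)
    (hf : ∀ i x y, dist (f i x) (f i y) ≤ r * dist x y) (i : Fin M) (s : ℕ → Fin M) :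
    codePoint f (strCons i s) = f i (codePoint f s) := by
  have hcont : Continuous (f i) :=
    (LipschitzWith.of_dist_le_mul (K := ⟨r, hr⟩) (hf i)).continuous
  have h1 := (tendsto_prefixMap_zero hr hr1 hf (strCons i s)).comp (tendsto_add_atTop_nat 1)
  exact tendsto_nhds_unique h1
    ((hcont.tendsto _).comp (tendsto_prefixMap_zero hr hr1 hf s))

theorem codePoint_eq (hr : 0 ≤ r) (hr1 : r < 1)
    (hf : ∀ i x y, dist (f i x) (f i y) ≤ r * dist x y) (s : ℕ → Fin M) :
    codePoint f s = f (s 0) (codePoint f fun l => s (l + 1)) := by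
  rw [← codePoint_strCons hr hr1 hf, strCons_tail]

/-- The address map is a uniform limit of maps that depend on finitely many letters only. -/
theorem continuous_codePoint (hr : 0 ≤ r) (hr1 : r < 1)
    (hf : ∀ i x y, dist (f i x) (f i y) ≤ r * dist x y) : Continuous (codePoint f) := by
  obtain ⟨C, hC⟩ := exists_dist_bound f
  have hu : TendstoUniformly (fun m j => prefixMap f m j 0) (codePoint f) atTop := by
    rw [Metric.tendstoUniformly_iff]
    intro ε hε
    have hlim : Tendsto (fun m : ℕ => C * r ^ m / (1 - r)) atTop (𝓝 0) := by
      simpa using ((tendsto_pow_atTop_nhds_zero_of_lt_one hr hr1).const_mul C).div_const (1 - r)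
    filter_upwards [hlim.eventually_lt_const hε] with m hm j
    rw [dist_comm]
    exact (dist_le_of_le_geometric_of_tendsto r C hr1 (dist_prefixMap_succ_le hr hf hC j)
      (tendsto_prefixMap_zero hr hr1 hf j) m).trans_lt hm
  refine hu.continuous (Frequently.of_forall fun m => ?_)
  have h1 : Continuous fun (j : ℕ → Fin M) (l : Fin m) => j l :=
    continuous_pi fun l => continuous_apply _
  exact (continuous_of_discreteTopology (f := fun w : Fin m → Fin M =>
    wordMap (fun _ => f) m w 0)).comp h1

end Coding

/-! ### Lexicographically largest addresses -/

section Top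

variable {M : ℕ}

/-- The strings of a set whose first letters are chosen as large as possible. -/
def greedy (S : Set (ℕ → Fin M)) : ℕ → Set (ℕ → Fin M)
  | 0 => S
  | m + 1 => {j ∈ greedy S m | ∀ j' ∈ greedy S m, j m ≤ j' m}

theorem greedy_nonempty {S : Set (ℕ → Fin M)} (hS : S.Nonempty) (m : ℕ) :
    (greedy S m).Nonempty := by
  induction m with
  | zero => exact hS
  | succ m ih =>
    obtain ⟨_, ⟨j, hj, rfl⟩, hmin⟩ := wellFounded_lt.has_min ((fun j => j m) '' greedy S m)
      (ih.image _)
    exact ⟨j, hj, fun j' hj' => not_lt.1 (hmin _ ⟨j', hj', rfl⟩)⟩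

theorem isClosed_greedy {S : Set (ℕ → Fin M)} (hS : IsClosed S) (m : ℕ) :
    IsClosed (greedy S m) := by
  induction m with
  | zero => exact hS
  | succ m ih =>
    have h : IsClosed ((fun j : ℕ → Fin M => j m) ⁻¹' {i | ∀ j' ∈ greedy S m, i ≤ j' m}) :=
      (isClosed_discrete _).preimage (continuous_apply m)
    exact ih.inter h

theorem mem_greedy_of_agree {S : Set (ℕ → Fin M)} {j j' : ℕ → Fin M} (hj' : j' ∈ S) :
    ∀ m, j ∈ greedy S m → (∀ l < m, j l = j' l) → j' ∈ greedy S m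
  | 0, _, _ => hj'
  | m + 1, hj, h => by
    refine ⟨mem_greedy_of_agree hj' m hj.1 fun l hl => h l (by omega), ?_⟩
    rw [← h m (by omega)]
    exact hj.2

/-- A nonempty closed set of strings has a largest element. -/
theorem exists_largest {S : Set (ℕ → Fin M)} (hS : IsClosed S) (hne : S.Nonempty) :
    ∃ j ∈ S, ∀ j' ∈ S, j' = j ∨ TopGT j j' := by
  -- The greedy sets are nested, nonempty and closed in the compact space of strings, so their
  -- intersection is not empty.
  obtain ⟨j, hj⟩ := IsCompact.nonempty_iInter_of_sequence_nonempty_isCompact_isClosed (greedy S)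
    (fun m => fun _ h => h.1) (greedy_nonempty hne) hS.isCompact (isClosed_greedy hS)
  rw [Set.mem_iInter] at hj
  refine ⟨j, hj 0, fun j' hj' => ?_⟩
  by_cases h : j' = j
  · exact Or.inl h
  · right
    obtain ⟨l, hl⟩ := Function.ne_iff.1 h
    have hex : ∃ l, j l ≠ j' l := ⟨l, fun e => hl e.symm⟩
    have hlt : ∀ l < Nat.find hex, j l = j' l := fun l hl => not_not.1 (Nat.find_min hex hl)
    refine ⟨Nat.find hex, hlt, ?_⟩
    exact lt_of_le_of_ne ((hj (Nat.find hex + 1)).2 _ (mem_greedy_of_agree hj' _ (hj _) hlt))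
      (Nat.find_spec hex)

theorem TopGT.asymm {u v : ℕ → Fin M} (h : TopGT u v) : ¬ (v = u ∨ TopGT v u) := by
  obtain ⟨m, h1, h2⟩ := h
  rintro (rfl | ⟨m', h3, h4⟩)
  · exact lt_irrefl _ h2
  · rcases lt_trichotomy m m' with h | rfl | h
    · rw [h3 m h] at h2
      exact lt_irrefl _ h2
    · exact lt_asymm h2 h4
    · rw [h1 m' h] at h4
      exact lt_irrefl _ h4

theorem TopGT.strCons (i : Fin M) {u v : ℕ → Fin M} (h : TopGT u v) :
    TopGT (strCons i u) (strCons i v) := by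
  obtain ⟨m, h1, h2⟩ := h
  refine ⟨m + 1, fun l hl => ?_, h2⟩
  cases l with
  | zero => rfl
  | succ l => exact h1 l (by omega)

end Top

end

/-! ### The limit system, its allowed strings and its tiles -/

noncomputable section

open Filter Topology

variable {c : ℝ} {n : ℕ}

/-! ### The limit system -/

theorem hatRatio_mul_goldenRatio_sq : (hatRatio : ℂ) * (Real.goldenRatio : ℂ) ^ 2 = 1 := by
  have h : hatRatio * Real.goldenRatio ^ 2 = 1 :=
    inv_mul_cancel₀ (pow_pos Real.goldenRatio_pos 2).ne'
  exact_mod_cast h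

theorem hatRatio_pow_mul_levelScale (n : ℕ) :
    (hatRatio : ℂ) ^ (n + 1) * levelScale (1 - c) c n = hatRatio * baseScale (1 - c) c := by
  have h : (hatRatio : ℂ) ^ n * (Real.goldenRatio : ℂ) ^ (2 * n) = 1 := by
    rw [pow_mul, ← mul_pow, hatRatio_mul_goldenRatio_sq, one_pow]
  rw [levelScale]
  linear_combination (hatRatio : ℂ) * baseScale (1 - c) c * h

/-- The limit map of a place. -/
def placeLimit (c : ℝ) (i : Fin 7) (z : ℂ) : ℂ :=
  hatRatio * (hexRoot ^ (motion i).1 * z) + hatRatio * baseScale (1 - c) c * (motion i).2.lead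

/-- The limit of the sequence of systems. -/
def hatLimit (c : ℝ) (i : Fin 8) : ℂ → ℂ := placeLimit c (letterPlace i)

theorem norm_hatRatio : ‖(hatRatio : ℂ)‖ = hatRatio := by
  rw [Complex.norm_real, Real.norm_of_nonneg hatRatio_pos.le]

theorem dist_placeLimit (i : Fin 7) (x y : ℂ) :
    dist (placeLimit c i x) (placeLimit c i y) = hatRatio * dist x y := by
  rw [dist_eq_norm, placeLimit, placeLimit, add_sub_add_right_eq_sub, ← mul_sub, ← mul_sub,
    norm_mul, norm_mul, norm_pow, norm_hexRoot, one_pow, one_mul, norm_hatRatio, dist_eq_norm]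

theorem dist_hatLimit (i : Fin 8) (x y : ℂ) :
    dist (hatLimit c i x) (hatLimit c i y) = hatRatio * dist x y := dist_placeLimit _ x y

/-- The translation differs from its leading term by a bounded amount at unit scale, which the
contraction turns into O(φ^n). -/
theorem exists_dist_placeLimit_le (c : ℝ) : ∃ D, 0 ≤ D ∧ ∀ n i z,
    dist ((hatRatio : ℂ) ^ (n + 1) * hatMove (1 - c) c n i z)
      (placeLimit c i ((hatRatio : ℂ) ^ n * z)) ≤ D * hatRatio ^ n := by
  obtain ⟨D, hD, h⟩ := exists_norm_ev_sub_le (1 - c) c (List.ofFn fun i => (motion i).2)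
  refine ⟨D, hD, fun n i z => ?_⟩
  have e : (hatRatio : ℂ) ^ (n + 1) * hatMove (1 - c) c n i z -
      placeLimit c i ((hatRatio : ℂ) ^ n * z) = (hatRatio : ℂ) ^ (n + 1) *
        ((motion i).2.ev (1 - c) c n - levelScale (1 - c) c n * (motion i).2.lead) := by
    rw [placeLimit, hatMove, frame_apply, ← hatRatio_pow_mul_levelScale n]
    ring
  rw [dist_eq_norm, e, norm_mul, norm_pow, norm_hatRatio, mul_comm]
  refine mul_le_mul (h _ ((List.mem_ofFn' _ _).2 ⟨i, rfl⟩) n) ?_ (pow_nonneg hatRatio_pos.le _) hD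
  exact pow_le_pow_of_le_one hatRatio_pos.le hatRatio_lt_one.le n.le_succ

theorem convergesTo_hatLimit (c : ℝ) : ConvergesTo (hatSIFS c) (hatLimit c) := by
  obtain ⟨D, hD, h⟩ := exists_dist_placeLimit_le c
  intro i
  rw [Metric.tendstoUniformly_iff]
  intro ε hε
  have hlim : Tendsto (fun m : ℕ => D * hatRatio ^ m) atTop (𝓝 0) := by
    simpa using (tendsto_pow_atTop_nhds_zero_of_lt_one hatRatio_pos.le hatRatio_lt_one).const_mul D
  have hev := (tendsto_sub_atTop_nat 1).eventually (hlim.eventually_lt_const hε)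
  -- From level 2 on the letter `8` is no longer the reflection.
  filter_upwards [hev, eventually_ge_atTop 2] with m hm hm2 z
  obtain ⟨n, rfl⟩ : ∃ n, m = n + 1 + 1 := ⟨m - 2, by omega⟩
  rw [Nat.add_sub_cancel] at hm
  rw [dist_comm, hatSIFS_eq, levelMove, if_neg fun h => absurd h.1 (by omega)]
  have := h (n + 1) (letterPlace i) (((hatRatio : ℂ) ^ (n + 1))⁻¹ * z)
  rw [mul_inv_cancel_left₀ (pow_ne_zero _ hatRatio_ne_zero)] at this
  exact this.trans_lt hm

theorem eq_hatLimit {f : Fin 8 → ℂ → ℂ} (hf : ConvergesTo (hatSIFS c) f) : f = hatLimit c := by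
  funext i z
  exact tendsto_nhds_unique ((hf i).tendsto_at z) ((convergesTo_hatLimit c i).tendsto_at z)

theorem hatLimit_seven : hatLimit c 7 = hatLimit c 5 := rfl

theorem hatLimit_comp (z : ℂ) :
    hatLimit c 5 (hatLimit c 6 z) = hatLimit c 6 (hatLimit c 0 z) := by
  have h : (motion 6).2.plus (motion 5).2.shift = (motion 6).2.shift := by decide
  have h' := congrArg Pos.lead h
  rw [Pos.lead_plus, Pos.lead_shift, Pos.lead_shift] at h'
  have e0 : (motion 0).2.lead = 0 := by simp [motion, Pos.lead, eis]
  have r0 : (motion 0).1 = 0 := rfl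
  have r5 : (motion 5).1 = 0 := rfl
  have r6 : (motion 6).1 = 0 := rfl
  change placeLimit c 5 (placeLimit c 6 z) = placeLimit c 6 (placeLimit c 0 z)
  simp only [placeLimit, e0, r0, r5, r6, pow_zero, one_mul, mul_zero, add_zero]
  linear_combination (hatRatio : ℂ) ^ 2 * baseScale (1 - c) c * h' + hatRatio *
    baseScale (1 - c) c * ((motion 6).2.lead - (motion 5).2.lead) * hatRatio_mul_goldenRatio_sq

/-! ### Allowed strings -/

/-- The strings in the first seven letters that do not contain `71`. -/
def allowed : Set (ℕ → Fin 8) := {j | ∀ l, j l ≠ 7 ∧ ¬ (j l = 6 ∧ j (l + 1) = 0)}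

theorem strCons_mem_allowed {i : Fin 8} {j : ℕ → Fin 8} :
    strCons i j ∈ allowed ↔ i ≠ 7 ∧ ¬ (i = 6 ∧ j 0 = 0) ∧ j ∈ allowed := by
  constructor
  · exact fun h => ⟨(h 0).1, (h 0).2, fun l => h (l + 1)⟩
  · rintro ⟨h1, h2, h3⟩ l
    cases l with
    | zero => exact ⟨h1, h2⟩
    | succ l => exact h3 l

theorem tail_mem_allowed {j : ℕ → Fin 8} (h : j ∈ allowed) : (fun l => j (l + 1)) ∈ allowed :=
  fun l => h (l + 1)

theorem isClosed_allowed : IsClosed allowed := by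
  have e : allowed = ⋂ l, (fun j : ℕ → Fin 8 => (j l, j (l + 1))) ⁻¹'
      {p | p.1 ≠ 7 ∧ ¬ (p.1 = 6 ∧ p.2 = 0)} := by
    ext j; rw [Set.mem_iInter]; rfl
  rw [e]
  exact isClosed_iInter fun l => (isClosed_discrete _).preimage
    ((continuous_apply l).prodMk (continuous_apply (l + 1)))

theorem dist_hatLimit_le (i : Fin 8) (x y : ℂ) :
    dist (hatLimit c i x) (hatLimit c i y) ≤ hatRatio * dist x y := (dist_hatLimit i x y).le

theorem hatCode_strCons (i : Fin 8) (s : ℕ → Fin 8) :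
    codePoint (hatLimit c) (strCons i s) = hatLimit c i (codePoint (hatLimit c) s) :=
  codePoint_strCons hatRatio_pos.le hatRatio_lt_one dist_hatLimit_le i s

theorem hatCode_eq (s : ℕ → Fin 8) :
    codePoint (hatLimit c) s = hatLimit c (s 0) (codePoint (hatLimit c) fun l => s (l + 1)) :=
  codePoint_eq hatRatio_pos.le hatRatio_lt_one dist_hatLimit_le s

theorem continuous_hatCode : Continuous (codePoint (hatLimit c)) :=
  continuous_codePoint hatRatio_pos.le hatRatio_lt_one dist_hatLimit_le

/-- The same rewriting as for words; in the limit `8` repeats `6` in every place, so allowed strings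
contain no `8` at all. -/
theorem exists_topGT_string {j : ℕ → Fin 8} (h : j ∉ allowed) :
    ∃ j', TopGT j' j ∧ codePoint (hatLimit c) j' = codePoint (hatLimit c) j := by
  obtain ⟨l, hl⟩ := not_forall.1 h
  induction l generalizing j with
  | zero =>
    by_cases h7 : j 0 = 7
    · refine ⟨strCons 5 fun l => j (l + 1), ⟨0, fun l hl => absurd hl (Nat.not_lt_zero l), ?_⟩, ?_⟩
      · rw [h7]; exact (by decide : (5 : Fin 8) < 7)
      · rw [hatCode_strCons, hatCode_eq j, h7, hatLimit_seven]
    · have h6 : j 0 = 6 ∧ j 1 = 0 := by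
        by_contra h6
        exact hl ⟨h7, h6⟩
      refine ⟨strCons 5 (strCons 6 fun l => j (l + 2)),
        ⟨0, fun l hl => absurd hl (Nat.not_lt_zero l), ?_⟩, ?_⟩
      · rw [h6.1]; exact (by decide : (5 : Fin 8) < 6)
      · rw [hatCode_strCons, hatCode_strCons, hatCode_eq j, hatCode_eq fun l => j (l + 1), h6.1,
          zero_add, h6.2, hatLimit_comp]
  | succ l ih =>
    obtain ⟨j', h1, h2⟩ := ih (j := fun l => j (l + 1)) (fun h => hl (h l)) hl
    refine ⟨strCons (j 0) j', ?_, ?_⟩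
    · have := h1.strCons (j 0)
      rwa [strCons_tail] at this
    · rw [hatCode_strCons, h2, ← hatCode_eq]

theorem topCodeSpace_subset_allowed : topCodeSpace (hatLimit c) ⊆ allowed := by
  rintro j ⟨x, hx, hmax⟩
  by_contra h
  obtain ⟨j', h1, h2⟩ := exists_topGT_string (c := c) h
  have key : ∀ j, IsAddress (hatLimit c) j x ↔ codePoint (hatLimit c) j = x := fun _ =>
    isAddress_iff hatRatio_pos.le hatRatio_lt_one dist_hatLimit_le
  exact h1.asymm ((hmax j' ((key j').2 (h2.trans ((key j).1 hx)))).imp_left Eq.symm)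

/-- The addresses of a point form a closed set of strings, which has a largest element. -/
theorem exists_mem_topCodeSpace (j : ℕ → Fin 8) :
    ∃ j' ∈ topCodeSpace (hatLimit c), codePoint (hatLimit c) j' = codePoint (hatLimit c) j := by
  have key : ∀ j x, IsAddress (hatLimit c) j x ↔ codePoint (hatLimit c) j = x := fun _ _ =>
    isAddress_iff hatRatio_pos.le hatRatio_lt_one dist_hatLimit_le
  obtain ⟨j', h1, h2⟩ := exists_largest
    (S := codePoint (hatLimit c) ⁻¹' {codePoint (hatLimit c) j})
    (isClosed_singleton.preimage continuous_hatCode) ⟨j, rfl⟩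
  exact ⟨j', ⟨_, (key _ _).2 h1, fun i hi => h2 i ((key _ _).1 hi)⟩, h1⟩

/-! ### The limit tiles -/

/-- The limit of the `H₈`-supertiles. -/
def limitEight (c : ℝ) : Set ℂ := codePoint (hatLimit c) '' allowed

/-- The limit of the `H₇`-supertiles. -/
def limitSeven (c : ℝ) : Set ℂ := codePoint (hatLimit c) '' (allowed ∩ {j | j 0 ≠ 0})

theorem isCompact_limitEight : IsCompact (limitEight c) :=
  isClosed_allowed.isCompact.image continuous_hatCode

theorem isCompact_limitSeven : IsCompact (limitSeven c) := by
  have h : IsClosed ((fun j : ℕ → Fin 8 => j 0) ⁻¹' {i | i ≠ 0}) :=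
    (isClosed_discrete _).preimage (continuous_apply 0)
  exact (isClosed_allowed.inter h).isCompact.image continuous_hatCode

/-- The part of the limit supertile that is put in the place of a letter. -/
def limitPart (c : ℝ) (i : Fin 8) : Set ℂ := if i = 6 then limitSeven c else limitEight c

theorem mem_limitPart {i : Fin 8} {j : ℕ → Fin 8} (h : strCons i j ∈ allowed) :
    codePoint (hatLimit c) j ∈ limitPart c i := by
  obtain ⟨-, h2, h3⟩ := strCons_mem_allowed.1 h
  rw [limitPart]
  split_ifs with hi
  · exact ⟨j, ⟨h3, fun h0 => h2 ⟨hi, h0⟩⟩, rfl⟩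
  · exact ⟨j, h3, rfl⟩

theorem exists_of_mem_limitPart {i : Fin 8} (hi : i ≠ 7) {z : ℂ} (hz : z ∈ limitPart c i) :
    ∃ j, strCons i j ∈ allowed ∧ codePoint (hatLimit c) j = z := by
  rw [limitPart] at hz
  split_ifs at hz with h6
  · obtain ⟨j, hj, rfl⟩ := hz
    exact ⟨j, strCons_mem_allowed.2 ⟨hi, fun h => hj.2 h.2, hj.1⟩, rfl⟩
  · obtain ⟨j, hj, rfl⟩ := hz
    exact ⟨j, strCons_mem_allowed.2 ⟨hi, fun h => h6 h.1, hj⟩, rfl⟩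

/-- Splitting off the first letter gives the set equations of the substitution: six copies of the
limit of H₈ and one of the limit of H₇. -/
theorem limitEight_eq :
    limitEight c = ⋃ i ∈ ({0, 1, 2, 3, 4, 5, 6} : Finset (Fin 8)), hatLimit c i '' limitPart c i := by
  have key : ∀ i : Fin 8, i ∈ ({0, 1, 2, 3, 4, 5, 6} : Finset (Fin 8)) ↔ i ≠ 7 := by decide
  ext z
  simp only [Set.mem_iUnion, key]
  constructor
  · rintro ⟨j, hj, rfl⟩
    rw [hatCode_eq]
    exact ⟨_, (hj 0).1, _, mem_limitPart (by rwa [strCons_tail]), rfl⟩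
  · rintro ⟨i, hi, y, hy, rfl⟩
    obtain ⟨j, hj, rfl⟩ := exists_of_mem_limitPart hi hy
    exact ⟨_, hj, hatCode_strCons i j⟩

theorem limitSeven_eq :
    limitSeven c = ⋃ i ∈ ({1, 2, 3, 4, 5, 6} : Finset (Fin 8)), hatLimit c i '' limitPart c i := by
  have key : ∀ i : Fin 8, i ∈ ({1, 2, 3, 4, 5, 6} : Finset (Fin 8)) ↔ i ≠ 0 ∧ i ≠ 7 := by decide
  ext z
  simp only [Set.mem_iUnion, key]
  constructor
  · rintro ⟨j, hj, rfl⟩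
    rw [hatCode_eq]
    exact ⟨_, ⟨hj.2, (hj.1 0).1⟩, _, mem_limitPart (by rw [strCons_tail]; exact hj.1), rfl⟩
  · rintro ⟨i, hi, y, hy, rfl⟩
    obtain ⟨j, hj, rfl⟩ := exists_of_mem_limitPart hi.2 hy
    exact ⟨_, ⟨hj, hi.1⟩, hatCode_strCons i j⟩

/-! ### The limit tile contains a disc -/

/-- By induction on the level: the error inherited from the parts is contracted by φ, and replacing
the map by its limit adds O(φ^{k+1}), which gives (k + 1) φ^k in total. -/
theorem exists_dist_limit_le (hc : c ∈ Set.Icc (0 : ℝ) 1) : ∃ D, ∀ k,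
    (∀ U ∈ (frames (1 - c) c k).1, ∀ z ∈ hatTile c, ∃ y ∈ limitEight c,
      dist ((hatRatio : ℂ) ^ (k + 1) * U z) y ≤ D * ((k + 1) * hatRatio ^ k)) ∧
    ∀ U ∈ (frames (1 - c) c k).2, ∀ z ∈ hatTile c, ∃ y ∈ limitSeven c,
      dist ((hatRatio : ℂ) ^ (k + 1) * U z) y ≤ D * ((k + 1) * hatRatio ^ k) := by
  obtain ⟨D, hD, h⟩ := exists_dist_placeLimit_le c
  -- Any allowed string not starting with letter 1 serves as a reference point in both limits.
  have hj : (fun _ => 1 : ℕ → Fin 8) ∈ allowed :=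
    fun _ => (by decide : (1 : Fin 8) ≠ 7 ∧ ¬ ((1 : Fin 8) = 6 ∧ (1 : Fin 8) = 0))
  set q := codePoint (hatLimit c) fun _ => 1
  have hq7 : q ∈ limitSeven c := ⟨_, ⟨hj, by decide⟩, rfl⟩
  have hq8 : q ∈ limitEight c := ⟨_, hj, rfl⟩
  have hbdd : ∀ l : List (ℂ ≃ᵢ ℂ), ∃ B, ∀ U ∈ l, ∀ z ∈ hatTile c,
      dist ((hatRatio : ℂ) ^ (0 + 1) * U z) q ≤ B := by
    intro l
    have hcomp : IsCompact (⋃ U ∈ {U | U ∈ l}, U '' hatTile c) :=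
      (List.finite_toSet l).isCompact_biUnion fun U _ =>
        (isDisc_hatTile hc).compact.image U.continuous
    obtain ⟨B, hB⟩ := (hcomp.image (f := fun z => dist ((hatRatio : ℂ) ^ (0 + 1) * z) q)
      (by fun_prop)).bddAbove
    exact ⟨B, fun U hU z hz => hB ⟨U z, Set.mem_biUnion hU ⟨z, hz, rfl⟩, rfl⟩⟩
  obtain ⟨B1, hB1⟩ := hbdd (frames (1 - c) c 0).1
  obtain ⟨B2, hB2⟩ := hbdd (frames (1 - c) c 0).2
  set D' := max D (max B1 B2)
  have hstep : ∀ k, ((∀ U ∈ (frames (1 - c) c k).1, ∀ z ∈ hatTile c, ∃ y ∈ limitEight c,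
      dist ((hatRatio : ℂ) ^ (k + 1) * U z) y ≤ D' * ((k + 1) * hatRatio ^ k)) ∧
      ∀ U ∈ (frames (1 - c) c k).2, ∀ z ∈ hatTile c, ∃ y ∈ limitSeven c,
      dist ((hatRatio : ℂ) ^ (k + 1) * U z) y ≤ D' * ((k + 1) * hatRatio ^ k)) →
      ∀ i : Fin 7, ∀ U ∈ block (1 - c) c k i, ∀ z ∈ hatTile c,
      ∃ y ∈ limitPart c i.castSucc, dist ((hatRatio : ℂ) ^ (k + 1 + 1) * U z)
        (hatLimit c i.castSucc y) ≤ D' * (((k + 1 : ℕ) + 1) * hatRatio ^ (k + 1)) := by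
    intro k ih i U hU z hz
    obtain ⟨V, hV, rfl⟩ := List.mem_map.1 hU
    have hex : ∃ y ∈ limitPart c i.castSucc,
        dist ((hatRatio : ℂ) ^ (k + 1) * V z) y ≤ D' * ((k + 1) * hatRatio ^ k) := by
      have e : ∀ i : Fin 7, i.castSucc = (6 : Fin 8) ↔ i = 6 := by decide
      rw [limitPart]
      simp only [e]
      split_ifs at hV ⊢
      · exact ih.2 V hV z hz
      · exact ih.1 V hV z hz
    obtain ⟨y, hy, hd⟩ := hex
    refine ⟨y, hy, ?_⟩
    have ei : ∀ i : Fin 7, letterPlace i.castSucc = i := by decide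
    have h1 := h (k + 1) i (V z)
    have h2 := dist_placeLimit (c := c) i ((hatRatio : ℂ) ^ (k + 1) * V z) y
    rw [hatLimit, ei, IsometryEquiv.trans_apply]
    refine (dist_triangle _ _ _).trans ((add_le_add h1 h2.le).trans ?_)
    have h3 := mul_le_mul_of_nonneg_left hd hatRatio_pos.le
    have h4 := mul_le_mul_of_nonneg_right (le_max_left D (max B1 B2))
      (pow_nonneg hatRatio_pos.le (k + 1))
    push_cast
    rw [pow_succ] at h4 ⊢
    linarith
  refine ⟨D', fun k => ?_⟩
  induction k with
  | zero =>
    refine ⟨fun U hU z hz => ⟨q, hq8, ?_⟩, fun U hU z hz => ⟨q, hq7, ?_⟩⟩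
    · have e : D' * (((0 : ℕ) + 1) * hatRatio ^ 0) = D' := by simp
      rw [e]
      exact (hB1 U hU z hz).trans ((le_max_left _ _).trans (le_max_right _ _))
    · have e : D' * (((0 : ℕ) + 1) * hatRatio ^ 0) = D' := by simp
      rw [e]
      exact (hB2 U hU z hz).trans ((le_max_right _ _).trans (le_max_right _ _))
  | succ k ih =>
    have hs := hstep k ih
    rw [(frames_succ_eq k).1, (frames_succ_eq k).2, limitEight_eq, limitSeven_eq]
    constructor
    · intro U hU z hz
      obtain ⟨i, -, hi⟩ := List.mem_flatMap.1 hU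
      obtain ⟨y, hy, hd⟩ := hs i U hi z hz
      have e : ∀ i : Fin 7, i.castSucc ∈ ({0, 1, 2, 3, 4, 5, 6} : Finset (Fin 8)) := by decide
      exact ⟨_, Set.mem_biUnion (e i) ⟨y, hy, rfl⟩, hd⟩
    · intro U hU z hz
      obtain ⟨i, hi0, hi⟩ := List.mem_flatMap.1 hU
      obtain ⟨y, hy, hd⟩ := hs i U hi z hz
      have e : ∀ i : Fin 7, i ∈ [1, 2, 3, 4, 5, 6] →
        i.castSucc ∈ ({1, 2, 3, 4, 5, 6} : Finset (Fin 8)) := by decide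
      exact ⟨_, Set.mem_biUnion (e i hi0) ⟨y, hy, rfl⟩, hd⟩

/-- The rescaled discs covered by the supertiles are all the same disc, and the tiles converge to
the closed limit set, which therefore contains it. -/
theorem ball_subset_limitEight (hc : c ∈ Set.Icc (0 : ℝ) 1) :
    Metric.ball (hatRatio * baseScale (1 - c) c * discCenter)
      (‖(hatRatio : ℂ) * baseScale (1 - c) c‖ / 10) ⊆ limitEight c := by
  obtain ⟨D, hD⟩ := exists_dist_limit_le hc
  intro p hp
  rw [← isCompact_limitEight.isClosed.closure_eq, Metric.mem_closure_iff]
  intro ε hε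
  have hlim : Tendsto (fun k : ℕ => D * (((k : ℝ) + 1) * hatRatio ^ k)) atTop (𝓝 0) := by
    have h1 := tendsto_self_mul_const_pow_of_lt_one hatRatio_pos.le hatRatio_lt_one
    have h2 := tendsto_pow_atTop_nhds_zero_of_lt_one hatRatio_pos.le hatRatio_lt_one
    have h3 := (h1.add h2).const_mul D
    rw [add_zero, mul_zero] at h3
    exact h3.congr fun k => by ring
  obtain ⟨k, hk, hcov⟩ := ((hlim.eventually_lt_const hε).and (eventually_covers hc)).exists
  have hne : (hatRatio : ℂ) ^ (k + 1) ≠ 0 := pow_ne_zero _ hatRatio_ne_zero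
  have hmem : ((hatRatio : ℂ) ^ (k + 1))⁻¹ * p ∈
      Metric.ball (levelScale (1 - c) c k * discCenter) (‖levelScale (1 - c) c k‖ / 10) := by
    rw [← hatRatio_pow_mul_levelScale k, Metric.mem_ball, dist_eq_norm, norm_mul] at hp
    rw [Metric.mem_ball, dist_eq_norm]
    have hpos := norm_pos_iff.2 hne
    have e : ((hatRatio : ℂ) ^ (k + 1))⁻¹ * p - levelScale (1 - c) c k * discCenter =
        ((hatRatio : ℂ) ^ (k + 1))⁻¹ *
          (p - (hatRatio : ℂ) ^ (k + 1) * levelScale (1 - c) c k * discCenter) := by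
      rw [mul_sub, mul_assoc, inv_mul_cancel_left₀ hne]
    rw [e, norm_mul, norm_inv, inv_mul_lt_iff₀ hpos]
    linarith
  obtain ⟨U, hU, z, hz, e⟩ := Set.mem_iUnion₂.1 (hcov hmem)
  obtain ⟨y, hy, hd⟩ := (hD k).1 U hU z hz
  refine ⟨y, hy, ?_⟩
  have e' : (hatRatio : ℂ) ^ (k + 1) * U z = p := by rw [e, mul_inv_cancel_left₀ hne]
  rw [← e']
  exact hd.trans_lt hk

end

/-! ### Areas of the limit tiles, and the beginnings of top addresses -/

noncomputable section

open Filter Topology MeasureTheory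

variable {c : ℝ} {k : ℕ}

/-! ### Areas -/

theorem volume_image_mul_add (a b : ℂ) (S : Set ℂ) :
    volume ((fun z => a * z + b) '' S) = ENNReal.ofReal (‖a‖ ^ 2) * volume S := by
  have h := Measure.addHaar_image_linearMap volume (Algebra.lmul ℝ ℂ a) S
  rw [← Algebra.norm_apply, Algebra.norm_complex_apply, Complex.normSq_eq_norm_sq,
    abs_of_nonneg (sq_nonneg _)] at h
  rw [← h]
  have e : (fun z => a * z + b) '' S = (fun z => -b + z) ⁻¹' (Algebra.lmul ℝ ℂ a '' S) := by
    rw [← Set.image_add_left, ← Set.image_comp]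
    exact Set.image_congr fun z _ => add_comm _ _
  rw [e, measure_preimage_add]

/-- The factor by which the maps of the limit system change areas. -/
def areaRatio : ℝ := hatRatio ^ 2

theorem areaRatio_pos : 0 < areaRatio := pow_pos hatRatio_pos 2

/-- Up to inversion, the characteristic equation of the substitution matrix (6 1; 5 1), with trace 7
and determinant 1. -/
theorem areaRatio_eq : areaRatio ^ 2 - 7 * areaRatio + 1 = 0 := by
  have h1 : hatRatio * Real.goldenRatio ^ 2 = 1 :=
    inv_mul_cancel₀ (pow_pos Real.goldenRatio_pos 2).ne'
  rw [Real.goldenRatio_sq] at h1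
  have h2 : hatRatio ^ 2 - 3 * hatRatio + 1 = 0 := by
    have := Real.goldenRatio_sq
    have hne : (Real.goldenRatio + 1) ^ 2 ≠ 0 := by positivity
    apply mul_left_cancel₀ hne
    linear_combination (hatRatio * (Real.goldenRatio + 1) - 3 * (Real.goldenRatio + 1) + 1) * h1 +
      this
  rw [areaRatio]
  linear_combination (hatRatio ^ 2 + 3 * hatRatio + 1) * h2

theorem areaRatio_lt : areaRatio * 6 < 1 := by
  have h := areaRatio_eq
  have h0 := areaRatio_pos
  have h1 : areaRatio < 1 := pow_lt_one₀ hatRatio_pos.le hatRatio_lt_one two_ne_zero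
  nlinarith

theorem volume_hatLimit_image (i : Fin 8) (S : Set ℂ) :
    volume (hatLimit c i '' S) = ENNReal.ofReal areaRatio * volume S := by
  have h := volume_image_mul_add (hatRatio * hexRoot ^ (motion (letterPlace i)).1)
    (hatRatio * baseScale (1 - c) c * (motion (letterPlace i)).2.lead) S
  rw [norm_mul, norm_pow, norm_hexRoot, one_pow, mul_one, norm_hatRatio] at h
  rw [areaRatio, ← h]
  exact congrArg volume (Set.image_congr fun z _ => by
    rw [hatLimit, placeLimit, mul_assoc (hatRatio : ℂ) (hexRoot ^ _)])

theorem volume_real_hatLimit_image (i : Fin 8) (S : Set ℂ) :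
    volume.real (hatLimit c i '' S) = areaRatio * volume.real S := by
  rw [Measure.real, volume_hatLimit_image, ENNReal.toReal_mul,
    ENNReal.toReal_ofReal areaRatio_pos.le, Measure.real]

theorem continuous_hatLimit (i : Fin 8) : Continuous (hatLimit c i) :=
  (LipschitzWith.of_dist_le_mul (K := ⟨hatRatio, hatRatio_pos.le⟩) (dist_hatLimit_le i)).continuous

theorem hatLimit_injective (i : Fin 8) : Function.Injective (hatLimit c i) := by
  intro x y h
  have := dist_hatLimit (c := c) i x y
  rw [h, dist_self, eq_comm, mul_eq_zero, or_iff_right hatRatio_pos.ne'] at this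
  exact dist_eq_zero.1 this

theorem isCompact_limitPart (i : Fin 8) : IsCompact (limitPart c i) := by
  rw [limitPart]
  split_ifs
  · exact isCompact_limitSeven
  · exact isCompact_limitEight

theorem volume_limitEight_pos (hc : c ∈ Set.Icc (0 : ℝ) 1) : 0 < volume.real (limitEight c) := by
  rw [measureReal_def, ENNReal.toReal_pos_iff]
  refine ⟨?_, isCompact_limitEight.measure_lt_top⟩
  refine (Metric.measure_ball_pos volume _ ?_).trans_le (measure_mono (ball_subset_limitEight hc))
  have : baseScale (1 - c) c ≠ 0 := baseScale_ne_zero (by linarith [hc.2]) hc.1 (by norm_num)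
  exact div_pos (norm_pos_iff.2 (mul_ne_zero hatRatio_ne_zero this)) (by norm_num)

theorem volume_pieces (s : Finset (Fin 8)) :
    volume.real (⋃ i ∈ s, hatLimit c i '' limitPart c i) ≤
      ∑ i ∈ s, areaRatio * volume.real (limitPart c i) := by
  refine (measureReal_biUnion_finset_le s _).trans (Finset.sum_le_sum fun i _ => ?_)
  rw [volume_real_hatLimit_image]

theorem volume_limitEight_le : volume.real (limitEight c) ≤
    areaRatio * (6 * volume.real (limitEight c) + volume.real (limitSeven c)) := by
  conv_lhs => rw [limitEight_eq]
  refine (volume_pieces _).trans_eq ?_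
  simp [limitPart, Finset.sum_insert]
  ring

theorem volume_limitSeven_le : volume.real (limitSeven c) ≤
    areaRatio * (5 * volume.real (limitEight c) + volume.real (limitSeven c)) := by
  conv_lhs => rw [limitSeven_eq]
  refine (volume_pieces _).trans_eq ?_
  simp [limitPart, Finset.sum_insert]
  ring

/-- The two subadditivity estimates are inequalities for the Perron eigenvalue. Eliminating the area
of H₇ with the second turns the first around, so it is an equality. -/
theorem volume_limitEight_eq : volume.real (limitEight c) =
    areaRatio * (6 * volume.real (limitEight c) + volume.real (limitSeven c)) := by
  refine volume_limitEight_le.antisymm ?_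
  have h1 := volume_limitSeven_le (c := c)
  have h2 := areaRatio_eq
  have h3 := areaRatio_lt
  have h4 := areaRatio_pos
  have h5 : (1 - areaRatio) * (areaRatio * (6 * volume.real (limitEight c) +
      volume.real (limitSeven c))) ≤ (1 - areaRatio) * volume.real (limitEight c) := by
    linear_combination mul_le_mul_of_nonneg_left h1 h4.le - volume.real (limitEight c) * h2
  exact le_of_mul_le_mul_left h5 (by linarith)

/-- Six copies scaled in area by less than 1/6 cannot make up the area of H₈. -/
theorem volume_limitSeven_pos (hc : c ∈ Set.Icc (0 : ℝ) 1) : 0 < volume.real (limitSeven c) := by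
  have h := volume_limitEight_eq (c := c)
  have h1 := volume_limitEight_pos hc
  have h2 := areaRatio_lt
  have h3 := areaRatio_pos
  have h4 : 0 < areaRatio * volume.real (limitSeven c) := by nlinarith
  exact pos_of_mul_pos_right h4 h3.le

theorem volume_limitPart_pos (hc : c ∈ Set.Icc (0 : ℝ) 1) (i : Fin 8) :
    0 < volume (limitPart c i) := by
  rw [limitPart]
  split_ifs
  · exact (ENNReal.toReal_pos_iff.1 (volume_limitSeven_pos hc)).1
  · exact (ENNReal.toReal_pos_iff.1 (volume_limitEight_pos hc)).1

/-- The area of the union equals the sum of the areas of the pieces, which leaves no room for an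
overlap of positive area. -/
theorem volume_inter_pieces {i j : Fin 8} (hi : i ≠ 7) (hj : j ≠ 7) (hij : i ≠ j) :
    volume (hatLimit c i '' limitPart c i ∩ hatLimit c j '' limitPart c j) = 0 := by
  set A : Fin 8 → Set ℂ := fun i => hatLimit c i '' limitPart c i
  set s : Finset (Fin 8) := {0, 1, 2, 3, 4, 5, 6}
  have hA : ∀ i, IsCompact (A i) := fun i => (isCompact_limitPart i).image (continuous_hatLimit i)
  have mem : ∀ i : Fin 8, i ≠ 7 → i ∈ s := by decide
  have hjs : j ∈ s.erase i := Finset.mem_erase.2 ⟨hij.symm, mem j hj⟩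
  have hsum : volume.real (⋃ i ∈ s, A i) = ∑ i ∈ s, volume.real (A i) := by
    have e : volume.real (⋃ i ∈ s, A i) = volume.real (limitEight c) := by rw [limitEight_eq]
    rw [e, volume_limitEight_eq]
    simp only [A, volume_real_hatLimit_image]
    simp [s, limitPart, Finset.sum_insert]
    ring
  have hcov : (⋃ l ∈ s, A l) ⊆ (A i ∪ A j) ∪ ⋃ l ∈ (s.erase i).erase j, A l := by
    refine Set.iUnion₂_subset fun l hl => ?_
    by_cases h1 : l = i
    · subst h1; exact fun x hx => Or.inl (Or.inl hx)
    · by_cases h2 : l = j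
      · subst h2; exact fun x hx => Or.inl (Or.inr hx)
      · exact fun x hx => Or.inr (Set.mem_biUnion (Finset.mem_erase.2 ⟨h2,
          Finset.mem_erase.2 ⟨h1, hl⟩⟩ : l ∈ ((s.erase i).erase j : Finset (Fin 8))) hx)
  have hfin : volume ((A i ∪ A j) ∪ ⋃ l ∈ (s.erase i).erase j, A l) ≠ ⊤ :=
    (((hA i).union (hA j)).union (((s.erase i).erase j).isCompact_biUnion
      fun l _ => hA l)).measure_lt_top.ne
  have h1 := (measureReal_mono hcov hfin).trans (measureReal_union_le _ _)
  have h2 := measureReal_biUnion_finset_le (μ := volume) ((s.erase i).erase j) A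
  have h3 := measureReal_union_add_inter (μ := volume) (s := A i) (hA j).measurableSet
    (hA i).measure_lt_top.ne (hA j).measure_lt_top.ne
  have h4 := Finset.add_sum_erase s (fun l => volume.real (A l)) (mem i hi)
  have h5 := Finset.add_sum_erase (s.erase i) (fun l => volume.real (A l)) hjs
  have h6 : volume.real (A i ∩ A j) ≤ 0 := by
    linarith
  have h7 : volume.real (A i ∩ A j) = 0 := h6.antisymm measureReal_nonneg
  rw [measureReal_def, ENNReal.toReal_eq_zero_iff] at h7
  exact h7.resolve_right ((hA i).inter (hA j)).measure_lt_top.ne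

/-! ### Limit tiles of words -/

/-- The points that have an allowed address with a given beginning. -/
def hatCylinder (c : ℝ) {k : ℕ} (u : Fin k → Fin 8) : Set ℂ :=
  codePoint (hatLimit c) '' {j | j ∈ allowed ∧ ∀ l : Fin k, j l = u l}

theorem hatCylinder_subset_image (u : Fin (k + 1) → Fin 8) :
    hatCylinder c u ⊆ hatLimit c (u 0) '' hatCylinder c fun l => u l.succ := by
  rintro _ ⟨j, ⟨hj, hu⟩, rfl⟩
  have h0 : j 0 = u 0 := hu 0
  rw [hatCode_eq, h0]
  exact ⟨_, ⟨_, ⟨tail_mem_allowed hj, fun l => hu l.succ⟩, rfl⟩, rfl⟩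

theorem hatCylinder_subset_piece (u : Fin (k + 1) → Fin 8) :
    hatCylinder c u ⊆ hatLimit c (u 0) '' limitPart c (u 0) := by
  rintro _ ⟨j, ⟨hj, hu⟩, rfl⟩
  have h0 : j 0 = u 0 := hu 0
  rw [hatCode_eq, ← h0]
  exact ⟨_, mem_limitPart (by rwa [strCons_tail]), rfl⟩

theorem hatCylinder_eq_empty {u : Fin (k + 1) → Fin 8} (h : u 0 = 7) : hatCylinder c u = ∅ := by
  refine Set.eq_empty_of_forall_notMem ?_
  rintro _ ⟨j, ⟨hj, hu⟩, rfl⟩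
  exact (hj 0).1 ((hu 0).trans h)

/-- Common first letters act by one similarity and are removed; at the first difference the
cylinders lie in different pieces. -/
theorem volume_hatCylinder_inter : ∀ (k : ℕ) (u v : Fin k → Fin 8), u ≠ v →
    volume (hatCylinder c u ∩ hatCylinder c v) = 0
  | 0, u, v, h => absurd (Subsingleton.elim u v) h
  | k + 1, u, v, h => by
    by_cases hu : u 0 = 7
    · rw [hatCylinder_eq_empty hu, Set.empty_inter, measure_empty]
    by_cases hv : v 0 = 7
    · rw [hatCylinder_eq_empty hv, Set.inter_empty, measure_empty]
    by_cases h0 : u 0 = v 0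
    · have ht : (fun l : Fin k => u l.succ) ≠ fun l => v l.succ := fun e =>
        h (funext fun i => Fin.cases h0 (fun l => congrFun e l) i)
      refine measure_mono_null (Set.inter_subset_inter (hatCylinder_subset_image u)
        (hatCylinder_subset_image v)) ?_
      rw [← h0, ← Set.image_inter (hatLimit_injective _), volume_hatLimit_image,
        volume_hatCylinder_inter k _ _ ht, mul_zero]
    · exact measure_mono_null (Set.inter_subset_inter (hatCylinder_subset_piece u)
        (hatCylinder_subset_piece v)) (volume_inter_pieces hu hv h0)

theorem volume_hatCylinder_pos (hc : c ∈ Set.Icc (0 : ℝ) 1) : ∀ (k : ℕ) (u : Fin (k + 1) → Fin 8),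
    Avoids71 u → (∀ l, u l ≠ 7) → 0 < volume (hatCylinder c u)
  | 0, u, _, h7 => by
    have hsub : hatLimit c (u 0) '' limitPart c (u 0) ⊆ hatCylinder c u := by
      rintro _ ⟨y, hy, rfl⟩
      obtain ⟨j, hj, rfl⟩ := exists_of_mem_limitPart (h7 0) hy
      refine ⟨_, ⟨hj, fun l => ?_⟩, hatCode_strCons _ _⟩
      rw [Fin.fin_one_eq_zero l]; rfl
    refine lt_of_lt_of_le ?_ (measure_mono hsub)
    rw [volume_hatLimit_image]
    exact ENNReal.mul_pos (ENNReal.ofReal_pos.2 areaRatio_pos).ne' (volume_limitPart_pos hc _).ne'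
  | k + 1, u, h6, h7 => by
    have ih := volume_hatCylinder_pos hc k (fun l => u l.succ) (fun l => h6 l.succ) fun l => h7 _
    have hsub : hatLimit c (u 0) '' hatCylinder c (fun l => u l.succ) ⊆ hatCylinder c u := by
      rintro _ ⟨_, ⟨j, ⟨hj, hu⟩, rfl⟩, rfl⟩
      refine ⟨_, ⟨strCons_mem_allowed.2 ⟨h7 0, ?_, hj⟩, fun l => ?_⟩, hatCode_strCons _ _⟩
      · rintro ⟨h0, h1⟩
        exact h6 0 ⟨h0, (hu 0).symm.trans h1⟩
      · exact Fin.cases rfl (fun l => hu l) l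
    refine lt_of_lt_of_le ?_ (measure_mono hsub)
    rw [volume_hatLimit_image]
    exact ENNReal.mul_pos (ENNReal.ofReal_pos.2 areaRatio_pos).ne' ih.ne'

/-- The beginnings of the top addresses of the limit system. -/
theorem exists_topCodeSpace_iff (hc : c ∈ Set.Icc (0 : ℝ) 1) (u : Fin (k + 1) → Fin 8) :
    (∃ j ∈ topCodeSpace (hatLimit c), ∀ l : Fin (k + 1), j l = u l) ↔
      Avoids71 u ∧ ∀ l, u l ≠ 7 := by
  constructor
  · rintro ⟨j, hj, hu⟩
    have hj := topCodeSpace_subset_allowed hj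
    refine ⟨fun l => ?_, fun l => ?_⟩
    · rw [← hu, ← hu]
      exact (hj l).2
    · rw [← hu]
      exact (hj l).1
  · rintro ⟨h6, h7⟩
    -- There are only finitely many words of the given length, so the cylinder of u keeps positive
    -- area when its overlaps with the others are removed.
    have hnull : volume (⋃ v ∈ {v | u ≠ v}, hatCylinder c u ∩ hatCylinder c v) = 0 :=
      (measure_biUnion_null_iff (Set.to_countable _)).2 fun v hv =>
        volume_hatCylinder_inter _ u v hv
    obtain ⟨p, hp, hp'⟩ := nonempty_of_measure_ne_zero (μ := volume)
      (s := hatCylinder c u \ ⋃ v ∈ {v | u ≠ v}, hatCylinder c u ∩ hatCylinder c v)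
      (by rw [measure_sdiff_null hnull]; exact (volume_hatCylinder_pos hc k u h6 h7).ne')
    obtain ⟨i, hi, rfl⟩ := hp
    -- The top address of such a point is allowed; a different beginning would place the point in
    -- another cylinder.
    obtain ⟨j, hj, e⟩ := exists_mem_topCodeSpace (c := c) i
    refine ⟨j, hj, fun l => ?_⟩
    by_contra hne
    refine hp' (Set.mem_biUnion (x := fun l : Fin (k + 1) => j l) (fun e => hne ?_)
      ⟨⟨i, hi, rfl⟩, j, ⟨topCodeSpace_subset_allowed hj, fun _ => rfl⟩, e⟩)
    exact (congrFun e l).symm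

end

/-! ### The tiling SIFS -/

noncomputable section

variable {c : ℝ} {n k : ℕ}

/-! ### The tiling system -/

theorem dist_hatSIFS (n : ℕ) (i : Fin 8) (x y : ℂ) :
    dist (hatSIFS c (n + 1) i x) (hatSIFS c (n + 1) i y) = hatRatio * dist x y := by
  have hn : hatRatio ^ n ≠ 0 := (pow_pos hatRatio_pos n).ne'
  rw [hatSIFS_eq, hatSIFS_eq, dist_eq_norm, ← mul_sub, norm_mul, ← dist_eq_norm,
    IsometryEquiv.dist_eq, dist_eq_norm, ← mul_sub, norm_mul, norm_inv, norm_pow, norm_pow,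
    norm_hatRatio, ← dist_eq_norm, pow_succ', mul_assoc, mul_inv_cancel_left₀ hn]

theorem isHomeomorph_hatSIFS (n : ℕ) (i : Fin 8) : IsHomeomorph (hatSIFS c (n + 1) i) := by
  have h := (((Homeomorph.mulLeft₀ _ (inv_ne_zero (pow_ne_zero n hatRatio_ne_zero))).trans
    (levelMove (1 - c) c n i).toHomeomorph).trans
    (Homeomorph.mulLeft₀ _ (pow_ne_zero (n + 1) hatRatio_ne_zero))).isHomeomorph
  convert h using 1
  funext z
  exact hatSIFS_eq n i z

theorem isHomeomorph_hatLimit (i : Fin 8) : IsHomeomorph (hatLimit c i) := by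
  have h := ((Homeomorph.mulLeft₀ (hatRatio * hexRoot ^ (motion (letterPlace i)).1 : ℂ)
    (mul_ne_zero hatRatio_ne_zero (pow_ne_zero _ hexRoot_ne_zero))).trans (Homeomorph.addRight
    (hatRatio * baseScale (1 - c) c * (motion (letterPlace i)).2.lead))).isHomeomorph
  convert h using 1
  funext z
  simp [hatLimit, placeLimit, mul_assoc]

theorem isIFS_hatLimit : IsIFS (hatLimit c) :=
  ⟨hatRatio, hatRatio_pos, hatRatio_lt_one, fun i => ⟨isHomeomorph_hatLimit i, dist_hatLimit_le i⟩⟩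

theorem isSIFS_hatSIFS : IsSIFS hatRatio (hatSIFS c) where
  isIFS := by
    rintro (_ | n) hn
    · exact absurd hn (by norm_num)
    · exact ⟨hatRatio, hatRatio_pos, hatRatio_lt_one, fun i =>
        ⟨isHomeomorph_hatSIFS n i, fun x y => (dist_hatSIFS n i x y).le⟩⟩
  ratio := by
    rintro (_ | n) hn
    · exact absurd hn (by norm_num)
    · exact dist_hatSIFS n
  exists_limit := ⟨_, isIFS_hatLimit, convergesTo_hatLimit c⟩

theorem isTile_hatTile (hc : c ∈ Set.Icc (0 : ℝ) 1) : IsTile (hatTile c) := by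
  have hd := isDisc_hatTile hc
  exact ⟨hd.nonempty.mono (hd.closure_eq ▸ subset_closure), hd.compact, hd.homeo⟩

theorem isSIFSSystem_hat (hc : c ∈ Set.Icc (0 : ℝ) 1) :
    IsSIFSSystem hatRatio (hatSIFS c) {hatTile c} (fun _ => hatTile c) where
  isSIFS := isSIFS_hatSIFS
  finite := Set.finite_singleton _
  isTile := by
    rintro t rfl
    exact isTile_hatTile hc
  card_lt := by rw [Set.ncard_singleton]; norm_num
  range_eq := Set.range_const

theorem secondCondition (hc : c ∈ Set.Icc (0 : ℝ) 1) :
    SecondCondition hatRatio (hatSIFS c) {hatTile c} (fun _ => hatTile c) := by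
  refine ⟨_, isIFS_hatLimit, convergesTo_hatLimit c, fun k u => ?_⟩
  rw [tileAddresses_eq hc]
  constructor
  · rintro ⟨w, hw, hu⟩
    -- Replaces a final letter `8` by `6`, which has the same limit map and creates no new `71`.
    set g : Fin 8 → Fin 8 := fun i => (letterPlace i).castSucc
    have g7 : ∀ i, g i ≠ 7 := by decide
    have g6 : ∀ i, g i = 6 → i = 6 := by decide
    have g0 : ∀ i, g i = 0 → i = 0 := by decide
    have gg : ∀ i, letterPlace (g i) = letterPlace i := by decide
    obtain ⟨j, hj, e⟩ := (exists_topCodeSpace_iff hc fun l => g (w l)).2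
      ⟨fun l h => hw.1 l ⟨g6 _ h.1, g0 _ h.2⟩, fun l => g7 _⟩
    refine ⟨j, hj, fun l => ?_⟩
    rw [hu, e, hatLimit, hatLimit, gg]
  · rintro ⟨j, hj, e⟩
    have h := (exists_topCodeSpace_iff hc fun l : Fin (k + 1) => j l).1 ⟨j, hj, fun _ => rfl⟩
    exact ⟨_, ⟨h.1, fun l => h.2 _⟩, e⟩

end

theorem theorem2 (c : ℝ) (hc : c ∈ Set.Icc (0 : ℝ) 1) :
    -- the system is a tiling SIFS
    IsTilingSIFS hatRatio (hatSIFS c) {hatTile c} (fun _ => hatTile c) ∧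
    -- the addresses of the tiles that do not vanish are the words avoiding `71`, where the
    -- index `8`, which repeats the index `6` from level `2` on, is used only at level `1`
    (∀ k : ℕ, tileAddresses hatRatio (hatSIFS c) {hatTile c} (fun _ => hatTile c) k =
      {w | Avoids71 w ∧ ∀ l : Fin k, w l.castSucc ≠ 7}) ∧
    -- tiles that do not vanish are not changed by processing
    (∀ (k : ℕ), ∀ w ∈ tileAddresses hatRatio (hatSIFS c) {hatTile c} (fun _ => hatTile c) k,
      processedTile (hatSIFS c) (fun _ => hatTile c) w =
        tileAt (hatSIFS c) (fun _ => hatTile c) w) ∧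
    -- the truncations of the top addresses of the limit system are the words avoiding `71`
    -- in the non-redundant letters `1, …, 7`
    (∀ f : Fin 8 → ℂ → ℂ, ConvergesTo (hatSIFS c) f →
      ∀ (k : ℕ) (u : Fin (k + 1) → Fin 8),
        (∃ j ∈ topCodeSpace f, ∀ l : Fin (k + 1), j l = u l) ↔
          (Avoids71 u ∧ ∀ l, u l ≠ 7)) ∧
    -- the exact overlap of consecutive supertiles
    (∀ n : ℕ, 1 ≤ n →
      hatSIFS c (n + 1) 5 ∘ hatSIFS c n 6 = hatSIFS c (n + 1) 6 ∘ hatSIFS c n 0) ∧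
    -- the processed collections are the supertiles of the imperfect substitution
    (∀ k : ℕ, processedCollection (hatSIFS c) (fun _ => hatTile c) k =
      (hatSupertiles c k).1) := by
  refine ⟨⟨isSIFSSystem_hat hc, firstCondition hc, secondCondition hc⟩, tileAddresses_eq hc,
    fun k w hw => ?_, fun f hf k u => ?_, fun n hn => ?_, processedCollection_eq hc⟩
  · rw [tileAddresses_eq hc] at hw
    exact processedTile_of_admissible hc hw
  · rw [eq_hatLimit hf]
    exact exists_topCodeSpace_iff hc u
  · obtain ⟨n, rfl⟩ : ∃ m, n = m + 1 := ⟨n - 1, by omega⟩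
    exact hatSIFS_comp n
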